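/- Let $1\le d\le N$ be integers. Let $\mathrm dU$ be Haar measure of mass one on the unitary group $\mathrm U(N)$. For complex $N\times N$ matrices $A,B$ and $z\in\mathbb C$ put $$I_N^{(1)}(z)=\int_{\mathrm U(N)}e^{\sqrt z\,N\,\mathrm{Tr}(AU+BU^{-1})}\,\mathrm dU,\qquad I_N^{(2)}(z)=\int_{\mathrm U(N)}e^{zN\,\mathrm{Tr}(AUBU^{-1})}\,\mathrm dU$$ (the BGW and HCIZ integrals), and $$I_N^{(0)}(z)=1+\sum_{k\ge1}z^kN^{2k}\sum_{\lambda\vdash k,\ \ell(\lambda)\le N}\ \prod_{\square\in\lambda}\frac1{h(\square)^2\bigl(1+\frac{c(\square)}N\bigr)},$$ where $\ell(\lambda)$ is the number of rows of the Young diagram $\lambda$, and $h$, $c$ are hook length and content. For $m=0,1,2$ let $I_N^{(m)d}$ (the degree-$d$ coupling coefficient) be the coefficient of $z^d/d!$ in the Maclaurin series of the entire function $I_N^{(m)}$. For $m=1$ let $a_1,\dots,a_N$ be the eigenvalues of $AB$; for $m=2$ let $a_1,\dots,a_N$ and $b_1,\dots,b_N$ be the eigenvalues of $A$ and of $B$ (with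 algebraic multiplicity). For partitions $\alpha,\beta\vdash d$ let $\vec W^r(\alpha,\beta)$ be the number of monotone $r$-step walks on the Cayley graph of the symmetric group $\mathrm S(d)$, generated by all transpositions, which start at a permutation of cycle type $\alpha$ and end at one of cycle type $\beta$; a walk is monotone if the labels of its successive edges weakly increase, where an edge given by the transposition $(s\ t)$, $s<t$, has label $t$. For $g\in\mathbb Z$ define the disconnected monotone double, single and simple Hurwitz numbers by $$\vec H^\bullet_g(\alpha,\beta)=\vec W^{2g-2+\ell(\alpha)+\ell(\beta)}(\alpha,\beta),\qquad \vec H_g^\bullet(\alpha)=\vec H_g^\bullet(\alpha,1^d),\qquad \vec H_g^{\bullet d}=\vec H_g^\bullet(1^d),$$ with $\vec W^r=0$ for $r<0$. Let $p_\alpha(x_1,\dots,x_N)=\prod_{i=1}^{\ell(\alpha)}\sum_{j=1}^N x_j^{\alpha_i}$, and let $\|\cdot\|$ be the sup norm over the closed unit polydisc in $\mathbb C^{mN}$ (the absolute value if $m=0$). Then, for each $m\in\{0,1,2\}$, $$I_N^{(m)d}=\sum_{g=-d+1}^\infty N^{2-2g}\,I_{Ng}^{(m)d},$$ for all $A,B$,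 where $$I_{Ng}^{(0)d}=\vec H_g^{\bullet d},\qquad I_{Ng}^{(1)d}=\sum_{\alpha\vdash d}\frac{p_\alpha(a_1,\dots,a_N)}{N^{\ell(\alpha)}}(-1)^{\ell(\alpha)+d}\,\vec H_g^\bullet(\alpha),$$ $$I_{Ng}^{(2)d}=\sum_{\alpha,\beta\vdash d}\frac{p_\alpha(a_1,\dots,a_N)}{N^{\ell(\alpha)}}\frac{p_\beta(b_1,\dots,b_N)}{N^{\ell(\beta)}}(-1)^{\ell(\alpha)+\ell(\beta)}\,\vec H_g^\bullet(\alpha,\beta).$$ As polynomials, $I_{Ng}^{(1)d}$ is homogeneous of degree $d$ in $a_1,\dots,a_N$, and $I_{Ng}^{(2)d}$ is homogeneous of degree $d$ in $a_1,\dots,a_N$ and of degree $d$ in $b_1,\dots,b_N$. The series is absolutely convergent in norm: $\sum_{g\ge -d+1}N^{2-2g}\|I_{Ng}^{(m)d}\|<\infty$; and it converges absolutely at every point of $\mathbb C^{mN}$. -/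

import Mathlib

open MeasureTheory

noncomputable section

namespace TopExpansion

/-! ### Monotone walks and disconnected monotone Hurwitz numbers -/

/-- `w` is a monotone `r`-step walk on the Cayley graph of the symmetric group `S(d)` generated by
all transpositions: the `i`-th step multiplies by the transposition `(s i  t i)` with `s i < t i`,
the label of the edge it traverses is `t i` (the larger of the two points interchanged), and the
labels form a weakly increasing sequence. The sequences `s` and `t` are determined by `w`. -/
def IsMonotoneWalk {d r : ℕ} (w : Fin (r + 1) → Equiv.Perm (Fin d)) : Prop :=
  ∃ s t : Fin r → Fin d, (∀ i, s i < t i) ∧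
    (∀ i : Fin r, w i.succ = w i.castSucc * Equiv.swap (s i) (t i)) ∧ Monotone t

/-- The permutation `π` of `{1, …, d}` has cycle type `α ⊢ d` (fixed points are parts equal
to `1`). -/
def HasType {d : ℕ} (π : Equiv.Perm (Fin d)) (α : d.Partition) : Prop :=
  π.partition.parts = α.parts

/-- The number of monotone `r`-step walks on the Cayley graph of `S(d)` which begin at a
permutation of cycle type `α` and end at a permutation of cycle type `β`. -/
def monotoneWalkCount {d : ℕ} (r : ℕ) (α β : d.Partition) : ℕ :=
  Nat.card {w : Fin (r + 1) → Equiv.Perm (Fin d) //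
    IsMonotoneWalk w ∧ HasType (w 0) α ∧ HasType (w (Fin.last r)) β}

/-- The number of rows `ℓ(α)` of `α`. -/
def len {d : ℕ} (α : d.Partition) : ℕ := α.parts.card

/-- The partition `1^d`. -/
def ones (d : ℕ) : d.Partition where
  parts := Multiset.replicate d 1
  parts_pos := by
    intro i hi
    rw [Multiset.eq_of_mem_replicate hi]
    exact Nat.one_pos
  parts_sum := by simp

/-- The disconnected monotone double Hurwitz number of genus `g` (possibly negative): the number of
monotone walks from `α` to `β` with `2g - 2 + ℓ(α) + ℓ(β)` steps (zero if this is negative). -/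
def doubleHurwitz {d : ℕ} (g : ℤ) (α β : d.Partition) : ℕ :=
  if 0 ≤ 2 * g - 2 + (len α : ℤ) + (len β : ℤ) then
    monotoneWalkCount (2 * g - 2 + (len α : ℤ) + (len β : ℤ)).toNat α β
  else 0

/-- The disconnected monotone single Hurwitz number. -/
def singleHurwitz {d : ℕ} (g : ℤ) (α : d.Partition) : ℕ := doubleHurwitz g α (ones d)

/-- The disconnected monotone simple Hurwitz number of degree `d`. -/
def simpleHurwitz (d : ℕ) (g : ℤ) : ℕ := singleHurwitz g (ones d)

/-! ### Haar measure on the unitary group -/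

/-- The unitary group `U(N)`. -/
abbrev U (N : ℕ) : Type := Matrix.unitaryGroup (Fin N) ℂ

instance (N : ℕ) : CompactSpace (U N) := by
  refine (isCompact_iff_compactSpace (s := (Matrix.unitaryGroup (Fin N) ℂ :
    Set (Matrix (Fin N) (Fin N) ℂ)))).1 ?_
  refine IsCompact.of_isClosed_subset
    (s := Set.pi Set.univ fun _ : Fin N => Set.pi Set.univ fun _ : Fin N =>
      Metric.closedBall (0 : ℂ) 1) ?_ ?_ ?_
  · exact isCompact_univ_pi fun _ => isCompact_univ_pi fun _ => isCompact_closedBall _ _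
  · have h : ((Matrix.unitaryGroup (Fin N) ℂ : Set (Matrix (Fin N) (Fin N) ℂ)))
        = {M | star M * M = 1} ∩ {M | M * star M = 1} := by
      ext M
      simp [Unitary.mem_iff]
    rw [h]
    exact (isClosed_eq (by fun_prop) continuous_const).inter
      (isClosed_eq (by fun_prop) continuous_const)
  · intro M hM i _ j _
    simpa using entry_norm_bound_of_unitary hM i j

instance (N : ℕ) : MeasurableSpace (U N) := borel (U N)

instance (N : ℕ) : BorelSpace (U N) := ⟨rfl⟩

/-- The Haar measure on `U(N)` of total mass one. -/
def haarU (N : ℕ) : Measure (U N) := Measure.haarMeasure ⊤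

/-! ### The three functions of the inverse coupling parameter -/

/-- The Bars-Green/Brézin-Gross-Witten/Wadia integral
`∫ exp(√z N Tr(A U + B U⁻¹)) dU` with the principal square root (the integral is an even
function of `√z`). -/
def BGW (N : ℕ) (A B : Matrix (Fin N) (Fin N) ℂ) (z : ℂ) : ℂ :=
  ∫ V : U N, Complex.exp (z ^ (1 / 2 : ℂ) * (N : ℂ) *
    (A * (V : Matrix (Fin N) (Fin N) ℂ)
      + B * ((V⁻¹ : U N) : Matrix (Fin N) (Fin N) ℂ)).trace) ∂(haarU N)

/-- The Harish-Chandra/Itzykson-Zuber integral `∫ exp(z N Tr(A U B U⁻¹)) dU`. -/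
def HCIZ (N : ℕ) (A B : Matrix (Fin N) (Fin N) ℂ) (z : ℂ) : ℂ :=
  ∫ V : U N, Complex.exp (z * (N : ℂ) *
    (A * (V : Matrix (Fin N) (Fin N) ℂ) * B
      * ((V⁻¹ : U N) : Matrix (Fin N) (Fin N) ℂ)).trace) ∂(haarU N)

/-- The content of the cell in row `c.1` and column `c.2`. -/
def content (c : ℕ × ℕ) : ℤ := (c.2 : ℤ) - (c.1 : ℤ)

/-- The hook length of a cell `c` of the Young diagram `μ`: the cell itself, the cells to its right
in its row and the cells below it in its column. -/
def hook (μ : YoungDiagram) (c : ℕ × ℕ) : ℕ :=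
  (μ.rowLen c.1 - c.2 - 1) + (μ.colLen c.2 - c.1 - 1) + 1

lemma finite_card_eq (d : ℕ) : {μ : YoungDiagram | μ.card = d}.Finite := by
  apply Set.Finite.of_finite_image (f := YoungDiagram.cells)
  · refine Set.Finite.subset
      ((Finset.range d ×ˢ Finset.range d).powerset.finite_toSet) ?_
    rintro _ ⟨μ, hμ, rfl⟩
    have hμ' : μ.cells.card = d := hμ
    simp only [Finset.coe_powerset, Set.mem_preimage, Set.mem_powerset_iff,
      Finset.coe_subset]
    rintro ⟨i, j⟩ hc
    have hc' : (i, j) ∈ μ := (YoungDiagram.mem_cells _).1 hc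
    have h1 : μ.rowLen i ≤ d := by
      rw [YoungDiagram.rowLen_eq_card, ← hμ']
      exact Finset.card_le_card (Finset.filter_subset _ _)
    have h2 : μ.colLen j ≤ d := by
      rw [YoungDiagram.colLen_eq_card, ← hμ']
      exact Finset.card_le_card (Finset.filter_subset _ _)
    rw [Finset.mem_product, Finset.mem_range, Finset.mem_range]
    exact ⟨lt_of_lt_of_le (YoungDiagram.mem_iff_lt_colLen.1 hc') h2,
      lt_of_lt_of_le (YoungDiagram.mem_iff_lt_rowLen.1 hc') h1⟩
  · intro μ _ ν _ h
    exact YoungDiagram.ext h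

/-- The finite set of Young diagrams with `d` cells and at most `N` rows. -/
def diagrams (d N : ℕ) : Finset YoungDiagram :=
  {μ ∈ (finite_card_eq d).toFinset | μ.colLen 0 ≤ N}

/-- The entire function
`1 + ∑_{d ≥ 1} z^d N^{2d} ∑_{λ ⊢ d, ℓ(λ) ≤ N} ∏_{□ ∈ λ} 1 / (h(□)² (1 + c(□)/N))`
(the summand `d = 0`, which is the empty diagram, contributes the constant term `1`). -/
def I0 (N : ℕ) (z : ℂ) : ℂ :=
  ∑' d : ℕ, z ^ d * (N : ℂ) ^ (2 * d) * ∑ μ ∈ diagrams d N, ∏ c ∈ μ.cells,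
    1 / ((hook μ c : ℂ) ^ 2 * (1 + (content c : ℂ) / (N : ℂ)))

/-- The degree-`d` coupling coefficient of a function of the inverse coupling `z`: the coefficient
of `z^d / d!` in its Maclaurin series. -/
def couplingCoeff (I : ℂ → ℂ) (d : ℕ) : ℂ := iteratedDeriv d I 0

/-! ### The topological coefficients -/

/-- The genus `g` coefficient for `m = 0`. -/
def topCoeff0 (d : ℕ) (g : ℤ) : ℂ := (simpleHurwitz d g : ℂ)

/-- The genus `g` coefficient for `m = 1`, a polynomial in `a_1, …, a_N`. -/
def topCoeff1 (N d : ℕ) (g : ℤ) : MvPolynomial (Fin N) ℂ :=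
  ∑ α : d.Partition,
    MvPolynomial.C ((1 / (N : ℂ) ^ len α) * (-1) ^ (len α + d) * (singleHurwitz g α : ℂ))
      * MvPolynomial.psumPart (Fin N) ℂ α

/-- The genus `g` coefficient for `m = 2`, a polynomial in `a_1, …, a_N` (left summand) and
`b_1, …, b_N` (right summand). -/
def topCoeff2 (N d : ℕ) (g : ℤ) : MvPolynomial (Fin N ⊕ Fin N) ℂ :=
  ∑ α : d.Partition, ∑ β : d.Partition,
    MvPolynomial.C ((1 / (N : ℂ) ^ len α) * (1 / (N : ℂ) ^ len β) * (-1) ^ (len α + len β)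
        * (doubleHurwitz g α β : ℂ))
      * MvPolynomial.rename Sum.inl (MvPolynomial.psumPart (Fin N) ℂ α)
      * MvPolynomial.rename Sum.inr (MvPolynomial.psumPart (Fin N) ℂ β)

/-- Sup norm of a polynomial on the closed unit polydisc. -/
def polydiscNorm {σ : Type} (p : MvPolynomial σ ℂ) : ℝ :=
  ⨆ x : {x : σ → ℂ // ∀ i, ‖x i‖ ≤ 1}, ‖MvPolynomial.eval x.1 p‖

/-- `a` lists the eigenvalues of `A` with algebraic multiplicity. -/
def IsSpectrum {N : ℕ} (A : Matrix (Fin N) (Fin N) ℂ) (a : Fin N → ℂ) : Prop :=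
  A.charpoly = ∏ i, (Polynomial.X - Polynomial.C (a i))

/-- The genera `g ≥ -d + 1`. -/
abbrev Genus (d : ℕ) : Type := {g : ℤ // -(d : ℤ) + 1 ≤ g}

end TopExpansion

end

noncomputable section

namespace TopExpansion

/-! ### Traces of tensor powers against permutations -/

/-! All three expansions rest on one function on S(d): the convolution inverse of π ↦ N^(cyc π − d)
(`normTrace`). With the Jucys-Murphy elements J_n = ∑_{s<n} (s n), the group algebra element ∑_π
N^(cyc π − d) π factors as ∏_{n<d} (1 + J_n/N); `normTraceBelow_succ` is one step of this
factorisation. The inverse is therefore ∑_r (−1/N)^r h_r(J_0, …, J_{d−1}), and the coefficient of g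
in h_r counts the factorisations of g into r transpositions with weakly increasing labels, that is,
monotone walks (`sum_monoGen_mul_normTrace`, `card_walks`). Convergence holds because d − 1 < N. The
sign character forces r + ℓ(α) + ℓ(β) to be even, so r can be traded for a genus, and all signs and
powers of N collapse to N^(2−2g) (`hasSum_doubleHurwitz`).

For m = 1, 2 the coupling coefficient is an integral of a product of traces. The average over U(N)
of the conjugates of an operator on (ℂ^N)^{⊗d} commutes with all tensor powers, hence is a
combination of permutations as d ≤ N (`exists_eq_sum_permMat`). Its coefficients solve a linear
system whose matrix is convolution by `normTrace`, and the inverse above solves it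
(`average_eq_sum`). Traces of permutations against tensor powers are products of power sums of
eigenvalues (`trace_tens_mul_permMat`, `prod_trace_pow`).

For m = 0 the value of the inverse at the identity has to be a Plancherel average of h_r of contents
(`monoCount_transp_one`). No representations are constructed. Instead `Eigen` formally attaches to a
polynomial in Jucys-Murphy elements a function of partitions, and `Eigen.coeff_one` computes the
coefficient of the identity by induction on n. The induction works because the conditional
expectation of J_n^k onto the algebra of S(n) satisfies the same recursion (`moment_succ`) as the
k-th moment of the content of the cell added by Plancherel growth (`transMoment_addCell`). The facts
needed about dimensions are identities for Vandermonde products under unit shifts, and the hook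
formula is `dimv_rows_sq`. -/

lemma sum_prod_path {ι : Type*} [Fintype ι] [DecidableEq ι] (A : Matrix ι ι ℂ) (m : ℕ) :
    ∀ w : ι → ι → ℂ, ∑ J : Fin (m + 1) → ι,
      (∏ i : Fin m, A (J i.castSucc) (J i.succ)) * w (J 0) (J (Fin.last m))
        = ∑ i, ∑ j, (A ^ m) i j * w i j := by
  -- The endpoint weight stays arbitrary because the induction absorbs the last edge into it: `w` is
  -- replaced by (i, j) ↦ A j x * w i x.
  induction m with
  | zero =>
    intro w
    rw [← (Equiv.funUnique (Fin 1) ι).symm.sum_comp]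
    simp [Matrix.one_apply]
  | succ m ih =>
    intro w
    rw [← (Fin.snocEquiv (fun _ : Fin (m + 2) => ι)).sum_comp, Fintype.sum_prod_type]
    simp only [Fin.snocEquiv, Equiv.coe_fn_mk]
    have key : ∀ (x : ι) (J : Fin (m + 1) → ι),
        (∏ i : Fin (m + 1), A ((Fin.snoc J x : Fin (m + 2) → ι) i.castSucc)
          ((Fin.snoc J x : Fin (m + 2) → ι) i.succ))
          * w ((Fin.snoc J x : Fin (m + 2) → ι) 0)
            ((Fin.snoc J x : Fin (m + 2) → ι) (Fin.last (m + 1)))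
        = (∏ i : Fin m, A (J i.castSucc) (J i.succ))
          * (fun i j => A j x * w i x) (J 0) (J (Fin.last m)) := by
      intro x J
      rw [Fin.prod_univ_castSucc]
      have h0 : (Fin.snoc J x : Fin (m + 2) → ι) 0 = J 0 := by
        rw [← Fin.castSucc_zero, Fin.snoc_castSucc (α := fun _ => ι)]
      have h1 : ∀ i : Fin m, (Fin.snoc J x : Fin (m + 2) → ι) i.castSucc.succ = J i.succ := by
        intro i
        rw [Fin.succ_castSucc, Fin.snoc_castSucc (α := fun _ => ι)]
      simp only [Fin.snoc_castSucc (α := fun _ => ι), Fin.succ_last, Fin.snoc_last, h0, h1]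
      ring
    rw [Finset.sum_congr rfl fun x _ =>
      (Finset.sum_congr rfl fun J _ => key x J).trans (ih fun i j => A j x * w i x)]
    have : ∀ i j, (A ^ (m + 1)) i j = ∑ k, (A ^ m) i k * A k j := by
      intro i j; rw [pow_succ, Matrix.mul_apply]
    simp only [this, Finset.sum_mul]
    rw [Finset.sum_comm]
    refine Finset.sum_congr rfl fun i _ => Finset.sum_congr rfl fun j _ =>
      Finset.sum_congr rfl fun k _ => ?_
    ring

lemma sum_prod_cyclic {ι : Type*} [Fintype ι] [DecidableEq ι] (A : Matrix ι ι ℂ) (m : ℕ)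
    [NeZero m] :
    ∑ J : Fin m → ι, ∏ i : Fin m, A (J i) (J (i + 1)) = (A ^ m).trace := by
  obtain ⟨m, rfl⟩ := Nat.exists_eq_succ_of_ne_zero (NeZero.ne m)
  have h := sum_prod_path A m (fun i j => A j i)
  rw [pow_succ, Matrix.trace]
  simp only [Matrix.diag_apply, Matrix.mul_apply, ← h]
  refine Finset.sum_congr rfl fun J _ => ?_
  rw [Fin.prod_univ_castSucc]
  simp

/-- The iterates of a moved point list the support, and addition in `Fin` wraps round correctly
because the order of a cycle is the size of its support. -/
lemma IsCycle.exists_equiv {α : Type*} [Fintype α] [DecidableEq α] {σ : Equiv.Perm α}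
    (hσ : σ.IsCycle) [NeZero σ.support.card] :
    ∃ e : Fin σ.support.card ≃ σ.support, ∀ i, σ (e i) = e (i + 1) := by
  obtain ⟨x, hx, -⟩ := id hσ
  have hc : ∀ i : ℕ, (σ ^ i) x ∈ σ.support := fun i => by
    rw [Equiv.Perm.pow_apply_mem_support, Equiv.Perm.mem_support]; exact hx
  have ho : orderOf σ = σ.support.card := hσ.orderOf
  let f : Fin σ.support.card → σ.support := fun i => ⟨(σ ^ (i : ℕ)) x, hc i⟩
  have hs : Function.Surjective f := by
    rintro ⟨y, hy⟩
    obtain ⟨i, hi, h⟩ := (hσ.sameCycle hx (Equiv.Perm.mem_support.1 hy)).exists_pow_eq'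
    exact ⟨⟨i, ho ▸ hi⟩, Subtype.ext h⟩
  have hb : Function.Bijective f := by
    rw [Fintype.bijective_iff_surjective_and_card]
    exact ⟨hs, by rw [Fintype.card_fin, Fintype.card_coe]⟩
  refine ⟨Equiv.ofBijective f hb, fun i => ?_⟩
  simp only [Equiv.ofBijective_apply, f]
  rw [← Equiv.Perm.mul_apply, ← pow_succ', Fin.val_add]
  have hm := pow_mod_orderOf σ ((i : ℕ) + ((1 : Fin σ.support.card) : ℕ))
  rw [ho, Fin.val_one', Nat.mod_eq_of_lt hσ.two_le_card_support] at hm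
  rw [Fin.val_one', Nat.mod_eq_of_lt hσ.two_le_card_support, hm]

/-- The auxiliary `g`, blind to the coordinates in the support, lets the induction treat disjoint
cycles one at a time: the product over the other cycle is absorbed into `g`. The power of
`Fintype.card ι` compensates for summing `g` over the blind coordinates. -/
lemma sum_prod_support {α ι : Type*} [Fintype α] [DecidableEq α] [Fintype ι] [DecidableEq ι]
    [Nonempty ι] (A : Matrix ι ι ℂ) (σ : Equiv.Perm α) :
    ∀ g : (α → ι) → ℂ, (∀ I I', (∀ k, k ∉ σ.support → I k = I' k) → g I = g I') →
      (Fintype.card ι : ℂ) ^ σ.support.card *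
        ∑ I : α → ι, (∏ k ∈ σ.support, A (I k) (I (σ k))) * g I
      = (σ.cycleType.map fun c => (A ^ c).trace).prod * ∑ I : α → ι, g I := by
  induction σ using Equiv.Perm.cycle_induction_on with
  | base_one => intro g _; simp
  | base_cycles σ hσ =>
    intro g hg
    have : NeZero σ.support.card := ⟨by have := hσ.two_le_card_support; omega⟩
    obtain ⟨e, he⟩ := IsCycle.exists_equiv hσ
    let E := (Equiv.piEquivPiSubtypeProd (fun k => k ∈ σ.support) (fun _ => ι)).symm
    obtain ⟨j0⟩ := ‹Nonempty ι›
    have hE1 : ∀ J K (k : σ.support), E (J, K) k = J k := by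
      intro J K k
      have hk := k.2
      simp only [E, Equiv.piEquivPiSubtypeProd, Equiv.coe_fn_symm_mk]
      rw [dif_pos hk]
    have hg' : ∀ J K, g (E (J, K)) = g (E (fun _ => j0, K)) := by
      intro J K
      refine hg _ _ fun k hk => ?_
      simp only [E, Equiv.piEquivPiSubtypeProd, Equiv.coe_fn_symm_mk]
      simp [hk]
    have hsum : ∀ J : σ.support → ι, ∀ K, ∏ k ∈ σ.support, A (E (J, K) k) (E (J, K) (σ k))
        = ∏ i, A (J (e i)) (J (e (i + 1))) := by
      intro J K
      rw [← Finset.prod_coe_sort, ← e.prod_comp]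
      simp only [he, hE1]
    have hJ : ∑ J : σ.support → ι, ∏ i, A (J (e i)) (J (e (i + 1)))
        = (A ^ σ.support.card).trace := by
      rw [← sum_prod_cyclic]
      exact (e.symm.arrowCongr (Equiv.refl ι)).sum_comp
        (fun J : Fin σ.support.card → ι => ∏ i, A (J i) (J (i + 1)))
    rw [hσ.cycleType, Multiset.map_singleton, Multiset.prod_singleton, ← hJ]
    rw [← E.sum_comp, ← E.sum_comp g, Fintype.sum_prod_type, Fintype.sum_prod_type]
    simp only [hg', hsum]
    simp only [← Finset.mul_sum, ← Finset.sum_mul, Finset.sum_const, Finset.card_univ,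
      Fintype.card_fun, Fintype.card_coe, nsmul_eq_mul, Nat.cast_pow]
    ring
  | induction_disjoint σ τ hd hc h1 h2 =>
    intro g hg
    have hds := hd.disjoint_support
    rw [hd.card_support_mul, hd.support_mul, hd.cycleType_mul, Multiset.map_add, Multiset.prod_add]
    have hW : ∀ I : α → ι, (∏ k ∈ σ.support ∪ τ.support, A (I k) (I ((σ * τ) k))) * g I
        = (∏ k ∈ σ.support, A (I k) (I (σ k))) *
          ((∏ k ∈ τ.support, A (I k) (I (τ k))) * g I) := by
      intro I
      rw [Finset.prod_union hds, mul_assoc]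
      congr 1
      · refine Finset.prod_congr rfl fun k hk => ?_
        have : τ k = k := by
          by_contra h
          exact Finset.disjoint_left.1 hds hk (Equiv.Perm.mem_support.2 h)
        rw [Equiv.Perm.mul_apply, this]
      · congr 1
        refine Finset.prod_congr rfl fun k hk => ?_
        have : τ k ∉ σ.support := fun h =>
          Finset.disjoint_left.1 hds h (Equiv.Perm.apply_mem_support.2 hk)
        rw [Equiv.Perm.mul_apply, Equiv.Perm.notMem_support.1 this]
    simp only [hW]
    rw [pow_add]
    have e1 := h1 (fun I => (∏ k ∈ τ.support, A (I k) (I (τ k))) * g I) (by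
      intro I I' h
      rw [hg I I' (fun k hk => h k fun hk' => hk (by rw [hd.support_mul]; simp [hk']))]
      congr 1
      refine Finset.prod_congr rfl fun k hk => ?_
      rw [h k (fun h => Finset.disjoint_left.1 hds h hk),
        h (τ k) (fun h => Finset.disjoint_left.1 hds h (Equiv.Perm.apply_mem_support.2 hk))])
    have e2 := h2 g (by
      intro I I' h
      exact hg I I' (fun k hk => h k fun hk' => hk (by rw [hd.support_mul]; simp [hk'])))
    rw [mul_right_comm, e1, mul_assoc, mul_assoc, mul_comm (Finset.sum _ _), e2]

lemma sum_prod_perm {α ι : Type*} [Fintype α] [DecidableEq α] [Fintype ι] [DecidableEq ι]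
    [Nonempty ι] (A : Matrix ι ι ℂ) (σ : Equiv.Perm α) :
    ∑ I : α → ι, ∏ k, A (I k) (I (σ k))
      = (σ.partition.parts.map fun c => (A ^ c).trace).prod := by
  -- The fixed points of σ enter through `g`; they contribute the parts equal to 1.
  have h := sum_prod_support A σ (fun I => ∏ k ∈ σ.supportᶜ, A (I k) (I k)) (by
    intro I I' h
    refine Finset.prod_congr rfl fun k hk => ?_
    rw [h k (Finset.mem_compl.1 hk)])
  have hn : (Fintype.card ι : ℂ) ≠ 0 := Nat.cast_ne_zero.2 Fintype.card_ne_zero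
  have e1 : ∀ I : α → ι, (∏ k ∈ σ.support, A (I k) (I (σ k))) *
      ∏ k ∈ σ.supportᶜ, A (I k) (I k) = ∏ k, A (I k) (I (σ k)) := by
    intro I
    rw [← Finset.prod_mul_prod_compl σ.support]
    congr 1
    refine Finset.prod_congr rfl fun k hk => ?_
    rw [Equiv.Perm.notMem_support.1 (Finset.mem_compl.1 hk)]
  have e2 : ∑ I : α → ι, ∏ k ∈ σ.supportᶜ, A (I k) (I k)
      = (Fintype.card ι : ℂ) ^ σ.support.card * A.trace ^ (Fintype.card α - σ.support.card) := by
    have : ∀ I : α → ι, ∏ k ∈ σ.supportᶜ, A (I k) (I k)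
        = ∏ k, (if k ∈ σ.support then 1 else A (I k) (I k)) := by
      intro I
      rw [← Finset.prod_mul_prod_compl σ.support]
      rw [Finset.prod_eq_one (s := σ.support) (fun k hk => by simp only [hk, if_true]), one_mul]
      exact Finset.prod_congr rfl fun k hk => by rw [if_neg (Finset.mem_compl.1 hk)]
    simp only [this]
    rw [← Fintype.piFinset_univ,
      ← Finset.prod_univ_sum (fun _ => Finset.univ)
        (fun k j => if k ∈ σ.support then (1 : ℂ) else A j j)]
    rw [← Finset.prod_mul_prod_compl σ.support]
    congr 1
    · rw [Finset.prod_congr rfl (g := fun _ => (Fintype.card ι : ℂ))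
        (fun k hk => by simp only [hk, if_true]; simp), Finset.prod_const]
    · rw [Finset.prod_congr rfl (g := fun _ => A.trace)
        (fun k hk => by simp only [Finset.mem_compl.1 hk, if_false]; rfl), Finset.prod_const,
        Finset.card_compl]
  simp only [e1, e2] at h
  rw [Equiv.Perm.parts_partition, Multiset.map_add, Multiset.prod_add, Multiset.map_replicate,
    Multiset.prod_replicate, pow_one]
  refine mul_left_cancel₀ (pow_ne_zero σ.support.card hn) ?_
  rw [h]; ring

/-! ### Power sums of eigenvalues -/

/-- Over ℂ the polynomial splits, and for a linear factor the determinant is a value of the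
characteristic polynomial up to sign. Taking p = z − X^k then yields the spectrum of A^k without
triangularising A. -/
lemma det_aeval_of_isSpectrum {N : ℕ} {A : Matrix (Fin N) (Fin N) ℂ} {a : Fin N → ℂ}
    (h : IsSpectrum A a) (p : Polynomial ℂ) :
    (Polynomial.aeval A p).det = ∏ i, p.eval (a i) := by
  have hlin : ∀ r : ℂ, (Polynomial.aeval A (Polynomial.X - Polynomial.C r)).det
      = ∏ i, (Polynomial.X - Polynomial.C r).eval (a i) := by
    intro r
    have h1 := congrArg (Polynomial.eval r) h
    rw [Matrix.eval_charpoly, Polynomial.eval_prod] at h1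
    have h2 : Polynomial.aeval A (Polynomial.X - Polynomial.C r)
        = - (Matrix.scalar (Fin N) r - A) := by
      rw [map_sub, Polynomial.aeval_X, Polynomial.aeval_C]
      simp [Matrix.algebraMap_eq_diagonal, Matrix.scalar_apply]
    rw [h2, Matrix.det_neg, h1]
    simp only [Polynomial.eval_sub, Polynomial.eval_X, Polynomial.eval_C, Fintype.card_fin]
    rw [← Fin.prod_const, ← Finset.prod_mul_distrib]
    exact Finset.prod_congr rfl fun i _ => by ring
  have hs := (IsAlgClosed.splits p).eq_prod_roots
  rw [hs]
  generalize p.roots = s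
  rw [map_mul, Matrix.det_mul, Polynomial.aeval_C]
  simp only [Polynomial.eval_mul, Polynomial.eval_C, Finset.prod_mul_distrib]
  congr 1
  · rw [Matrix.algebraMap_eq_diagonal, Matrix.det_diagonal]; simp
  · induction s using Multiset.induction_on with
    | empty => simp
    | cons r s ih =>
      simp only [Multiset.map_cons, Multiset.prod_cons, map_mul, Matrix.det_mul, hlin, ih,
        Polynomial.eval_mul, Finset.prod_mul_distrib]

lemma IsSpectrum.pow {N : ℕ} {A : Matrix (Fin N) (Fin N) ℂ} {a : Fin N → ℂ}
    (h : IsSpectrum A a) (k : ℕ) : IsSpectrum (A ^ k) (fun i => a i ^ k) := by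
  refine Polynomial.funext fun z => ?_
  rw [Matrix.eval_charpoly, Polynomial.eval_prod]
  have := det_aeval_of_isSpectrum h (Polynomial.C z - Polynomial.X ^ k)
  rw [map_sub, map_pow, Polynomial.aeval_X, Polynomial.aeval_C] at this
  rw [show algebraMap ℂ (Matrix (Fin N) (Fin N) ℂ) z = Matrix.scalar (Fin N) z from rfl] at this
  simpa using this

lemma IsSpectrum.trace {N : ℕ} {A : Matrix (Fin N) (Fin N) ℂ} {a : Fin N → ℂ}
    (h : IsSpectrum A a) : A.trace = ∑ i, a i := by
  rw [Matrix.trace_eq_sum_roots_charpoly, h, Finset.prod_eq_multiset_prod,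
    ← Function.comp_def (fun x => Polynomial.X - Polynomial.C x) a, ← Multiset.map_map,
    Polynomial.roots_multiset_prod_X_sub_C]
  rfl

lemma prod_trace_pow {N d : ℕ} {A : Matrix (Fin N) (Fin N) ℂ} {a : Fin N → ℂ}
    (h : IsSpectrum A a) (α : d.Partition) :
    (α.parts.map fun c => (A ^ c).trace).prod
      = MvPolynomial.eval a (MvPolynomial.psumPart (Fin N) ℂ α) := by
  rw [MvPolynomial.psumPart, map_multiset_prod, Multiset.map_map]
  congr 1
  refine Multiset.map_congr rfl fun c _ => ?_
  rw [(h.pow c).trace]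
  simp [MvPolynomial.psum]

/-! ### Tensor powers of matrices and permutations of tensor factors -/

/-- The `d`-th tensor power of a matrix, acting on `(ℂ^N)^{⊗ d}`. -/
def tens (d : ℕ) {N : ℕ} (A : Matrix (Fin N) (Fin N) ℂ) :
    Matrix (Fin d → Fin N) (Fin d → Fin N) ℂ :=
  Matrix.of fun I J => ∏ k, A (I k) (J k)

/-- The action of a permutation of the tensor factors on `(ℂ^N)^{⊗ d}`. -/
def permMat {d : ℕ} (N : ℕ) (π : Equiv.Perm (Fin d)) :
    Matrix (Fin d → Fin N) (Fin d → Fin N) ℂ :=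
  Matrix.of fun I J => if J = I ∘ π then 1 else 0

lemma tens_apply {d N : ℕ} (A : Matrix (Fin N) (Fin N) ℂ) (I J : Fin d → Fin N) :
    tens d A I J = ∏ k, A (I k) (J k) := rfl

lemma permMat_apply {d N : ℕ} (π : Equiv.Perm (Fin d)) (I J : Fin d → Fin N) :
    permMat N π I J = if J = I ∘ π then 1 else 0 := rfl

lemma tens_mul {d N : ℕ} (A B : Matrix (Fin N) (Fin N) ℂ) :
    tens d (A * B) = tens d A * tens d B := by
  ext I J
  simp only [tens_apply, Matrix.mul_apply, ← Finset.prod_mul_distrib]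
  rw [← Fintype.piFinset_univ,
    ← Finset.prod_univ_sum (fun _ => Finset.univ) (fun k j => A (I k) j * B j (J k))]

lemma tens_one {d N : ℕ} : tens d (1 : Matrix (Fin N) (Fin N) ℂ) = 1 := by
  ext I J
  simp only [tens_apply, Matrix.one_apply, Finset.prod_ite_zero, Finset.prod_const_one,
    funext_iff, Finset.mem_univ, true_imp_iff]

lemma tens_diagonal {d N : ℕ} (u : Fin N → ℂ) :
    tens d (Matrix.diagonal u) = Matrix.diagonal fun I => ∏ k, u (I k) := by
  ext I J
  by_cases h : I = J
  · subst h; simp [tens_apply]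
  · obtain ⟨k, hk⟩ := Function.ne_iff.1 h
    rw [Matrix.diagonal_apply_ne _ h, tens_apply]
    exact Finset.prod_eq_zero (Finset.mem_univ k) (Matrix.diagonal_apply_ne _ hk)

lemma trace_tens {d N : ℕ} (A : Matrix (Fin N) (Fin N) ℂ) : (tens d A).trace = A.trace ^ d := by
  simp only [Matrix.trace, Matrix.diag_apply, tens_apply]
  rw [← Fintype.piFinset_univ,
    ← Finset.prod_univ_sum (fun _ => Finset.univ) (fun _ j => A j j)]
  simp

lemma permMat_mul {d N : ℕ} (π σ : Equiv.Perm (Fin d)) :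
    permMat N (π * σ) = permMat N π * permMat N σ := by
  ext I J
  rw [Matrix.mul_apply, Finset.sum_eq_single (I ∘ π)]
  · rw [permMat_apply, permMat_apply, permMat_apply, if_pos rfl, one_mul]; rfl
  · intro K _ hK
    rw [permMat_apply, if_neg hK, zero_mul]
  · simp

lemma permMat_mul_apply {d N : ℕ} (π : Equiv.Perm (Fin d))
    (X : Matrix (Fin d → Fin N) (Fin d → Fin N) ℂ) (I J : Fin d → Fin N) :
    (permMat N π * X) I J = X (I ∘ π) J := by
  simp [Matrix.mul_apply, permMat_apply]

lemma mul_permMat_apply {d N : ℕ} (π : Equiv.Perm (Fin d))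
    (X : Matrix (Fin d → Fin N) (Fin d → Fin N) ℂ) (I J : Fin d → Fin N) :
    (X * permMat N π) I J = X I (J ∘ π.symm) := by
  have : ∀ K : Fin d → Fin N, J = K ∘ π ↔ J ∘ π.symm = K := fun K =>
    ⟨fun h => by rw [h, Function.comp_assoc]; simp, fun h => by
      rw [← h, Function.comp_assoc]; simp⟩
  simp [Matrix.mul_apply, permMat_apply, this]

lemma permMat_mul_tens {d N : ℕ} (π : Equiv.Perm (Fin d)) (A : Matrix (Fin N) (Fin N) ℂ) :
    permMat N π * tens d A = tens d A * permMat N π := by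
  ext I J
  rw [permMat_mul_apply, mul_permMat_apply, tens_apply, tens_apply, ← Equiv.prod_comp π.symm]
  simp

lemma trace_tens_mul_permMat {d N : ℕ} [NeZero N] (π : Equiv.Perm (Fin d))
    (A : Matrix (Fin N) (Fin N) ℂ) :
    (tens d A * permMat N π).trace = (π.partition.parts.map fun c => (A ^ c).trace).prod := by
  -- Right multiplication by `permMat N π` acts on column indices by the inverse permutation.
  have : π.partition = π⁻¹.partition := by
    rw [← Equiv.Perm.partition_eq_of_isConj, Equiv.Perm.isConj_iff_cycleType_eq,
      Equiv.Perm.cycleType_inv]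
  rw [this, ← sum_prod_perm]
  simp only [Matrix.trace, Matrix.diag_apply, mul_permMat_apply, tens_apply]
  rfl

/-! ### The commutant of the tensor powers of unitary matrices -/

/-- Along a line of matrices the entries of both sides are polynomials in t, so agreement at
infinitely many t is agreement everywhere. -/
lemma commute_tens_of_infinite {d N : ℕ} (X : Matrix (Fin d → Fin N) (Fin d → Fin N) ℂ)
    (P Q : Matrix (Fin N) (Fin N) ℂ) {S : Set ℂ} (hS : S.Infinite)
    (h : ∀ t ∈ S, tens d (P + t • Q) * X = X * tens d (P + t • Q)) (t : ℂ) :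
    tens d (P + t • Q) * X = X * tens d (P + t • Q) := by
  ext I J
  let q : (Fin d → Fin N) → (Fin d → Fin N) → Polynomial ℂ := fun I J =>
    ∏ k, (Polynomial.C (P (I k) (J k)) + Polynomial.X * Polynomial.C (Q (I k) (J k)))
  have hq : ∀ t I J, (q I J).eval t = tens d (P + t • Q) I J := by
    intro t I J
    simp only [q, tens_apply, Polynomial.eval_prod]
    refine Finset.prod_congr rfl fun k _ => ?_
    simp [mul_comm t]
  have : (∑ K, q I K * Polynomial.C (X K J)) = ∑ K, Polynomial.C (X I K) * q K J := by
    refine Polynomial.eq_of_infinite_eval_eq _ _ (hS.mono fun t ht => ?_)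
    have := congrFun (congrFun (h t ht) I) J
    simpa [Polynomial.eval_finsetSum, hq, Matrix.mul_apply] using this
  have := congrArg (Polynomial.eval t) this
  simpa [Polynomial.eval_finsetSum, hq, Matrix.mul_apply] using this

lemma infinite_sphere : {t : ℂ | ‖t‖ = 1}.Infinite := by
  have h : Set.Infinite ((fun x : ℝ => Complex.exp (x * Complex.I)) '' Set.Ioo 0 1) := by
    refine (Set.Ioo_infinite one_pos).image ?_
    intro x hx y hy hxy
    rw [Complex.exp_eq_exp_iff_exists_int] at hxy
    obtain ⟨n, hn⟩ := hxy
    have h1 := congrArg Complex.im hn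
    simp only [Complex.mul_im, Complex.ofReal_re, Complex.I_im, mul_one, Complex.ofReal_im,
      Complex.I_re, mul_zero, add_zero, Complex.add_im, Complex.intCast_re,
      Complex.intCast_im] at h1
    norm_num at h1
    have hpi := Real.pi_gt_three
    have hn0 : n = 0 := by
      by_contra hne
      have : (1 : ℝ) ≤ |(n : ℝ)| := by exact_mod_cast Int.one_le_abs hne
      have h3 : |x - y| = |(n : ℝ)| * (2 * Real.pi) := by
        rw [h1, add_sub_cancel_left, abs_mul, abs_of_pos (by positivity : 0 < 2 * Real.pi)]
      have h4 : |x - y| < 1 := by rw [abs_lt]; constructor <;> linarith [hx.1, hx.2, hy.1, hy.2]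
      nlinarith
    simpa [hn0] using h1
  refine h.mono ?_
  rintro _ ⟨x, -, rfl⟩
  exact Complex.norm_exp_ofReal_mul_I x

/-- Weyl's unitary trick. Polynomial continuation extends commutation from unitary diagonal matrices
to all diagonal ones, the spectral theorem to Hermitian ones, and a second continuation to all
matrices. -/
lemma commute_tens_all {d N : ℕ} {X : Matrix (Fin d → Fin N) (Fin d → Fin N) ℂ}
    (h : ∀ V : U N, tens d (V : Matrix (Fin N) (Fin N) ℂ) * X
      = X * tens d (V : Matrix (Fin N) (Fin N) ℂ))
    (g : Matrix (Fin N) (Fin N) ℂ) : tens d g * X = X * tens d g := by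
  -- `s` collects the coordinates released from the unit circle; each insertion continues one
  -- coordinate from the circle to all of ℂ.
  have hdiag : ∀ (s : Finset (Fin N)) (u : Fin N → ℂ), (∀ i, i ∉ s → ‖u i‖ = 1) →
      tens d (Matrix.diagonal u) * X = X * tens d (Matrix.diagonal u) := by
    intro s
    induction s using Finset.induction_on with
    | empty =>
      intro u hu
      refine h ⟨Matrix.diagonal u, ?_⟩
      rw [Matrix.mem_unitaryGroup_iff, Matrix.star_eq_conjTranspose,
        Matrix.diagonal_conjTranspose, Matrix.diagonal_mul_diagonal, ← Matrix.diagonal_one]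
      congr 1
      funext i
      have := hu i (Finset.notMem_empty i)
      simp [Complex.mul_conj, Complex.normSq_eq_norm_sq, this]
    | insert i s hi ih =>
      intro u hu
      have hupd : ∀ t : ℂ, Matrix.diagonal (Function.update u i 0)
          + t • Matrix.diagonal (Pi.single i (1 : ℂ)) = Matrix.diagonal (Function.update u i t) := by
        intro t
        rw [← Matrix.diagonal_smul, Matrix.diagonal_add]
        congr 1
        funext j
        by_cases hj : j = i
        · subst hj; simp
        · simp [hj]
      have := commute_tens_of_infinite X (Matrix.diagonal (Function.update u i 0))
        (Matrix.diagonal (Pi.single i (1 : ℂ))) infinite_sphere (fun t ht => by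
          rw [hupd]
          refine ih _ fun j hj => ?_
          by_cases hji : j = i
          · subst hji; simpa using ht
          · rw [Function.update_of_ne hji]
            exact hu j (by simp [hji, hj])) (u i)
      rw [hupd, Function.update_eq_self] at this
      exact this
  have hherm : ∀ H : Matrix (Fin N) (Fin N) ℂ, H.IsHermitian → tens d H * X = X * tens d H := by
    intro H hH
    have hs := hH.spectral_theorem
    rw [Unitary.conjStarAlgAut_apply] at hs
    rw [hs, tens_mul, tens_mul]
    have h1 := h hH.eigenvectorUnitary
    have h2 := h (star hH.eigenvectorUnitary)
    have h3 := hdiag Finset.univ (RCLike.ofReal ∘ hH.eigenvalues) (by simp)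
    rw [Unitary.coe_star] at h2
    rw [Matrix.mul_assoc, h2, ← Matrix.mul_assoc, Matrix.mul_assoc _ _ X, h3, ← Matrix.mul_assoc,
      h1]
    simp only [Matrix.mul_assoc]
  -- g = H + iK with H and K Hermitian. The line H + tK is Hermitian for real t, and the
  -- continuation is evaluated at t = i.
  have hg : g = ((1 / 2 : ℂ) • (g + g.conjTranspose))
      + Complex.I • ((-Complex.I / 2) • (g - g.conjTranspose)) := by
    ext i j
    simp only [Matrix.add_apply, Matrix.smul_apply, Matrix.sub_apply, smul_eq_mul]
    linear_combination (1 / 2 * (g i j - g.conjTranspose i j)) * Complex.I_mul_I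
  rw [hg]
  refine commute_tens_of_infinite X _ _ (S := Set.range ((↑) : ℝ → ℂ))
    (Set.infinite_range_of_injective Complex.ofReal_injective) ?_ _
  rintro _ ⟨t, rfl⟩
  refine hherm _ ?_
  ext i j
  simp
  ring

lemma exists_perm_of_forall_exists {d N : ℕ} {e I : Fin d → Fin N} (he : Function.Injective e)
    (h : ∀ j, ∃ k, I k = e j) : ∃ π : Equiv.Perm (Fin d), I = e ∘ π := by
  choose f hf using h
  have hfi : Function.Injective f := fun a b hab => he (by rw [← hf, ← hf, hab])
  let π := Equiv.ofBijective f (Finite.injective_iff_bijective.1 hfi)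
  refine ⟨π.symm, funext fun k => ?_⟩
  rw [Function.comp_apply, ← hf]
  exact congrArg I (π.apply_symm_apply k).symm

/-- Since d ≤ N there is a basis tensor with pairwise distinct indices. Commutation determines X
from its column at that tensor, and that column is supported on rearrangements of it. -/
lemma exists_eq_sum_permMat {d N : ℕ} (hdN : d ≤ N)
    {X : Matrix (Fin d → Fin N) (Fin d → Fin N) ℂ}
    (h : ∀ g : Matrix (Fin N) (Fin N) ℂ, tens d g * X = X * tens d g) :
    ∃ c : Equiv.Perm (Fin d) → ℂ, X = ∑ π, c π • permMat N π := by
  set e : Fin d → Fin N := Fin.castLE hdN with he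
  have hei : Function.Injective e := Fin.castLE_injective hdN
  have hX : ∀ I, X I e ≠ 0 → ∃ π : Equiv.Perm (Fin d), I = e ∘ π := by
    intro I hI
    refine exists_perm_of_forall_exists hei fun j => ?_
    by_contra hj
    push Not at hj
    -- This diagonal matrix kills the basis vector `e j` and fixes the others: its tensor power
    -- kills the column index `e` but fixes the row index `I`, which avoids `e j`.
    have h1 := congrFun (congrFun (h (Matrix.diagonal fun i => if i = e j then 0 else 1)) I) e
    rw [tens_diagonal, Matrix.diagonal_mul, Matrix.mul_diagonal,
      Finset.prod_eq_one (fun k _ => if_neg (hj k)),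
      Finset.prod_eq_zero (Finset.mem_univ j) (by simp)] at h1
    exact hI (by simpa using h1)
  refine ⟨fun π => X (e ∘ π.symm) e, ?_⟩
  ext I J
  -- `g` sends the basis vector `e k` to the one indexed by `J k`, so its tensor power carries the
  -- column of X at `e` to the column at `J`. Its columns beyond the first d play no role and are
  -- set to 0.
  let g : Matrix (Fin N) (Fin N) ℂ := Matrix.of fun i j =>
    if hj : (j : ℕ) < d then (if i = J ⟨j, hj⟩ then 1 else 0) else 0
  have hg : ∀ i k, g i (e k) = if i = J k then 1 else 0 := by
    intro i k
    simp [g, he]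
  have h1 := congrFun (congrFun (h g) I) e
  have h2 : ∀ K, tens d g K e = if K = J then 1 else 0 := by
    intro K
    simp only [tens_apply, hg, Finset.prod_ite_zero, Finset.prod_const_one, funext_iff,
      Finset.mem_univ, true_imp_iff]
  rw [Matrix.mul_apply, Matrix.mul_apply] at h1
  simp only [h2, mul_ite, mul_one, mul_zero, Finset.sum_ite_eq', Finset.mem_univ, if_true] at h1
  rw [← h1, Matrix.sum_apply]
  have hinj : Function.Injective fun π : Equiv.Perm (Fin d) => e ∘ π.symm := by
    intro π σ hπ
    have : π.symm = σ.symm := Equiv.ext fun k => hei (congrFun hπ k)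
    simpa using congrArg Equiv.symm this
  refine (Fintype.sum_of_injective (fun π : Equiv.Perm (Fin d) => e ∘ π.symm) hinj _ _ ?_ ?_).symm
  · intro K hK
    by_cases hXK : X K e = 0
    · rw [hXK, mul_zero]
    · obtain ⟨π, rfl⟩ := hX K hXK
      exact absurd ⟨π.symm, rfl⟩ hK
  · intro π
    rw [Matrix.smul_apply, smul_eq_mul, mul_comm]
    congr 1
    simp only [permMat_apply, tens_apply, Function.comp_apply, hg, Finset.prod_ite_zero,
      Finset.prod_const_one, Finset.mem_univ, true_imp_iff]
    refine if_congr ⟨fun hJ k => ?_, fun hJ => ?_⟩ rfl rfl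
    · rw [hJ]; simp
    · funext k
      have := hJ (π k)
      simpa using this.symm

/-! ### Conjugation averages over the unitary group -/

instance (N : ℕ) : IsProbabilityMeasure (haarU N) :=
  ⟨Measure.haarMeasure_self (K₀ := ⊤)⟩

instance (N : ℕ) : (haarU N).IsMulLeftInvariant := by unfold haarU; infer_instance

lemma integrable_haarU {N : ℕ} {f : U N → ℂ} (hf : Continuous f) : Integrable f (haarU N) :=
  hf.integrable_of_hasCompactSupport (HasCompactSupport.of_compactSpace f)

lemma continuous_tens {d N : ℕ} (I J : Fin d → Fin N) :
    Continuous fun V : U N => tens d (V : Matrix (Fin N) (Fin N) ℂ) I J := by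
  simp only [tens_apply]
  exact continuous_finsetProd _ fun k _ =>
    (continuous_apply_apply (I k) (J k)).comp continuous_subtype_val

/-- Conjugation of an operator on `(ℂ^N)^{⊗ d}` by a unitary matrix. -/
def conjTens {d N : ℕ} (V : U N) (X : Matrix (Fin d → Fin N) (Fin d → Fin N) ℂ) :
    Matrix (Fin d → Fin N) (Fin d → Fin N) ℂ :=
  tens d (V : Matrix (Fin N) (Fin N) ℂ) * X * tens d ((V⁻¹ : U N) : Matrix (Fin N) (Fin N) ℂ)

lemma continuous_conjTens {d N : ℕ} (X : Matrix (Fin d → Fin N) (Fin d → Fin N) ℂ)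
    (I J : Fin d → Fin N) : Continuous fun V : U N => conjTens V X I J := by
  simp only [conjTens, Matrix.mul_apply]
  refine continuous_finsetSum _ fun K _ => ?_
  exact (continuous_finsetSum _ fun L _ => (continuous_tens I L).mul continuous_const).mul
    ((continuous_tens K J).comp continuous_inv)

/-- The average over the unitary group of the conjugates of an operator on `(ℂ^N)^{⊗ d}`. -/
def average {d N : ℕ} (X : Matrix (Fin d → Fin N) (Fin d → Fin N) ℂ) :
    Matrix (Fin d → Fin N) (Fin d → Fin N) ℂ :=
  Matrix.of fun I J => ∫ V : U N, conjTens V X I J ∂(haarU N)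

lemma average_apply {d N : ℕ} (X : Matrix (Fin d → Fin N) (Fin d → Fin N) ℂ)
    (I J : Fin d → Fin N) :
    average X I J = ∫ V : U N, conjTens V X I J ∂(haarU N) := rfl

lemma mul_average_mul {d N : ℕ} (X P Q : Matrix (Fin d → Fin N) (Fin d → Fin N) ℂ)
    (I J : Fin d → Fin N) :
    (P * average X * Q) I J = ∫ V : U N, (P * conjTens V X * Q) I J ∂(haarU N) := by
  simp only [Matrix.mul_apply, average_apply]
  rw [integral_finsetSum]
  · refine Finset.sum_congr rfl fun K _ => ?_
    rw [integral_mul_const, integral_finsetSum]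
    · simp only [integral_const_mul]
    · exact fun L _ => (integrable_haarU (continuous_conjTens X L K)).const_mul _
  · exact fun K _ => (integrable_finsetSum _ fun L _ =>
      (integrable_haarU (continuous_conjTens X L K)).const_mul _).mul_const _

lemma trace_mul_average {d N : ℕ} (X P : Matrix (Fin d → Fin N) (Fin d → Fin N) ℂ) :
    (P * average X).trace = ∫ V : U N, (P * conjTens V X).trace ∂(haarU N) := by
  have h := mul_average_mul X P 1
  simp only [mul_one] at h
  simp only [Matrix.trace, Matrix.diag_apply, h]
  rw [integral_finsetSum]
  intro I _
  simp only [Matrix.mul_apply]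
  exact integrable_finsetSum _ fun L _ => (integrable_haarU (continuous_conjTens X L I)).const_mul _

lemma tens_inv_mul_tens {d N : ℕ} (W : U N) : tens d ((W⁻¹ : U N) : Matrix (Fin N) (Fin N) ℂ)
    * tens d (W : Matrix (Fin N) (Fin N) ℂ) = 1 := by
  rw [← tens_mul, ← Submonoid.coe_mul, inv_mul_cancel, Submonoid.coe_one, tens_one]

/-- Left invariance of Haar measure: conjugating the average by W only translates the integration
variable. -/
lemma tens_mul_average {d N : ℕ} (X : Matrix (Fin d → Fin N) (Fin d → Fin N) ℂ) (W : U N) :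
    tens d (W : Matrix (Fin N) (Fin N) ℂ) * average X
      = average X * tens d (W : Matrix (Fin N) (Fin N) ℂ) := by
  have h : tens d (W : Matrix (Fin N) (Fin N) ℂ) * average X
      * tens d ((W⁻¹ : U N) : Matrix (Fin N) (Fin N) ℂ) = average X := by
    ext I J
    rw [mul_average_mul, average_apply,
      ← integral_mul_left_eq_self (fun V => conjTens V X I J) W]
    refine integral_congr_ae (Filter.Eventually.of_forall fun V => ?_)
    simp only [conjTens, mul_inv_rev, Submonoid.coe_mul, tens_mul, Matrix.mul_assoc]
  conv_rhs => rw [← h]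
  rw [Matrix.mul_assoc _ _ (tens d (W : Matrix (Fin N) (Fin N) ℂ)), tens_inv_mul_tens,
    Matrix.mul_one]

/-- Permutations of the factors commute with tensor powers, so every conjugate has the same trace
against them. The coefficients of the average are thereby detected by X itself. -/
lemma trace_permMat_mul_average {d N : ℕ} (X : Matrix (Fin d → Fin N) (Fin d → Fin N) ℂ)
    (σ : Equiv.Perm (Fin d)) :
    (permMat N σ * average X).trace = (permMat N σ * X).trace := by
  rw [trace_mul_average]
  have : ∀ V : U N, (permMat N σ * conjTens V X).trace = (permMat N σ * X).trace := by
    intro V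
    rw [conjTens, ← Matrix.mul_assoc, ← Matrix.mul_assoc, permMat_mul_tens, Matrix.trace_mul_comm,
      ← Matrix.mul_assoc, ← Matrix.mul_assoc, tens_inv_mul_tens, Matrix.one_mul]
  simp only [this, integral_const, probReal_univ, one_smul]

/-- The normalised trace `N^{-d} Tr π = N^{cyc π - d}` of a permutation. -/
def normTrace (N : ℕ) {d : ℕ} (π : Equiv.Perm (Fin d)) : ℂ :=
  ((N : ℂ) ^ d)⁻¹ * (permMat N π).trace

/-- If `w` inverts `normTrace` for convolution, then `w` gives the average of an operator. -/
lemma average_eq_sum {d N : ℕ} (hdN : d ≤ N) [NeZero N] {w : Equiv.Perm (Fin d) → ℂ}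
    (hw : ∀ π, ∑ τ, w (π * τ⁻¹) * normTrace N τ = if π = 1 then 1 else 0)
    (X : Matrix (Fin d → Fin N) (Fin d → Fin N) ℂ) :
    average X = ∑ β, (((N : ℂ) ^ d)⁻¹ * ∑ σ, w (β⁻¹ * σ⁻¹) * (permMat N σ * X).trace)
      • permMat N β := by
  obtain ⟨c, hc⟩ := exists_eq_sum_permMat hdN (commute_tens_all (tens_mul_average X))
  -- A linear system for `c`, with matrix N^d times convolution by `normTrace`; `h2` inverts it by
  -- means of `w`.
  have h1 : ∀ σ, (permMat N σ * X).trace = ∑ α, c α * (permMat N (σ * α)).trace := by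
    intro σ
    rw [← trace_permMat_mul_average, hc, Matrix.mul_sum, Matrix.trace_sum]
    simp [permMat_mul]
  have h2 : ∀ β, ((N : ℂ) ^ d)⁻¹ * ∑ σ, w (β⁻¹ * σ⁻¹) * (permMat N σ * X).trace = c β := by
    intro β
    simp only [h1, Finset.mul_sum]
    rw [Finset.sum_comm]
    have : ∀ α, ∑ σ, ((N : ℂ) ^ d)⁻¹ * (w (β⁻¹ * σ⁻¹) * (c α * (permMat N (σ * α)).trace))
        = if α = β then c α else 0 := by
      intro α
      have := hw (β⁻¹ * α)
      rw [← Equiv.sum_comp (Equiv.mulRight α)] at this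
      simp only [Equiv.coe_mulRight, mul_inv_rev, mul_assoc, mul_inv_cancel_left, normTrace,
        inv_mul_eq_one, eq_comm (a := β)] at this
      rw [← mul_one (c α), ← mul_zero (c α), ← mul_ite, ← this, Finset.mul_sum]
      refine Finset.sum_congr rfl fun σ _ => ?_
      ring
    simp [this]
  simp only [h2]
  exact hc

variable {d N : ℕ}

/-- The d-th power of a trace is the trace of a tensor power, so the integrand pairs the d-th tensor
power of A with a conjugate of that of B. -/
lemma integral_trace_conj_pow (hdN : d ≤ N) [NeZero N] {w : Equiv.Perm (Fin d) → ℂ}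
    (hw : ∀ π, ∑ τ, w (π * τ⁻¹) * normTrace N τ = if π = 1 then 1 else 0)
    (A B : Matrix (Fin N) (Fin N) ℂ) :
    ∫ V : U N, (A * (V : Matrix (Fin N) (Fin N) ℂ) * B
      * ((V⁻¹ : U N) : Matrix (Fin N) (Fin N) ℂ)).trace ^ d ∂(haarU N)
    = ((N : ℂ) ^ d)⁻¹ * ∑ σ, ∑ τ, w (σ⁻¹ * τ) * (tens d A * permMat N σ).trace
        * (tens d B * permMat N τ).trace := by
  have h := trace_mul_average (tens d B) (tens d A)
  simp only [conjTens, ← tens_mul, trace_tens, ← Matrix.mul_assoc] at h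
  rw [← h, average_eq_sum hdN hw, Matrix.mul_sum, Matrix.trace_sum, Finset.mul_sum]
  refine Finset.sum_congr rfl fun β _ => ?_
  rw [Matrix.mul_smul, Matrix.trace_smul, smul_eq_mul, mul_assoc, Finset.sum_mul]
  congr 1
  rw [← Equiv.sum_comp (Equiv.inv (Equiv.Perm (Fin d)))]
  refine Finset.sum_congr rfl fun σ _ => ?_
  have : (permMat N σ⁻¹ * tens d B).trace = (tens d B * permMat N σ).trace := by
    rw [permMat_mul_tens, trace_tens_mul_permMat, trace_tens_mul_permMat]
    have : σ.partition = σ⁻¹.partition := by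
      rw [← Equiv.Perm.partition_eq_of_isConj, Equiv.Perm.isConj_iff_cycleType_eq,
        Equiv.Perm.cycleType_inv]
    rw [this]
  rw [Equiv.inv_apply, inv_inv, this]
  ring

/-- An entry of the tensor power of V times an entry of that of V⁻¹ is an entry of a conjugated
matrix unit. In the resulting double sum over permutations β, σ the substitution σ ↦ σβ makes every
β contribute equally, which gives the factor d!. -/
lemma integral_trace_pow_mul_trace_pow (hdN : d ≤ N) [NeZero N] {w : Equiv.Perm (Fin d) → ℂ}
    (hw : ∀ π, ∑ τ, w (π * τ⁻¹) * normTrace N τ = if π = 1 then 1 else 0)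
    (A B : Matrix (Fin N) (Fin N) ℂ) :
    ∫ V : U N, (A * (V : Matrix (Fin N) (Fin N) ℂ)).trace ^ d
      * (B * ((V⁻¹ : U N) : Matrix (Fin N) (Fin N) ℂ)).trace ^ d ∂(haarU N)
    = ((N : ℂ) ^ d)⁻¹ * (d.factorial * ∑ σ, w σ⁻¹ * (tens d (A * B) * permMat N σ).trace) := by
  have hconj : ∀ σ τ : Equiv.Perm (Fin d), (tens d (A * B) * permMat N (σ * τ)).trace
      = (tens d (A * B) * permMat N (τ * σ)).trace := by
    intro σ τ
    rw [trace_tens_mul_permMat, trace_tens_mul_permMat]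
    have : (σ * τ).partition = (τ * σ).partition := by
      rw [← Equiv.Perm.partition_eq_of_isConj, isConj_iff]
      exact ⟨σ⁻¹, by group⟩
    rw [this]
  let ι := Fin d → Fin N
  have hs : ∀ (V : U N) (I J K L : ι), conjTens V (Matrix.single I L (1 : ℂ)) J K
      = tens d (V : Matrix (Fin N) (Fin N) ℂ) J I *
        tens d ((V⁻¹ : U N) : Matrix (Fin N) (Fin N) ℂ) L K := by
    intro V I J K L
    rw [conjTens, Matrix.mul_assoc, Matrix.mul_apply, Finset.sum_eq_single I]
    · simp
    · intro I' _ hI'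
      rw [Matrix.single_mul_apply_of_ne _ _ _ _ _ hI', mul_zero]
    · simp
  have h1 : ∀ V : U N, (A * (V : Matrix (Fin N) (Fin N) ℂ)).trace ^ d
      * (B * ((V⁻¹ : U N) : Matrix (Fin N) (Fin N) ℂ)).trace ^ d
      = ∑ x : (ι × ι) × (ι × ι), tens d A x.1.1 x.1.2 * tens d B x.2.1 x.2.2 *
        conjTens V (Matrix.single x.1.1 x.2.2 1) x.1.2 x.2.1 := by
    intro V
    simp only [hs]
    rw [← trace_tens, ← trace_tens, tens_mul, tens_mul]
    simp only [Matrix.trace, Matrix.diag_apply, Matrix.mul_apply, ← Fintype.sum_prod_type']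
    rw [Finset.sum_mul_sum, ← Finset.sum_product']
    refine Finset.sum_congr rfl fun x _ => ?_
    ring
  have h2 : ∫ V : U N, (A * (V : Matrix (Fin N) (Fin N) ℂ)).trace ^ d
      * (B * ((V⁻¹ : U N) : Matrix (Fin N) (Fin N) ℂ)).trace ^ d ∂(haarU N)
      = ∑ x : (ι × ι) × (ι × ι), tens d A x.1.1 x.1.2 * tens d B x.2.1 x.2.2 *
        average (Matrix.single x.1.1 x.2.2 1) x.1.2 x.2.1 := by
    simp only [h1]
    rw [integral_finsetSum]
    · simp only [integral_const_mul, average_apply]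
    · exact fun x _ => (integrable_haarU (continuous_conjTens _ _ _)).const_mul _
  have h3 : ∀ (σ : Equiv.Perm (Fin d)) (I L : ι),
      (permMat N σ * Matrix.single I L (1 : ℂ)).trace = permMat N σ L I := by
    intro σ I L
    rw [Matrix.trace_mul_comm, Matrix.trace_single_mul]; simp
  have h4 : ∀ β σ : Equiv.Perm (Fin d), ∑ x : (ι × ι) × (ι × ι),
      tens d A x.1.1 x.1.2 * tens d B x.2.1 x.2.2 *
      (permMat N σ x.2.2 x.1.1 * permMat N β x.1.2 x.2.1)
      = (tens d (A * B) * permMat N (β * σ)).trace := by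
    intro β σ
    rw [permMat_mul, tens_mul, Matrix.mul_assoc (tens d A), ← Matrix.mul_assoc (tens d B),
      ← permMat_mul_tens, Matrix.mul_assoc, ← Matrix.mul_assoc (tens d A)]
    simp only [Matrix.trace, Matrix.diag_apply]
    rw [Fintype.sum_prod_type, Fintype.sum_prod_type]
    refine Finset.sum_congr rfl fun I _ => ?_
    rw [Matrix.mul_apply]
    simp only [Matrix.mul_apply, Finset.sum_mul_sum, Fintype.sum_prod_type]
    rw [Finset.sum_comm]
    refine Finset.sum_congr rfl fun K _ => ?_
    refine Finset.sum_congr rfl fun J _ => Finset.sum_congr rfl fun L _ => ?_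
    ring
  have h5 : ∀ I J K L : ι, tens d A I J * tens d B K L * average (Matrix.single I L 1) J K
      = ((N : ℂ) ^ d)⁻¹ * ∑ β, ∑ σ, w (β⁻¹ * σ⁻¹) * (tens d A I J * tens d B K L *
      (permMat N σ L I * permMat N β J K)) := by
    intro I J K L
    rw [average_eq_sum hdN hw]
    simp only [Matrix.sum_apply, Matrix.smul_apply, smul_eq_mul, Finset.mul_sum, Finset.sum_mul, h3]
    refine Finset.sum_congr rfl fun β _ => Finset.sum_congr rfl fun σ _ => ?_
    ring
  rw [h2]
  simp only [h5, ← Finset.mul_sum]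
  congr 1
  have h7 : ∀ β : Equiv.Perm (Fin d),
      ∑ σ, w (β⁻¹ * σ⁻¹) * (tens d (A * B) * permMat N (β * σ)).trace
      = ∑ σ, w σ⁻¹ * (tens d (A * B) * permMat N σ).trace := by
    intro β
    rw [← Equiv.sum_comp (Equiv.mulRight β)
      (fun σ => w σ⁻¹ * (tens d (A * B) * permMat N σ).trace)]
    refine Finset.sum_congr rfl fun σ _ => ?_
    rw [Equiv.coe_mulRight, mul_inv_rev, hconj]
  rw [Finset.sum_comm]
  have h8 : ∀ β : Equiv.Perm (Fin d), ∑ x : (ι × ι) × (ι × ι), ∑ σ, w (β⁻¹ * σ⁻¹) *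
      (tens d A x.1.1 x.1.2 * tens d B x.2.1 x.2.2 *
      (permMat N σ x.2.2 x.1.1 * permMat N β x.1.2 x.2.1))
      = ∑ σ, w σ⁻¹ * (tens d (A * B) * permMat N σ).trace := by
    intro β
    rw [Finset.sum_comm, ← h7 β]
    simp only [← Finset.mul_sum, h4]
  simp only [h8, Finset.sum_const, Finset.card_univ, Fintype.card_perm, Fintype.card_fin,
    nsmul_eq_mul]

/-! ### Counting monotone factorisations -/

section Mono

variable {G : Type*} [Group G] [DecidableEq G]

/-- The coefficient of `g` in the complete homogeneous symmetric polynomial of degree `r` in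
`∑ S 0, …, ∑ S (n - 1)`: the number of factorisations of `g` into `r` factors lying in
`S k₁, …, S kᵣ`, where `k₁ ≤ … ≤ kᵣ < n`. -/
def monoCount (S : ℕ → Finset G) : ℕ → ℕ → G → ℕ
  | _, 0, g => if g = 1 then 1 else 0
  | 0, _ + 1, _ => 0
  | n + 1, r + 1, g => monoCount S n (r + 1) g + ∑ x ∈ S n, monoCount S (n + 1) r (g * x⁻¹)

lemma monoCount_zero_right (S : ℕ → Finset G) (n : ℕ) (g : G) :
    monoCount S n 0 g = if g = 1 then 1 else 0 := by
  cases n <;> rw [monoCount]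

lemma monoCount_zero_succ (S : ℕ → Finset G) (r : ℕ) (g : G) : monoCount S 0 (r + 1) g = 0 := by
  rw [monoCount]

lemma monoCount_succ_succ (S : ℕ → Finset G) (n r : ℕ) (g : G) :
    monoCount S (n + 1) (r + 1) g
      = monoCount S n (r + 1) g + ∑ x ∈ S n, monoCount S (n + 1) r (g * x⁻¹) := by
  rw [monoCount]

lemma monoCount_map {G' : Type*} [Group G'] [DecidableEq G'] (φ : G →* G')
    (hφ : Function.Injective φ) {S : ℕ → Finset G} {S' : ℕ → Finset G'} {m : ℕ}
    (hS : ∀ n < m, S' n = (S n).map ⟨φ, hφ⟩) (n : ℕ) :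
    n ≤ m → ∀ r g, monoCount S' n r (φ g) = monoCount S n r g := by
  induction n with
  | zero =>
    intro _ r g
    cases r with
    | zero => simp only [monoCount_zero_right, map_eq_one_iff φ hφ]
    | succ r => simp only [monoCount_zero_succ]
  | succ n ihn =>
    intro hn r
    induction r with
    | zero => intro g; simp only [monoCount_zero_right, map_eq_one_iff φ hφ]
    | succ r ihr =>
      intro g
      rw [monoCount_succ_succ, monoCount_succ_succ, ihn (by omega), hS n (by omega),
        Finset.sum_map]
      congr 1
      refine Finset.sum_congr rfl fun x _ => ?_
      rw [← ihr, map_mul, map_inv]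
      rfl

/-- The number of sequences of `r` transpositions with weakly increasing labels less than `n`. -/
def seqCount : ℕ → ℕ → ℕ
  | 0, r => if r = 0 then 1 else 0
  | n + 1, r => ∑ p ∈ Finset.HasAntidiagonal.antidiagonal r, seqCount n p.1 * n ^ p.2

lemma seqCount_zero_right (n : ℕ) : seqCount n 0 = 1 := by
  induction n with
  | zero => simp [seqCount]
  | succ n ih => simp [seqCount, ih]

lemma seqCount_succ_succ (n r : ℕ) :
    seqCount (n + 1) (r + 1) = seqCount n (r + 1) + n * seqCount (n + 1) r := by
  rw [seqCount, Finset.Nat.sum_antidiagonal_succ', seqCount, Finset.mul_sum, pow_zero, mul_one]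
  congr 1
  refine Finset.sum_congr rfl fun p _ => ?_
  rw [pow_succ]; ring

lemma monoCount_le {S : ℕ → Finset G} (hS : ∀ n, (S n).card ≤ n) (n : ℕ) :
    ∀ r g, monoCount S n r g ≤ seqCount n r := by
  induction n with
  | zero =>
    intro r g
    cases r with
    | zero => rw [monoCount_zero_right, seqCount_zero_right]; split_ifs <;> simp
    | succ r => simp [monoCount_zero_succ]
  | succ n ihn =>
    intro r
    induction r with
    | zero => intro g; rw [monoCount_zero_right, seqCount_zero_right]; split_ifs <;> simp
    | succ r ihr =>
      intro g
      rw [monoCount_succ_succ, seqCount_succ_succ]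
      refine add_le_add (ihn _ _) ((Finset.sum_le_card_nsmul _ _ _ fun x _ => ihr _).trans ?_)
      rw [smul_eq_mul]
      exact Nat.mul_le_mul_right _ (hS n)

/-- The generating function of `seqCount n` is ∏_{k<n} 1/(1 − kt), a finite product of geometric
series. Only the largest ratio, at k = n − 1 ≤ m, limits convergence; this is why d = N is still
allowed at t = −1/N. -/
lemma summable_seqCount {t : ℝ} (ht : 0 ≤ t) {m : ℕ} (hm : (m : ℝ) * t < 1) (n : ℕ) :
    n ≤ m + 1 → Summable fun r => (seqCount n r : ℝ) * t ^ r := by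
  induction n with
  | zero =>
    intro _
    refine summable_of_hasFiniteSupport ((Set.finite_singleton 0).subset fun r hr => ?_)
    by_contra h
    have h : r ≠ 0 := h
    simp [seqCount, h] at hr
  | succ n ih =>
    intro hn
    have h1 := ih (by omega)
    have hnt : (n : ℝ) * t < 1 :=
      lt_of_le_of_lt (mul_le_mul_of_nonneg_right (by exact_mod_cast (by omega : n ≤ m)) ht) hm
    have h2 : Summable fun r => ((n : ℝ) * t) ^ r :=
      summable_geometric_of_lt_one (by positivity) hnt
    have h3 := summable_norm_sum_mul_antidiagonal_of_summable_norm h1.norm h2.norm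
    refine h3.of_norm.congr fun r => ?_
    rw [seqCount, Nat.cast_sum, Finset.sum_mul]
    refine Finset.sum_congr rfl fun p hp => ?_
    rw [← Finset.HasAntidiagonal.mem_antidiagonal.1 hp, pow_add, mul_pow]
    push_cast
    ring

lemma summable_monoCount {S : ℕ → Finset G} (hS : ∀ n, (S n).card ≤ n) {t : ℂ} {m : ℕ}
    (hm : (m : ℝ) * ‖t‖ < 1) {n : ℕ} (hn : n ≤ m + 1) (g : G) :
    Summable fun r => ‖t ^ r * monoCount S n r g‖ := by
  refine (summable_seqCount (norm_nonneg t) hm n hn).of_nonneg_of_le (fun r => norm_nonneg _)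
    fun r => ?_
  rw [norm_mul, norm_pow, Complex.norm_natCast, mul_comm]
  exact mul_le_mul_of_nonneg_right (by exact_mod_cast monoCount_le hS n r g) (by positivity)

/-- The generating function of the numbers of monotone factorisations. -/
def monoGen (S : ℕ → Finset G) (t : ℂ) (n : ℕ) (g : G) : ℂ := ∑' r, t ^ r * monoCount S n r g

lemma hasSum_monoGen {S : ℕ → Finset G} (hS : ∀ n, (S n).card ≤ n) {t : ℂ} {m : ℕ}
    (hm : (m : ℝ) * ‖t‖ < 1) {n : ℕ} (hn : n ≤ m + 1) (g : G) :
    HasSum (fun r => t ^ r * monoCount S n r g) (monoGen S t n g) :=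
  (summable_monoCount hS hm hn g).of_norm.hasSum

lemma monoGen_zero (S : ℕ → Finset G) (t : ℂ) (g : G) :
    monoGen S t 0 g = if g = 1 then 1 else 0 := by
  rw [monoGen, tsum_eq_single 0]
  · simp [monoCount_zero_right]
  · intro r hr
    obtain ⟨r, rfl⟩ := Nat.exists_eq_succ_of_ne_zero hr
    simp [monoCount_zero_succ]

/-- Writing G_n for the generating element, this is G_{n+1} (1 − t ∑ S_n) = G_n, with ∑ S_n the sum
of the elements of `S n`, read off coefficientwise after splitting off r = 0. -/
lemma monoGen_succ {S : ℕ → Finset G} (hS : ∀ n, (S n).card ≤ n) {t : ℂ} {m : ℕ}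
    (hm : (m : ℝ) * ‖t‖ < 1) {n : ℕ} (hn : n + 1 ≤ m + 1) (g : G) :
    monoGen S t (n + 1) g = monoGen S t n g + t * ∑ x ∈ S n, monoGen S t (n + 1) (g * x⁻¹) := by
  have h1 := hasSum_monoGen hS hm hn g
  have h2 := hasSum_monoGen hS hm (by omega : n ≤ m + 1) g
  have h3 := (hasSum_sum fun x (_ : x ∈ S n) => hasSum_monoGen hS hm hn (g * x⁻¹)).mul_left t
  rw [← hasSum_nat_add_iff' 1] at h1 h2
  have h4 := h1.unique ((h2.add h3).congr_fun fun r => by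
    simp only [monoCount_succ_succ, Nat.cast_add, Nat.cast_sum, mul_add, Finset.mul_sum,
      pow_succ']
    simp only [mul_assoc])
  simp only [Finset.range_one, Finset.sum_singleton, monoCount_zero_right] at h4
  linear_combination h4

end Mono

/-- The transpositions `(s n)` with `s < n`, the letters being `0, …, d - 1`. -/
def transp (d n : ℕ) : Finset (Equiv.Perm (Fin d)) :=
  if h : n < d then
    Finset.univ.image fun s : Fin n => Equiv.swap ⟨s, s.2.trans h⟩ ⟨n, h⟩
  else ∅

lemma card_transp_le (d n : ℕ) : (transp d n).card ≤ n := by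
  rw [transp]
  split_ifs with h
  · exact Finset.card_image_le.trans (by simp)
  · simp

lemma swap_left_injective {α : Type*} [DecidableEq α] (b : α) :
    Function.Injective fun a : α => Equiv.swap a b := by
  intro a a' h
  have := congrArg (fun σ : Equiv.Perm α => σ b) h
  simpa using this

lemma sum_transp {d n : ℕ} (h : n < d) {M : Type*} [AddCommMonoid M] (f : Equiv.Perm (Fin d) → M) :
    ∑ x ∈ transp d n, f x = ∑ s : Fin n, f (Equiv.swap ⟨s, s.2.trans h⟩ ⟨n, h⟩) := by
  rw [transp, dif_pos h, Finset.sum_image]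
  intro a _ b _ hab
  have := swap_left_injective _ hab
  simpa [Fin.ext_iff] using this

lemma sign_of_monoCount_ne_zero {d : ℕ} (n : ℕ) : ∀ r (π : Equiv.Perm (Fin d)),
    monoCount (transp d) n r π ≠ 0 → Equiv.Perm.sign π = (-1) ^ r := by
  induction n with
  | zero =>
    intro r π h
    cases r with
    | zero =>
      rw [monoCount_zero_right] at h
      have : π = 1 := by by_contra h'; simp [h'] at h
      simp [this]
    | succ r => exact absurd (monoCount_zero_succ _ _ _) h
  | succ n ihn =>
    intro r
    induction r with
    | zero =>
      intro π h
      rw [monoCount_zero_right] at h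
      have : π = 1 := by by_contra h'; simp [h'] at h
      simp [this]
    | succ r ihr =>
      intro π h
      rw [monoCount_succ_succ] at h
      by_cases h0 : monoCount (transp d) n (r + 1) π = 0
      · rw [h0, zero_add] at h
        obtain ⟨x, hx, hne⟩ := Finset.exists_ne_zero_of_sum_ne_zero h
        have h1 := ihr _ hne
        have h2 : Equiv.Perm.sign x = -1 := by
          rw [transp] at hx
          split_ifs at hx with hd
          · obtain ⟨s, -, rfl⟩ := Finset.mem_image.1 hx
            exact Equiv.Perm.sign_swap (by simp [Fin.ext_iff, s.2.ne])
          · simp at hx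
        rw [map_mul, map_inv, h2] at h1
        rw [pow_succ, ← h1]
        simp
      · exact ihn _ _ h0

/-! ### The inverse of the normalised trace -/

lemma trace_permMat {d N : ℕ} (π : Equiv.Perm (Fin d)) :
    (permMat N π).trace = ∑ I : Fin d → Fin N, if I = I ∘ π then 1 else 0 := rfl

/-- Multiplying by (m n) joins the fixed point n to the cycle of m, so one cycle is lost. In terms
of index functions, the value I n is free for τ but tied to I m for the product; shifting I n
cyclically by c matches the solutions of I m = I n with those of I m = I n + c. -/
lemma trace_permMat_swap_mul {d N : ℕ} [NeZero N] {τ : Equiv.Perm (Fin d)} {m n : Fin d}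
    (hmn : m ≠ n) (hτ : τ n = n) :
    (N : ℂ) * (permMat N (Equiv.swap m n * τ)).trace = (permMat N τ).trace := by
  have h1 : ∀ I : Fin d → Fin N, I = I ∘ (Equiv.swap m n * τ) ↔ (I = I ∘ τ ∧ I m = I n) := by
    intro I
    have hs : I m = I n → I ∘ Equiv.swap m n = I := by
      intro h
      funext k
      rw [Function.comp_apply, Equiv.swap_apply_def]
      split_ifs with h1 h2
      · rw [h1, h]
      · rw [h2, h]
      · rfl
    constructor
    · intro h
      have hn : I m = I n := by
        have := congrFun h n
        simpa [hτ] using this.symm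
      refine ⟨?_, hn⟩
      conv_lhs => rw [h, Equiv.Perm.coe_mul, ← Function.comp_assoc, hs hn]
    · rintro ⟨h, hn⟩
      rw [Equiv.Perm.coe_mul, ← Function.comp_assoc, hs hn]
      exact h
  have h0 : (permMat N (Equiv.swap m n * τ)).trace
      = ∑ I : Fin d → Fin N, if I = I ∘ τ ∧ I m = I n then 1 else 0 := by
    rw [trace_permMat]
    exact Finset.sum_congr rfl fun I _ => if_congr (h1 I) rfl rfl
  rw [h0, trace_permMat]
  have h2 : ∀ c : Fin N, ∑ I : Fin d → Fin N, (if I = I ∘ τ ∧ I m = I n then (1 : ℂ) else 0)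
      = ∑ I : Fin d → Fin N, if I = I ∘ τ then (if I m = I n + c then 1 else 0) else 0 := by
    intro c
    rw [← Equiv.sum_comp (Equiv.addRight (Pi.single n c : Fin d → Fin N))]
    refine Finset.sum_congr rfl fun I _ => ?_
    have h3 : (Pi.single n c : Fin d → Fin N) ∘ τ = Pi.single n c := by
      funext k
      by_cases hk : k = n
      · subst hk; simp [hτ]
      · have : τ k ≠ n := fun h => hk (τ.injective (h.trans hτ.symm))
        simp [this, hk]
    have h4 : (I + Pi.single n c = (I + Pi.single n c) ∘ τ) ↔ I = I ∘ τ := by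
      rw [show (I + Pi.single n c) ∘ τ = I ∘ τ + (Pi.single n c : Fin d → Fin N) ∘ τ from rfl, h3,
        add_left_inj]
    rw [ite_and]
    simp only [Equiv.coe_addRight, h4]
    simp [hmn]
  have h5 : ∀ z : ℂ, (N : ℂ) * z = ∑ _c : Fin N, z := fun z => by simp
  rw [h5, Finset.sum_congr rfl fun (c : Fin N) _ => h2 c, Finset.sum_comm]
  refine Finset.sum_congr rfl fun I _ => ?_
  split_ifs
  · have : ∀ c : Fin N, I m = I n + c ↔ I m - I n = c := fun c => by rw [sub_eq_iff_eq_add']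
    simp [this]
  · simp

/-- The restriction of `normTrace` to the permutations fixing all letters `k ≥ n`. -/
def normTraceBelow (N : ℕ) {d : ℕ} (n : ℕ) (π : Equiv.Perm (Fin d)) : ℂ :=
  open Classical in if ∀ k : Fin d, n ≤ k → π k = k then normTrace N π else 0

/-- One factor 1 + J_n/N of Jucys' factorisation. A permutation fixing everything above n either
fixes n, or becomes one fixing n after multiplication by exactly one transposition (s n), namely
that with s = σ(n); the latter costs a factor 1/N. -/
lemma normTraceBelow_succ {d N n : ℕ} [NeZero N] (h : n < d) (σ : Equiv.Perm (Fin d)) :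
    normTraceBelow N (n + 1) σ
      = normTraceBelow N n σ + (N : ℂ)⁻¹ * ∑ x ∈ transp d n, normTraceBelow N n (x * σ) := by
  have hN : (N : ℂ) ≠ 0 := Nat.cast_ne_zero.2 (NeZero.ne N)
  rw [sum_transp h]
  set ν : Fin d := ⟨n, h⟩ with hν
  by_cases hσ : ∀ k : Fin d, n + 1 ≤ k → σ k = k
  · rw [normTraceBelow, if_pos hσ]
    have hle : (σ ν : ℕ) ≤ n := by
      by_contra hlt
      have h1 := hσ (σ ν) (by omega)
      have h2 := σ.injective h1
      rw [h2] at hlt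
      exact hlt le_rfl
    have hcase : ∀ s : Fin n, (∀ k : Fin d, n ≤ k → (Equiv.swap ⟨s, s.2.trans h⟩ ν * σ) k = k)
        ↔ (s : ℕ) = σ ν := by
      intro s
      have hsν : (⟨s, s.2.trans h⟩ : Fin d) ≠ ν := by simp [hν, Fin.ext_iff, s.2.ne]
      constructor
      · intro hk
        have := hk ν le_rfl
        rw [Equiv.Perm.mul_apply, Equiv.swap_apply_eq_iff, Equiv.swap_apply_right] at this
        rw [this]
      · intro hs k hk
        rcases eq_or_lt_of_le hk with hk | hk
        · have : k = ν := Fin.ext hk.symm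
          rw [this, Equiv.Perm.mul_apply, Equiv.swap_apply_eq_iff, Equiv.swap_apply_right]
          exact Fin.ext hs.symm
        · rw [Equiv.Perm.mul_apply, hσ k hk, Equiv.swap_apply_of_ne_of_ne]
          · rw [Ne, Fin.ext_iff]; have := s.2; simp only; omega
          · rw [Ne, Fin.ext_iff]; simp only [hν]; omega
    simp only [normTraceBelow, hcase]
    by_cases hn : (σ ν : ℕ) = n
    · rw [if_pos, Finset.sum_eq_zero, mul_zero, add_zero]
      · intro s _
        rw [if_neg]
        rw [hn]; exact s.2.ne
      · intro k hk
        rcases eq_or_lt_of_le hk with hk | hk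
        · have : k = ν := Fin.ext hk.symm
          rw [this]; exact Fin.ext hn
        · exact hσ k hk
    · have hlt : (σ ν : ℕ) < n := lt_of_le_of_ne hle hn
      rw [if_neg (fun hk => hn (congrArg Fin.val (hk ν le_rfl))), zero_add,
        Finset.sum_eq_single ⟨σ ν, hlt⟩]
      · rw [if_pos rfl]
        simp only [Fin.eta]
        have h1 := trace_permMat_swap_mul (N := N) (m := σ ν) (n := ν)
          (τ := Equiv.swap (σ ν) ν * σ) (fun h => hn (congrArg Fin.val h)) (by simp)
        rw [← mul_assoc, Equiv.swap_mul_self, one_mul] at h1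
        rw [normTrace, normTrace, ← h1]
        field_simp
      · intro s _ hs
        rw [if_neg]
        intro h'
        exact hs (Fin.ext h')
      · simp
  · have h0 : ∀ τ : Equiv.Perm (Fin d), (∀ k : Fin d, n ≤ k → τ k = k) →
        ∀ k : Fin d, n + 1 ≤ k → τ k = k := fun τ hτ k hk => hτ k (by omega)
    rw [normTraceBelow, if_neg hσ, normTraceBelow, if_neg (fun h' => hσ (h0 σ h')),
      Finset.sum_eq_zero, mul_zero, add_zero]
    intro s _
    rw [normTraceBelow, if_neg]
    intro h'
    refine hσ fun k hk => ?_
    have := h0 _ h' k hk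
    rwa [Equiv.Perm.mul_apply, Equiv.swap_apply_eq_iff, Equiv.swap_apply_of_ne_of_ne] at this
    · rw [Ne, Fin.ext_iff]; have := s.2; simp only; omega
    · rw [Ne, Fin.ext_iff]; simp only [hν]; omega

/-- With G_n and T_n for the two elements, G_n = G_{n+1}(1 + J_n/N) and T_{n+1} = (1 + J_n/N) T_n,
so G_{n+1} T_{n+1} = G_n T_n and the product stays equal to 1. No commutativity is needed. -/
lemma sum_monoGen_mul_normTraceBelow {d N : ℕ} (hd : 1 ≤ d) (hdN : d ≤ N) [NeZero N] (n : ℕ) :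
    n ≤ d → ∀ π : Equiv.Perm (Fin d),
    ∑ τ, monoGen (transp d) (-(N : ℂ)⁻¹) n (π * τ⁻¹) * normTraceBelow N n τ
      = if π = 1 then 1 else 0 := by
  have hN : (N : ℂ) ≠ 0 := Nat.cast_ne_zero.2 (NeZero.ne N)
  induction n with
  | zero =>
    intro _ π
    rw [Finset.sum_eq_single 1]
    · have : normTraceBelow N 0 (1 : Equiv.Perm (Fin d)) = 1 := by
        rw [normTraceBelow, if_pos (by simp), normTrace, trace_permMat]
        simp [hN]
      rw [this, monoGen_zero]
      simp
    · intro τ _ hτ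
      rw [normTraceBelow, if_neg, mul_zero]
      intro h
      exact hτ (Equiv.ext fun k => h k (Nat.zero_le _))
    · simp
  | succ n ih =>
    intro hn π
    have hm : ((d - 1 : ℕ) : ℝ) * ‖-(N : ℂ)⁻¹‖ < 1 := by
      rw [norm_neg, norm_inv, Complex.norm_natCast]
      have : (0 : ℝ) < N := by exact_mod_cast NeZero.pos N
      rw [← div_eq_mul_inv, div_lt_one this]
      exact_mod_cast (by omega : d - 1 < N)
    rw [← ih (by omega) π]
    have hinv : ∀ x ∈ transp d n, x⁻¹ = x := by
      intro x hx
      rw [transp] at hx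
      split_ifs at hx with hd
      · obtain ⟨s, -, rfl⟩ := Finset.mem_image.1 hx
        exact Equiv.swap_inv _ _
      · simp at hx
    have h1 : ∀ τ : Equiv.Perm (Fin d), monoGen (transp d) (-(N : ℂ)⁻¹) n (π * τ⁻¹)
        = monoGen (transp d) (-(N : ℂ)⁻¹) (n + 1) (π * τ⁻¹) + (N : ℂ)⁻¹ *
          ∑ x ∈ transp d n, monoGen (transp d) (-(N : ℂ)⁻¹) (n + 1) (π * τ⁻¹ * x⁻¹) := by
      intro τ
      rw [monoGen_succ (card_transp_le d) hm (n := n) (by omega)]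
      ring
    simp only [h1, normTraceBelow_succ (N := N) (show n < d by omega), mul_add, add_mul,
      Finset.sum_add_distrib]
    congr 1
    simp only [Finset.mul_sum, Finset.sum_mul]
    rw [Finset.sum_comm, Finset.sum_comm (s := Finset.univ)]
    refine Finset.sum_congr rfl fun x hx => ?_
    -- Reindexing by the involution x moves the transposition from one factor of the convolution to
    -- the other.
    rw [← Equiv.sum_comp (Equiv.mulLeft x)]
    refine Finset.sum_congr rfl fun τ _ => ?_
    have hxx : x * (x * τ) = τ := by
      nth_rewrite 1 [← hinv x hx]
      rw [inv_mul_cancel_left]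
    rw [Equiv.coe_mulLeft, hxx, mul_inv_rev, ← mul_assoc π]
    ring

lemma sum_monoGen_mul_normTrace {d N : ℕ} (hd : 1 ≤ d) (hdN : d ≤ N) [NeZero N]
    (π : Equiv.Perm (Fin d)) :
    ∑ τ, monoGen (transp d) (-(N : ℂ)⁻¹) d (π * τ⁻¹) * normTrace N τ
      = if π = 1 then 1 else 0 := by
  rw [← sum_monoGen_mul_normTraceBelow hd hdN d le_rfl π]
  refine Finset.sum_congr rfl fun τ _ => ?_
  rw [normTraceBelow, if_pos]
  intro k hk
  exact absurd k.2 (by omega)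

/-! ### Monotone walks as monotone factorisations -/

open Classical in
/-- The monotone `r`-step walks from `σ` to `τ` all of whose labels are less than `n`. -/
def walks {d : ℕ} (n r : ℕ) (σ τ : Equiv.Perm (Fin d)) : Finset (Fin (r + 1) → Equiv.Perm (Fin d)) :=
  {w | (∃ s t : Fin r → Fin d, (∀ i, s i < t i) ∧
    (∀ i : Fin r, w i.succ = w i.castSucc * Equiv.swap (s i) (t i)) ∧ Monotone t ∧
    ∀ i, (t i : ℕ) < n) ∧ w 0 = σ ∧ w (Fin.last r) = τ}

lemma mem_walks {d n r : ℕ} {σ τ : Equiv.Perm (Fin d)} {w : Fin (r + 1) → Equiv.Perm (Fin d)} :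
    w ∈ walks n r σ τ ↔ (∃ s t : Fin r → Fin d, (∀ i, s i < t i) ∧
    (∀ i : Fin r, w i.succ = w i.castSucc * Equiv.swap (s i) (t i)) ∧ Monotone t ∧
    ∀ i, (t i : ℕ) < n) ∧ w 0 = σ ∧ w (Fin.last r) = τ := by
  simp [walks]

lemma snoc_mem_walks {d n r : ℕ} (h : n < d) {σ τ : Equiv.Perm (Fin d)} {s : Fin n}
    {w : Fin (r + 1) → Equiv.Perm (Fin d)}
    (hw : w ∈ walks (n + 1) r σ (τ * Equiv.swap ⟨s, s.2.trans h⟩ ⟨n, h⟩)) :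
    (Fin.snoc w τ : Fin (r + 2) → Equiv.Perm (Fin d)) ∈ walks (n + 1) (r + 1) σ τ := by
  obtain ⟨⟨a, b, hab, hstep, hmono, hlt⟩, h0, hl⟩ := mem_walks.1 hw
  rw [mem_walks]
  refine ⟨⟨Fin.snoc a ⟨s, s.2.trans h⟩, Fin.snoc b ⟨n, h⟩, ?_, ?_, ?_, ?_⟩, ?_, ?_⟩
  · intro i
    refine Fin.lastCases ?_ (fun i => ?_) i
    · simp only [Fin.snoc_last]
      exact s.2
    · simp only [Fin.snoc_castSucc (α := fun _ => Fin d)]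
      exact hab i
  · intro i
    refine Fin.lastCases ?_ (fun i => ?_) i
    · simp only [Fin.snoc_last, Fin.succ_last, Fin.snoc_castSucc (α := fun _ => Equiv.Perm (Fin d))]
      rw [hl, mul_assoc, Equiv.swap_mul_self, mul_one]
    · simp only [Fin.succ_castSucc, Fin.snoc_castSucc (α := fun _ => Equiv.Perm (Fin d)),
        Fin.snoc_castSucc (α := fun _ => Fin d)]
      exact hstep i
  · intro i j
    refine Fin.lastCases ?_ (fun j => ?_) j
    · intro _
      refine Fin.lastCases ?_ (fun i => ?_) i
      · exact le_rfl
      · simp only [Fin.snoc_last, Fin.snoc_castSucc (α := fun _ => Fin d)]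
        exact Nat.lt_succ_iff.1 (hlt i)
    · refine Fin.lastCases ?_ (fun i => ?_) i
      · intro hle
        exact absurd hle (not_le.2 (Fin.castSucc_lt_last j))
      · intro hle
        simp only [Fin.snoc_castSucc (α := fun _ => Fin d)]
        exact hmono (by simpa using hle)
  · intro i
    refine Fin.lastCases ?_ (fun i => ?_) i
    · simp
    · simp only [Fin.snoc_castSucc (α := fun _ => Fin d)]
      exact hlt i
  · rw [← Fin.castSucc_zero, Fin.snoc_castSucc (α := fun _ => Equiv.Perm (Fin d)), h0]
  · simp

/-- Split on the last label. If it is below n then so are all labels, by monotonicity; otherwise it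
equals n, and deleting the last step leaves an arbitrary walk with labels at most n. -/
lemma walks_succ_succ {d n r : ℕ} (h : n < d) (σ τ : Equiv.Perm (Fin d)) :
    walks (n + 1) (r + 1) σ τ = walks n (r + 1) σ τ ∪
      (Finset.univ : Finset (Fin n)).biUnion fun s =>
        (walks (n + 1) r σ (τ * Equiv.swap ⟨s, s.2.trans h⟩ ⟨n, h⟩)).image
          fun w => (Fin.snoc w τ : Fin (r + 2) → Equiv.Perm (Fin d)) := by
  ext w
  simp only [Finset.mem_union, Finset.mem_biUnion, Finset.mem_univ, true_and, Finset.mem_image]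
  constructor
  · intro hw
    obtain ⟨⟨a, b, hab, hstep, hmono, hlt⟩, h0, hl⟩ := mem_walks.1 hw
    rcases Nat.lt_or_ge (b (Fin.last r)) n with hb | hb
    · left
      rw [mem_walks]
      exact ⟨⟨a, b, hab, hstep, hmono, fun i =>
        lt_of_le_of_lt (Fin.le_def.1 (hmono (Fin.le_last i))) hb⟩, h0, hl⟩
    · right
      have hb' : b (Fin.last r) = ⟨n, h⟩ :=
        Fin.ext (le_antisymm (Nat.lt_succ_iff.1 (hlt _)) hb)
      have ha : (a (Fin.last r) : ℕ) < n := by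
        have := hab (Fin.last r)
        rw [hb'] at this
        exact this
      have hstepl := hstep (Fin.last r)
      rw [Fin.succ_last, hl, hb'] at hstepl
      refine ⟨⟨a (Fin.last r), ha⟩, Fin.init w, ?_, ?_⟩
      · rw [mem_walks]
        refine ⟨⟨fun i => a i.castSucc, fun i => b i.castSucc, fun i => hab _, fun i => ?_,
          fun i j hij => hmono (by simpa using hij), fun i => hlt _⟩, h0, ?_⟩
        · have := hstep i.castSucc
          rw [Fin.succ_castSucc] at this
          exact this
        · change w (Fin.last r).castSucc = _
          rw [hstepl, mul_assoc, Equiv.swap_mul_self, mul_one]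
      · rw [← hl]
        exact Fin.snoc_init_self w
  · rintro (hw | ⟨s, w, hw, rfl⟩)
    · obtain ⟨⟨a, b, hab, hstep, hmono, hlt⟩, h0, hl⟩ := mem_walks.1 hw
      rw [mem_walks]
      exact ⟨⟨a, b, hab, hstep, hmono, fun i => (hlt i).trans (Nat.lt_succ_self n)⟩, h0, hl⟩
    · exact snoc_mem_walks h hw

lemma card_walks {d : ℕ} (n : ℕ) : n ≤ d → ∀ (r : ℕ) (σ τ : Equiv.Perm (Fin d)),
    (walks n r σ τ).card = monoCount (transp d) n r (σ⁻¹ * τ) := by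
  have hz : ∀ n (σ τ : Equiv.Perm (Fin d)),
      (walks n 0 σ τ).card = monoCount (transp d) n 0 (σ⁻¹ * τ) := by
    intro n σ τ
    rw [monoCount_zero_right]
    split_ifs with h
    · rw [inv_mul_eq_one] at h
      subst h
      rw [Finset.card_eq_one]
      refine ⟨fun _ => σ, ?_⟩
      ext w
      rw [mem_walks, Finset.mem_singleton]
      constructor
      · rintro ⟨-, h0, -⟩
        funext i
        rw [Fin.fin_one_eq_zero i, h0]
      · rintro rfl
        exact ⟨⟨Fin.elim0, Fin.elim0, fun i => i.elim0, fun i => i.elim0, fun i => i.elim0,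
          fun i => i.elim0⟩, rfl, rfl⟩
    · rw [Finset.card_eq_zero, Finset.eq_empty_iff_forall_notMem]
      intro w hw
      obtain ⟨-, h0, hl⟩ := mem_walks.1 hw
      exact h (inv_mul_eq_one.2 (h0.symm.trans hl))
  induction n with
  | zero =>
    intro _ r σ τ
    cases r with
    | zero => exact hz _ _ _
    | succ r =>
      rw [monoCount_zero_succ, Finset.card_eq_zero, Finset.eq_empty_iff_forall_notMem]
      intro w hw
      obtain ⟨⟨a, b, -, -, -, hlt⟩, -, -⟩ := mem_walks.1 hw
      exact absurd (hlt 0) (Nat.not_lt_zero _)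
  | succ n ihn =>
    intro hn r
    induction r with
    | zero => intro σ τ; exact hz _ _ _
    | succ r ihr =>
      intro σ τ
      have h : n < d := hn
      have hinj : Function.Injective fun w : Fin (r + 1) → Equiv.Perm (Fin d) =>
          (Fin.snoc w τ : Fin (r + 2) → Equiv.Perm (Fin d)) := by
        intro w w' hww
        have := congrArg Fin.init hww
        simpa only [Fin.init_snoc] using this
      have hlast : ∀ (s : Fin n) (w : Fin (r + 1) → Equiv.Perm (Fin d)),
          w ∈ walks (n + 1) r σ (τ * Equiv.swap ⟨s, s.2.trans h⟩ ⟨n, h⟩) →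
          w (Fin.last r) = τ * Equiv.swap ⟨s, s.2.trans h⟩ ⟨n, h⟩ := fun s w hw =>
        (mem_walks.1 hw).2.2
      rw [walks_succ_succ h, Finset.card_union_of_disjoint, Finset.card_biUnion, monoCount_succ_succ,
        ihn (by omega), sum_transp h]
      · congr 1
        refine Finset.sum_congr rfl fun s _ => ?_
        rw [Finset.card_image_of_injective _ hinj, ihr, Equiv.swap_inv, mul_assoc]
      · intro s _ s' _ hss
        refine Finset.disjoint_left.2 ?_
        intro w hw hw'
        obtain ⟨v, hv, rfl⟩ := Finset.mem_image.1 hw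
        obtain ⟨v', hv', hvv⟩ := Finset.mem_image.1 hw'
        have := hinj hvv
        subst this
        have h1 := (hlast s _ hv).symm.trans (hlast s' _ hv')
        have h2 := swap_left_injective _ (mul_left_cancel h1)
        exact hss (by simpa [Fin.ext_iff] using h2)
      · rw [Finset.disjoint_left]
        intro w hw hw'
        obtain ⟨s, -, hw'⟩ := Finset.mem_biUnion.1 hw'
        obtain ⟨v, hv, rfl⟩ := Finset.mem_image.1 hw'
        obtain ⟨⟨a, b, hab, hstep, -, hlt⟩, -, -⟩ := mem_walks.1 hw
        have h1 := hstep (Fin.last r)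
        simp only [Fin.snoc_last, Fin.succ_last,
          Fin.snoc_castSucc (α := fun _ => Equiv.Perm (Fin d)), hlast s v hv] at h1
        rw [mul_assoc, left_eq_mul] at h1
        -- The last step would be both (s n) and a transposition of letters below n; the image of n
        -- tells them apart.
        have h2 := congrArg (fun π : Equiv.Perm (Fin d) => π ⟨n, h⟩) h1
        have hb := hlt (Fin.last r)
        have ha := Fin.lt_def.1 (hab (Fin.last r))
        simp only [Equiv.Perm.mul_apply, Equiv.Perm.one_apply] at h2
        rw [Equiv.swap_apply_of_ne_of_ne (a := a (Fin.last r)), Equiv.swap_apply_right] at h2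
        · exact s.2.ne (congrArg Fin.val h2)
        · rw [Ne, Fin.ext_iff]; simp only; omega
        · rw [Ne, Fin.ext_iff]; simp only; omega

/-- The cycle type of a permutation of `d` letters as a partition of `d`. -/
def typ {d : ℕ} (π : Equiv.Perm (Fin d)) : d.Partition where
  parts := π.partition.parts
  parts_pos := π.partition.parts_pos
  parts_sum := by rw [π.partition.parts_sum, Fintype.card_fin]

lemma hasType_iff {d : ℕ} {π : Equiv.Perm (Fin d)} {α : d.Partition} : HasType π α ↔ typ π = α :=
  (Nat.Partition.ext_iff (x := typ π) (y := α)).symm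

lemma monotoneWalkCount_eq {d : ℕ} (r : ℕ) (α β : d.Partition) :
    monotoneWalkCount r α β = ∑ σ with typ σ = α, ∑ τ with typ τ = β,
      monoCount (transp d) d r (σ⁻¹ * τ) := by
  classical
  rw [monotoneWalkCount, Nat.card_eq_fintype_card, Fintype.card_subtype,
    ← Finset.sum_product', Finset.card_eq_sum_card_fiberwise
      (f := fun w => (w 0, w (Fin.last r)))
      (t := ({σ | typ σ = α} : Finset (Equiv.Perm (Fin d))) ×ˢ
        ({τ | typ τ = β} : Finset (Equiv.Perm (Fin d))))]
  · refine Finset.sum_congr rfl fun x hx => ?_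
    rw [← card_walks d le_rfl]
    congr 1
    ext w
    simp only [Finset.mem_product, Finset.mem_filter, Finset.mem_univ, true_and] at hx
    simp only [Finset.mem_filter, Finset.mem_univ, true_and, mem_walks, IsMonotoneWalk,
      hasType_iff, Prod.ext_iff]
    constructor
    · rintro ⟨⟨⟨s, t, h1, h2, h3⟩, -, -⟩, h0, hl⟩
      exact ⟨⟨s, t, h1, h2, h3, fun i => (t i).2⟩, h0, hl⟩
    · rintro ⟨⟨s, t, h1, h2, h3, -⟩, h0, hl⟩
      exact ⟨⟨⟨s, t, h1, h2, h3⟩, h0 ▸ hx.1, hl ▸ hx.2⟩, h0, hl⟩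
  · intro w hw
    simp only [Finset.coe_filter, Finset.mem_univ, true_and, Set.mem_ofPred_eq, hasType_iff] at hw
    simp [hw.2.1, hw.2.2]

/-! ### Expansion by genus -/

lemma sign_eq_neg_one_pow {d : ℕ} (π : Equiv.Perm (Fin d)) :
    Equiv.Perm.sign π = (-1) ^ (d + len (typ π)) := by
  have hle : π.support.card ≤ d := by simpa using π.support.card_le_univ
  have h : d + len (typ π)
      = (π.cycleType.sum + π.cycleType.card) + 2 * (d - π.support.card) := by
    simp only [len, typ, Equiv.Perm.parts_partition, Multiset.card_add, Multiset.card_replicate,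
      Fintype.card_fin, Equiv.Perm.sum_cycleType]
    omega
  rw [h, Equiv.Perm.sign_of_cycleType, pow_add _ _ (2 * _), pow_mul]
  simp

lemma len_le {d : ℕ} (α : d.Partition) : len α ≤ d := by
  have h : (α.parts.map fun _ => 1).sum ≤ (α.parts.map id).sum :=
    Multiset.sum_map_le_sum_map _ _ fun i hi => α.parts_pos hi
  simpa [len, α.parts_sum] using h

lemma typ_eq_ones_iff {d : ℕ} {π : Equiv.Perm (Fin d)} : typ π = ones d ↔ π = 1 := by
  constructor
  · intro h
    have h1 : π.cycleType + Multiset.replicate (Fintype.card (Fin d) - π.support.card) 1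
        = Multiset.replicate d 1 := congrArg Nat.Partition.parts h
    rw [← Equiv.Perm.cycleType_eq_zero, Multiset.eq_zero_iff_forall_notMem]
    intro c hc
    have h2 := Equiv.Perm.two_le_of_mem_cycleType hc
    have h3 : c ∈ Multiset.replicate d 1 := by rw [← h1]; simp [hc]
    have := Multiset.eq_of_mem_replicate h3
    omega
  · rintro rfl
    refine Nat.Partition.ext ?_
    simp [typ, ones, Equiv.Perm.parts_partition]

/-- Each step changes the sign, and a permutation of type α has sign (−1)^(d + ℓ(α)). -/
lemma monotoneWalkCount_parity {d r : ℕ} {α β : d.Partition} (h : monotoneWalkCount r α β ≠ 0) :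
    Even (r + len α + len β) := by
  rw [monotoneWalkCount_eq] at h
  obtain ⟨σ, hσ, h⟩ := Finset.exists_ne_zero_of_sum_ne_zero h
  obtain ⟨τ, hτ, h⟩ := Finset.exists_ne_zero_of_sum_ne_zero h
  simp only [Finset.mem_filter, Finset.mem_univ, true_and] at hσ hτ
  have h1 := sign_of_monoCount_ne_zero _ _ _ h
  rw [map_mul, map_inv, sign_eq_neg_one_pow, sign_eq_neg_one_pow, hσ, hτ, Int.units_inv_eq_self,
    ← pow_add] at h1
  have h2 : (-1 : ℤˣ) ^ (d + len α + (d + len β) + r) = 1 := by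
    rw [pow_add, h1, ← pow_add, ← two_mul, pow_mul]; simp
  have h3 : Even (d + len α + (d + len β) + r) := by
    by_contra hodd
    rw [Nat.not_even_iff_odd] at hodd
    rw [hodd.neg_one_pow] at h2
    exact absurd h2 (by decide)
  obtain ⟨k, hk⟩ := h3
  have hd : len α + len β + r + 2 * d = 2 * k := by omega
  exact ⟨k - d, by omega⟩

/-- Substituting r = 2g − 2 + ℓ(α) + ℓ(β) turns (−N)^(ℓ(α)+ℓ(β)) (−1/N)^r into N^(2−2g); parity
makes the signs cancel. As ℓ(α) + ℓ(β) ≤ 2d, the condition r ≥ 0 forces g ≥ 1 − d. -/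
lemma hasSum_doubleHurwitz {d N : ℕ} (hd : 1 ≤ d) (hdN : d ≤ N) (α β : d.Partition) :
    HasSum (fun g : Genus d => (N : ℂ) ^ (2 - 2 * g.1) * (doubleHurwitz g.1 α β : ℂ))
      ((-(N : ℂ)) ^ (len α + len β) * ∑ σ with typ σ = α, ∑ τ with typ τ = β,
        monoGen (transp d) (-(N : ℂ)⁻¹) d (σ⁻¹ * τ)) := by
  have hN0 : (N : ℂ) ≠ 0 := Nat.cast_ne_zero.2 (by omega)
  have hm : ((d - 1 : ℕ) : ℝ) * ‖-(N : ℂ)⁻¹‖ < 1 := by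
    rw [norm_neg, norm_inv, Complex.norm_natCast]
    have : (0 : ℝ) < N := by exact_mod_cast (by omega : 0 < N)
    rw [← div_eq_mul_inv, div_lt_one this]
    exact_mod_cast (by omega : d - 1 < N)
  have h1 : HasSum (fun r : ℕ => (-(N : ℂ)) ^ (len α + len β) *
      ((-(N : ℂ)⁻¹) ^ r * (monotoneWalkCount r α β : ℂ)))
      ((-(N : ℂ)) ^ (len α + len β) * ∑ σ with typ σ = α, ∑ τ with typ τ = β,
        monoGen (transp d) (-(N : ℂ)⁻¹) d (σ⁻¹ * τ)) := by
    refine HasSum.mul_left _ ?_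
    simp only [monotoneWalkCount_eq, Nat.cast_sum, Finset.mul_sum]
    exact hasSum_sum fun σ _ => hasSum_sum fun τ _ =>
      hasSum_monoGen (card_transp_le d) hm (by omega) _
  set L : ℕ := len α + len β with hL
  have hL2 : L ≤ 2 * d := by have := len_le α; have := len_le β; omega
  have hdH : ∀ (g : ℤ) (r : ℕ), 2 * g - 2 + (L : ℤ) = r →
      doubleHurwitz g α β = monotoneWalkCount r α β := by
    intro g r hr
    have hr' : 2 * g - 2 + (len α : ℤ) + (len β : ℤ) = r := by rw [← hr, hL]; push_cast; ring
    rw [doubleHurwitz, hr', if_pos (by positivity), Int.toNat_natCast]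
  have hval : ∀ (g : ℤ) (r : ℕ), 2 * g - 2 + (L : ℤ) = r →
      (-(N : ℂ)) ^ L * ((-(N : ℂ)⁻¹) ^ r * (monotoneWalkCount r α β : ℂ))
      = (N : ℂ) ^ (2 - 2 * g) * (doubleHurwitz g α β : ℂ) := by
    intro g r hr
    rw [hdH g r hr, ← mul_assoc]
    congr 1
    have h2 : (2 - 2 * g : ℤ) = (L : ℤ) - (r : ℤ) := by omega
    rw [h2, zpow_sub₀ hN0, zpow_natCast, zpow_natCast, div_eq_mul_inv, neg_pow, neg_pow (N : ℂ)⁻¹,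
      inv_pow]
    have h3 : (-1 : ℂ) ^ L * (-1) ^ r = 1 := by
      rw [← pow_add]
      have : Even (L + r) := by
        rw [← Int.even_coe_nat]
        push_cast
        rw [← hr]
        exact ⟨g - 1 + L, by ring⟩
      exact this.neg_one_pow
    linear_combination (N : ℂ) ^ L * ((N : ℂ) ^ r)⁻¹ * h3
  have hnn : ∀ g : Function.support
      (fun g : Genus d => (N : ℂ) ^ (2 - 2 * g.1) * (doubleHurwitz g.1 α β : ℂ)),
      2 * g.1.1 - 2 + (L : ℤ) = ((2 * g.1.1 - 2 + (L : ℤ)).toNat : ℤ) := by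
    intro g
    have h2 := g.2
    rw [Function.mem_support, doubleHurwitz] at h2
    have h3 : 0 ≤ 2 * g.1.1 - 2 + (len α : ℤ) + (len β : ℤ) := by
      by_contra h'
      rw [if_neg h'] at h2
      simp at h2
    rw [Int.toNat_of_nonneg]
    rw [hL]; push_cast; omega
  -- The correspondence between g and r is a bijection of supports only: r of the wrong parity and g
  -- with negative r carry zero terms.
  refine (hasSum_iff_hasSum_of_ne_zero_bij
    (fun g => (2 * g.1.1 - 2 + (L : ℤ)).toNat) ?_ ?_ ?_).1 h1
  · intro x y hxy
    have hx := hnn x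
    have hy := hnn y
    refine Subtype.ext ?_
    have h2 : 2 * x.1.1 - 2 + (L : ℤ) = 2 * y.1.1 - 2 + (L : ℤ) :=
      hx.trans ((congrArg (Nat.cast : ℕ → ℤ) hxy).trans hy.symm)
    have h3 : x.1.1 = y.1.1 := by linarith
    exact Subtype.ext h3
  · intro r hr
    have hr2 : monotoneWalkCount r α β ≠ 0 := by
      intro h0
      rw [Function.mem_support, h0] at hr
      simp at hr
    obtain ⟨k, hk⟩ := monotoneWalkCount_parity hr2
    -- With r + L = 2k, solving 2g − 2 + L = r gives g = k − L + 1.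
    have hg : 2 * ((k : ℤ) - L + 1) - 2 + (L : ℤ) = r := by omega
    refine ⟨⟨⟨(k : ℤ) - L + 1, by omega⟩, ?_⟩, ?_⟩
    · rw [Function.mem_support, ← hval _ _ hg]
      exact hr
    · simp only [hg, Int.toNat_natCast]
  · intro g
    exact hval _ _ (hnn g)

/-! ### Coupling coefficients of power series -/

/-- Uniqueness of power series coefficients; any disc of positive radius suffices. -/
lemma couplingCoeff_eq {f : ℂ → ℂ} {c : ℕ → ℂ} {ρ : ℝ} (hρ : 0 < ρ)
    (h : ∀ z, ‖z‖ < ρ → HasSum (fun n => z ^ n * c n) (f z)) (d : ℕ) :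
    couplingCoeff f d = d.factorial * c d := by
  have h1 : HasFPowerSeriesAt f (FormalMultilinearSeries.ofScalars ℂ c) 0 := by
    rw [hasFPowerSeriesAt_iff]
    filter_upwards [Metric.ball_mem_nhds (0 : ℂ) hρ] with z hz
    simpa [FormalMultilinearSeries.coeff_ofScalars] using h z (by simpa using hz)
  have h2 := h1.analyticAt.hasFPowerSeriesAt
  have h3 := congrArg (fun p => p.coeff d) (h1.eq_formalMultilinearSeries h2)
  simp only [FormalMultilinearSeries.coeff_ofScalars] at h3
  rw [couplingCoeff, h3, mul_div_cancel₀ _ (Nat.cast_ne_zero.2 d.factorial_ne_zero)]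

/-- A continuous function on the compact group is bounded by some C, so the exponential series of
‖s‖C dominates and permits termwise integration. -/
lemma hasSum_integral_exp {N : ℕ} {f : U N → ℂ} (hf : Continuous f) (s : ℂ) :
    HasSum (fun n : ℕ => s ^ n / n.factorial * ∫ V, f V ^ n ∂(haarU N))
      (∫ V, Complex.exp (s * f V) ∂(haarU N)) := by
  obtain ⟨C, hC⟩ := (isCompact_range hf).isBounded.exists_norm_le
  have hC' : ∀ V, ‖f V‖ ≤ C := fun V => hC _ ⟨V, rfl⟩
  have hint : ∀ n : ℕ, Integrable (fun V => s ^ n / n.factorial * f V ^ n) (haarU N) := fun n =>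
    (integrable_haarU (hf.pow n)).const_mul _
  have h := hasSum_integral_of_summable_integral_norm hint (by
    refine (Real.summable_pow_div_factorial (‖s‖ * C)).of_nonneg_of_le
      (fun n => integral_nonneg fun V => norm_nonneg _) fun n => ?_
    have : (‖s‖ * C) ^ n / n.factorial
        = ∫ _V : U N, (‖s‖ * C) ^ n / n.factorial ∂(haarU N) := by simp
    rw [this]
    refine integral_mono (hint n).norm (integrable_const _) fun V => ?_
    simp only [norm_mul, norm_div, norm_pow, Complex.norm_natCast]
    rw [mul_pow, mul_div_right_comm]
    exact mul_le_mul_of_nonneg_left (pow_le_pow_left₀ (norm_nonneg _) (hC' V) n) (by positivity))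
  simp only [integral_const_mul] at h
  have he : (fun V => Complex.exp (s * f V))
      = fun V => ∑' n : ℕ, s ^ n / n.factorial * f V ^ n := by
    funext V
    rw [Complex.exp_eq_exp_ℂ, NormedSpace.exp_eq_tsum_div]
    refine tsum_congr fun n => ?_
    rw [mul_pow]; ring
  rw [he]
  exact h

lemma continuous_coe_unitary (N : ℕ) :
    Continuous fun V : U N => (V : Matrix (Fin N) (Fin N) ℂ) := continuous_subtype_val

lemma continuous_coe_inv_unitary (N : ℕ) :
    Continuous fun V : U N => ((V⁻¹ : U N) : Matrix (Fin N) (Fin N) ℂ) :=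
  (continuous_coe_unitary N).comp continuous_inv

lemma couplingCoeff_HCIZ (N : ℕ) (A B : Matrix (Fin N) (Fin N) ℂ) (d : ℕ) :
    couplingCoeff (HCIZ N A B) d = (N : ℂ) ^ d * ∫ V : U N,
      (A * (V : Matrix (Fin N) (Fin N) ℂ) * B
      * ((V⁻¹ : U N) : Matrix (Fin N) (Fin N) ℂ)).trace ^ d ∂(haarU N) := by
  have hc : Continuous fun V : U N => (A * (V : Matrix (Fin N) (Fin N) ℂ) * B
      * ((V⁻¹ : U N) : Matrix (Fin N) (Fin N) ℂ)).trace :=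
    (((continuous_const.matrix_mul (continuous_coe_unitary N)).matrix_mul
      continuous_const).matrix_mul (continuous_coe_inv_unitary N)).matrix_trace
  rw [couplingCoeff_eq one_pos (c := fun n => (N : ℂ) ^ n / n.factorial * ∫ V : U N,
      (A * (V : Matrix (Fin N) (Fin N) ℂ) * B
      * ((V⁻¹ : U N) : Matrix (Fin N) (Fin N) ℂ)).trace ^ n ∂(haarU N))]
  · have := Nat.cast_ne_zero (R := ℂ).2 d.factorial_ne_zero
    field_simp
  · intro z _
    refine (hasSum_integral_exp hc (z * N)).congr_fun fun n => ?_
    rw [mul_pow]; ring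

lemma trace_unit_mul {N : ℕ} {ζ : ℂ} (hζ : ζ * star ζ = 1) :
    ∃ Z : U N, (∀ (A : Matrix (Fin N) (Fin N) ℂ) (V : U N),
      (A * ((Z * V : U N) : Matrix (Fin N) (Fin N) ℂ)).trace
        = ζ * (A * (V : Matrix (Fin N) (Fin N) ℂ)).trace) ∧
      ∀ (A : Matrix (Fin N) (Fin N) ℂ) (V : U N),
      (A * (((Z * V)⁻¹ : U N) : Matrix (Fin N) (Fin N) ℂ)).trace
        = star ζ * (A * ((V⁻¹ : U N) : Matrix (Fin N) (Fin N) ℂ)).trace := by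
  have hZ : ζ • (1 : Matrix (Fin N) (Fin N) ℂ) ∈ Matrix.unitaryGroup (Fin N) ℂ := by
    rw [Matrix.mem_unitaryGroup_iff, star_smul, smul_mul_smul_comm, hζ]
    simp
  refine ⟨⟨_, hZ⟩, fun A V => ?_, fun A V => ?_⟩
  · rw [Submonoid.coe_mul]
    simp
  · rw [mul_inv_rev, Submonoid.coe_mul]
    have : (((⟨_, hZ⟩ : U N)⁻¹ : U N) : Matrix (Fin N) (Fin N) ℂ) = star ζ • 1 := by
      simp
    rw [this]
    simp

/-- Translate by the scalar unitary ζ with ζ^(j−k) = −1: the integrand changes sign while the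
integral does not change. -/
lemma integral_trace_pow_mul_eq_zero {N : ℕ} (A B : Matrix (Fin N) (Fin N) ℂ) {j k : ℕ}
    (hjk : j ≠ k) : ∫ V : U N, (A * (V : Matrix (Fin N) (Fin N) ℂ)).trace ^ j
      * (B * ((V⁻¹ : U N) : Matrix (Fin N) (Fin N) ℂ)).trace ^ k ∂(haarU N) = 0 := by
  have hne : (j : ℝ) - k ≠ 0 := sub_ne_zero.2 (by exact_mod_cast hjk)
  set θ : ℝ := Real.pi / (j - k) with hθ
  set ζ := Complex.exp (θ * Complex.I) with hζ
  have h1 : ζ * star ζ = 1 := by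
    rw [Complex.star_def, Complex.mul_conj, Complex.normSq_eq_norm_sq, hζ,
      Complex.norm_exp_ofReal_mul_I]
    simp
  have h2 : ζ ^ j = - ζ ^ k := by
    rw [hζ, ← Complex.exp_nat_mul, ← Complex.exp_nat_mul]
    have : (j : ℂ) * (θ * Complex.I) = k * (θ * Complex.I) + Real.pi * Complex.I := by
      have h3 : ((j : ℝ) - k) * θ = Real.pi := by rw [hθ]; field_simp
      rw [← h3]; push_cast; ring
    rw [this, Complex.exp_add, Complex.exp_pi_mul_I]; ring
  obtain ⟨Z, hZ1, hZ2⟩ := trace_unit_mul (N := N) h1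
  have h3 := integral_mul_left_eq_self (μ := haarU N) (fun V : U N =>
    (A * (V : Matrix (Fin N) (Fin N) ℂ)).trace ^ j
      * (B * ((V⁻¹ : U N) : Matrix (Fin N) (Fin N) ℂ)).trace ^ k) Z
  have h4 : ∀ V : U N, (A * ((Z * V : U N) : Matrix (Fin N) (Fin N) ℂ)).trace ^ j
      * (B * (((Z * V)⁻¹ : U N) : Matrix (Fin N) (Fin N) ℂ)).trace ^ k
      = - ((A * (V : Matrix (Fin N) (Fin N) ℂ)).trace ^ j
      * (B * ((V⁻¹ : U N) : Matrix (Fin N) (Fin N) ℂ)).trace ^ k) := by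
    intro V
    rw [hZ1, hZ2, mul_pow, mul_pow, h2]
    have h5 : ζ ^ k * star ζ ^ k = 1 := by rw [← mul_pow, h1, one_pow]
    linear_combination (-(A * (V : Matrix (Fin N) (Fin N) ℂ)).trace ^ j
      * (B * ((V⁻¹ : U N) : Matrix (Fin N) (Fin N) ℂ)).trace ^ k) * h5
  simp only [h4, integral_neg] at h3
  exact self_eq_neg.1 h3.symm

lemma integral_trace_add_pow {N : ℕ} (A B : Matrix (Fin N) (Fin N) ℂ) (n : ℕ) :
    ∫ V : U N, (A * (V : Matrix (Fin N) (Fin N) ℂ)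
      + B * ((V⁻¹ : U N) : Matrix (Fin N) (Fin N) ℂ)).trace ^ n ∂(haarU N)
    = ∑ k ∈ Finset.range (n + 1), (n.choose k : ℂ) *
      ∫ V : U N, (A * (V : Matrix (Fin N) (Fin N) ℂ)).trace ^ k
      * (B * ((V⁻¹ : U N) : Matrix (Fin N) (Fin N) ℂ)).trace ^ (n - k) ∂(haarU N) := by
  have hA : Continuous fun V : U N => (A * (V : Matrix (Fin N) (Fin N) ℂ)).trace :=
    (continuous_const.matrix_mul (continuous_coe_unitary N)).matrix_trace
  have hB : Continuous fun V : U N =>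
      (B * ((V⁻¹ : U N) : Matrix (Fin N) (Fin N) ℂ)).trace :=
    (continuous_const.matrix_mul (continuous_coe_inv_unitary N)).matrix_trace
  simp only [Matrix.trace_add, add_pow]
  rw [integral_finsetSum]
  · simp only [integral_mul_const]
    exact Finset.sum_congr rfl fun k _ => mul_comm _ _
  · exact fun k _ => (integrable_haarU ((hA.pow k).mul (hB.pow (n - k)))).mul_const _

/-- Only moments with equally many V and V⁻¹ survive, so the expansion in √z is even and no branch
of the root matters. The factorials combine as (2n choose n)/(2n)! = 1/(n!)². -/
lemma couplingCoeff_BGW (N : ℕ) (A B : Matrix (Fin N) (Fin N) ℂ) (d : ℕ) :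
    couplingCoeff (BGW N A B) d = (N : ℂ) ^ (2 * d) / d.factorial *
      ∫ V : U N, (A * (V : Matrix (Fin N) (Fin N) ℂ)).trace ^ d
      * (B * ((V⁻¹ : U N) : Matrix (Fin N) (Fin N) ℂ)).trace ^ d ∂(haarU N) := by
  have hc : Continuous fun V : U N => (A * (V : Matrix (Fin N) (Fin N) ℂ)
      + B * ((V⁻¹ : U N) : Matrix (Fin N) (Fin N) ℂ)).trace :=
    ((continuous_const.matrix_mul (continuous_coe_unitary N)).add
      (continuous_const.matrix_mul (continuous_coe_inv_unitary N))).matrix_trace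
  set M : ℕ → ℂ := fun n => ∫ V : U N, (A * (V : Matrix (Fin N) (Fin N) ℂ)
      + B * ((V⁻¹ : U N) : Matrix (Fin N) (Fin N) ℂ)).trace ^ n ∂(haarU N) with hM
  have hodd : ∀ n, ¬ Even n → M n = 0 := by
    intro n hn
    simp only [hM, integral_trace_add_pow]
    refine Finset.sum_eq_zero fun k hk => ?_
    rw [integral_trace_pow_mul_eq_zero, mul_zero]
    intro h
    rw [Finset.mem_range] at hk
    exact hn ⟨k, by omega⟩
  have heven : ∀ n, M (2 * n) = ((2 * n).choose n : ℂ) *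
      ∫ V : U N, (A * (V : Matrix (Fin N) (Fin N) ℂ)).trace ^ n
      * (B * ((V⁻¹ : U N) : Matrix (Fin N) (Fin N) ℂ)).trace ^ n ∂(haarU N) := by
    intro n
    simp only [hM, integral_trace_add_pow]
    rw [Finset.sum_eq_single n]
    · rw [two_mul, Nat.add_sub_cancel]
    · intro k hk hkn
      rw [integral_trace_pow_mul_eq_zero, mul_zero]
      rw [Finset.mem_range] at hk
      omega
    · intro h
      exact absurd (Finset.mem_range.2 (by omega)) h
  rw [couplingCoeff_eq one_pos (c := fun n => (N : ℂ) ^ (2 * n) / (2 * n).factorial * M (2 * n))]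
  · rw [heven, Nat.cast_choose ℂ (by omega : d ≤ 2 * d), show 2 * d - d = d by omega]
    have h1 := Nat.cast_ne_zero (R := ℂ).2 d.factorial_ne_zero
    have h2 := Nat.cast_ne_zero (R := ℂ).2 (2 * d).factorial_ne_zero
    field_simp
  · intro z _
    have h := hasSum_integral_exp hc (z ^ (1 / 2 : ℂ) * N)
    have hinj : Function.Injective fun n : ℕ => 2 * n := fun a b h => by simpa using h
    rw [← hinj.hasSum_iff] at h
    · refine h.congr_fun fun n => ?_
      have hz : (z ^ (1 / 2 : ℂ)) ^ (2 * n) = z ^ n := by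
        rw [pow_mul]
        congr 1
        have := Complex.cpow_nat_inv_pow z (n := 2) two_ne_zero
        rw [one_div]
        exact_mod_cast this
      simp only [Function.comp_apply]
      rw [mul_pow, hz]; ring
    · intro n hn
      have : M n = 0 := hodd n fun ⟨k, hk⟩ => hn ⟨k, by simp only; omega⟩
      simp only [hM] at this
      rw [this, mul_zero]

/-! ### Sums over permutations of functions of the cycle type -/

lemma sum_sum_typ {d : ℕ} {M : Type*} [AddCommMonoid M]
    (f : d.Partition → Equiv.Perm (Fin d) → M) :
    ∑ α, ∑ σ with typ σ = α, f α σ = ∑ σ, f (typ σ) σ := by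
  rw [← Finset.sum_fiberwise (s := Finset.univ) (g := typ)]
  refine Finset.sum_congr rfl fun α _ => Finset.sum_congr rfl fun σ hσ => ?_
  rw [(Finset.mem_filter.1 hσ).2]

lemma trace_tens_mul_permMat_of_isSpectrum {d N : ℕ} [NeZero N] {A : Matrix (Fin N) (Fin N) ℂ}
    {a : Fin N → ℂ} (h : IsSpectrum A a) (σ : Equiv.Perm (Fin d)) :
    (tens d A * permMat N σ).trace
      = MvPolynomial.eval a (MvPolynomial.psumPart (Fin N) ℂ (typ σ)) := by
  rw [trace_tens_mul_permMat, ← prod_trace_pow h]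
  rfl

/-! ### Homogeneity and norms -/

lemma psumPart_isHomogeneous {d N : ℕ} (α : d.Partition) :
    (MvPolynomial.psumPart (Fin N) ℂ α).IsHomogeneous d := by
  have : ∀ s : Multiset ℕ, ((s.map (MvPolynomial.psum (Fin N) ℂ)).prod).IsHomogeneous s.sum := by
    intro s
    induction s using Multiset.induction_on with
    | empty => simpa using MvPolynomial.isHomogeneous_one (Fin N) ℂ
    | cons k s ih =>
      rw [Multiset.map_cons, Multiset.prod_cons, Multiset.sum_cons]
      refine MvPolynomial.IsHomogeneous.mul ?_ ih
      exact MvPolynomial.IsHomogeneous.sum _ _ _ fun i _ => MvPolynomial.isHomogeneous_X_pow i k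
  have h := this α.parts
  rwa [α.parts_sum] at h

/-- The bound N^ℓ(α) cancels the normalisation in the genus coefficients, so their polydisc norms
are bounded by plain sums of Hurwitz numbers. -/
lemma norm_eval_psumPart_le {d N : ℕ} (α : d.Partition) {x : Fin N → ℂ} (hx : ∀ i, ‖x i‖ ≤ 1) :
    ‖MvPolynomial.eval x (MvPolynomial.psumPart (Fin N) ℂ α)‖ ≤ (N : ℝ) ^ len α := by
  rw [MvPolynomial.psumPart, map_multiset_prod, Multiset.map_map, len]
  induction α.parts using Multiset.induction_on with
  | empty => simp
  | cons k s ih =>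
    rw [Multiset.map_cons, Multiset.prod_cons, Multiset.card_cons, pow_succ', norm_mul]
    refine mul_le_mul ?_ ih (norm_nonneg _) (by positivity)
    simp only [Function.comp_apply, MvPolynomial.psum, map_sum, map_pow, MvPolynomial.eval_X]
    refine (norm_sum_le _ _).trans ?_
    refine (Finset.sum_le_sum (g := fun _ => (1 : ℝ)) fun i _ => ?_).trans (by simp)
    rw [norm_pow]
    exact pow_le_one₀ (norm_nonneg _) (hx i)

lemma polydiscNorm_nonneg {σ : Type} (p : MvPolynomial σ ℂ) : 0 ≤ polydiscNorm p :=
  Real.iSup_nonneg fun _ => norm_nonneg _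

lemma polydiscNorm_le {σ : Type} {p : MvPolynomial σ ℂ} {C : ℝ}
    (h : ∀ x : σ → ℂ, (∀ i, ‖x i‖ ≤ 1) → ‖MvPolynomial.eval x p‖ ≤ C) : polydiscNorm p ≤ C := by
  have : Nonempty {x : σ → ℂ // ∀ i, ‖x i‖ ≤ 1} := ⟨⟨0, by simp⟩⟩
  exact ciSup_le fun x => h x.1 x.2

/-! ### The expansions of the Brézin-Gross-Witten and Harish-Chandra/Itzykson-Zuber integrals -/

variable {N d : ℕ}

lemma eval_topCoeff1 (g : ℤ) (a : Fin N → ℂ) :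
    MvPolynomial.eval a (topCoeff1 N d g) = ∑ α : d.Partition,
      (1 / (N : ℂ) ^ len α) * (-1) ^ (len α + d) * (singleHurwitz g α : ℂ)
        * MvPolynomial.eval a (MvPolynomial.psumPart (Fin N) ℂ α) := by
  simp [topCoeff1]

lemma eval_topCoeff2 (g : ℤ) (a b : Fin N → ℂ) :
    MvPolynomial.eval (Sum.elim a b) (topCoeff2 N d g) = ∑ α : d.Partition, ∑ β : d.Partition,
      (1 / (N : ℂ) ^ len α) * (1 / (N : ℂ) ^ len β) * (-1) ^ (len α + len β)
        * (doubleHurwitz g α β : ℂ)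
        * MvPolynomial.eval a (MvPolynomial.psumPart (Fin N) ℂ α)
        * MvPolynomial.eval b (MvPolynomial.psumPart (Fin N) ℂ β) := by
  simp [topCoeff2, MvPolynomial.eval_rename]

lemma topCoeff1_isHomogeneous (g : ℤ) : (topCoeff1 N d g).IsHomogeneous d := by
  refine MvPolynomial.IsHomogeneous.sum _ _ _ fun α _ => ?_
  have := (MvPolynomial.isHomogeneous_C (Fin N)
    ((1 / (N : ℂ) ^ len α) * (-1) ^ (len α + d) * (singleHurwitz g α : ℂ))).mul
    (psumPart_isHomogeneous (N := N) α)
  rwa [zero_add] at this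

/-- Allows the degree in one block of variables to be read off by giving that block weight 1 and the
other weight 0. -/
lemma rename_isWeightedHomogeneous {σ τ : Type*} {e : σ → τ}
    {p : MvPolynomial σ ℂ} {n k : ℕ} (hp : p.IsHomogeneous n) {w : τ → ℕ}
    (hw : ∀ i, w (e i) = k) : (MvPolynomial.rename e p).IsWeightedHomogeneous w (k * n) := by
  intro m hm
  obtain ⟨u, rfl, hu⟩ := MvPolynomial.coeff_rename_ne_zero _ _ _ hm
  have h1 := hp hu
  rw [Finsupp.weight_apply, Finsupp.sum_mapDomain_index (by simp) (by simp [add_mul])]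
  rw [Finsupp.weight_apply] at h1
  rw [← h1, Finsupp.mul_sum]
  refine Finsupp.sum_congr fun i _ => ?_
  simp [hw, mul_comm]

lemma topCoeff2_isWeightedHomogeneous (g : ℤ) {k l : ℕ} :
    (topCoeff2 N d g).IsWeightedHomogeneous
      (Sum.elim (fun _ => k) (fun _ => l) : Fin N ⊕ Fin N → ℕ) (k * d + l * d) := by
  refine MvPolynomial.IsWeightedHomogeneous.sum _ _ _ fun α _ =>
    MvPolynomial.IsWeightedHomogeneous.sum _ _ _ fun β _ => ?_
  have h1 := rename_isWeightedHomogeneous (e := Sum.inl) (k := k)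
    (psumPart_isHomogeneous (N := N) α)
    (w := (Sum.elim (fun _ => k) (fun _ => l) : Fin N ⊕ Fin N → ℕ)) (by simp)
  have h2 := rename_isWeightedHomogeneous (e := Sum.inr) (k := l)
    (psumPart_isHomogeneous (N := N) β)
    (w := (Sum.elim (fun _ => k) (fun _ => l) : Fin N ⊕ Fin N → ℕ)) (by simp)
  have h3 := (MvPolynomial.isWeightedHomogeneous_C
    (Sum.elim (fun _ => k) (fun _ => l) : Fin N ⊕ Fin N → ℕ)
    ((1 / (N : ℂ) ^ len α) * (1 / (N : ℂ) ^ len β) * (-1) ^ (len α + len β)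
      * (doubleHurwitz g α β : ℂ)))
  have := (h3.mul h1).mul h2
  rwa [zero_add] at this

/-! ### Absolute convergence in the polydisc norm -/

lemma summable_doubleHurwitz (hd : 1 ≤ d) (hdN : d ≤ N) (α β : d.Partition) :
    Summable fun g : Genus d => (N : ℝ) ^ (2 - 2 * g.1) * (doubleHurwitz g.1 α β : ℝ) := by
  refine (hasSum_doubleHurwitz hd hdN α β).summable.norm.congr fun g => ?_
  rw [norm_mul, norm_zpow, Complex.norm_natCast, Complex.norm_natCast]

lemma summable_polydiscNorm_topCoeff1 (hd : 1 ≤ d) (hdN : d ≤ N) :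
    Summable fun g : Genus d => (N : ℝ) ^ (2 - 2 * g.1) * polydiscNorm (topCoeff1 N d g.1) := by
  have hN : (N : ℝ) ≠ 0 := Nat.cast_ne_zero.2 (by omega)
  refine (summable_sum fun α (_ : α ∈ Finset.univ) =>
    summable_doubleHurwitz hd hdN α (ones d)).of_nonneg_of_le
    (fun g => mul_nonneg (by positivity) (polydiscNorm_nonneg _)) fun g => ?_
  rw [← Finset.mul_sum]
  refine mul_le_mul_of_nonneg_left (polydiscNorm_le fun x hx => ?_) (by positivity)
  rw [eval_topCoeff1]
  refine (norm_sum_le _ _).trans (Finset.sum_le_sum fun α _ => ?_)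
  simp only [norm_mul, norm_div, norm_pow, norm_neg, norm_one, one_pow, mul_one,
    Complex.norm_natCast, singleHurwitz]
  refine (mul_le_mul_of_nonneg_left (norm_eval_psumPart_le α hx) (by positivity)).trans_eq ?_
  field_simp

lemma summable_polydiscNorm_topCoeff2 (hd : 1 ≤ d) (hdN : d ≤ N) :
    Summable fun g : Genus d => (N : ℝ) ^ (2 - 2 * g.1) * polydiscNorm (topCoeff2 N d g.1) := by
  have hN : (N : ℝ) ≠ 0 := Nat.cast_ne_zero.2 (by omega)
  refine (summable_sum fun α (_ : α ∈ Finset.univ) => summable_sum fun β (_ : β ∈ Finset.univ) =>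
    summable_doubleHurwitz hd hdN α β).of_nonneg_of_le
    (fun g => mul_nonneg (by positivity) (polydiscNorm_nonneg _)) fun g => ?_
  simp only [← Finset.mul_sum]
  refine mul_le_mul_of_nonneg_left (polydiscNorm_le fun x hx => ?_) (by positivity)
  rw [← Sum.elim_comp_inl_inr x, eval_topCoeff2]
  refine (norm_sum_le _ _).trans (Finset.sum_le_sum fun α _ => ?_)
  refine (norm_sum_le _ _).trans (Finset.sum_le_sum fun β _ => ?_)
  simp only [norm_mul, norm_div, norm_pow, norm_neg, norm_one, one_pow, mul_one,
    Complex.norm_natCast]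
  refine (mul_le_mul (mul_le_mul_of_nonneg_left
    (norm_eval_psumPart_le α fun i => hx (Sum.inl i)) (by positivity))
    (norm_eval_psumPart_le β fun i => hx (Sum.inr i)) (norm_nonneg _) (by positivity)).trans_eq ?_
  field_simp

lemma hasSum_topCoeff1 (hd : 1 ≤ d) (hdN : d ≤ N) (A B : Matrix (Fin N) (Fin N) ℂ) (a : Fin N → ℂ)
    (h : IsSpectrum (A * B) a) :
    HasSum (fun g : Genus d => (N : ℂ) ^ (2 - 2 * g.1) * MvPolynomial.eval a (topCoeff1 N d g.1))
      (couplingCoeff (BGW N A B) d) := by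
  have hN0 : (N : ℂ) ≠ 0 := Nat.cast_ne_zero.2 (by omega)
  have : NeZero N := ⟨by omega⟩
  have hs := hasSum_sum fun α (_ : α ∈ (Finset.univ : Finset d.Partition)) =>
    (hasSum_doubleHurwitz hd hdN α (ones d)).mul_left ((1 / (N : ℂ) ^ len α) * (-1) ^ (len α + d)
      * MvPolynomial.eval a (MvPolynomial.psumPart (Fin N) ℂ α))
  have hones : len (ones d) = d := by simp [len, ones]
  have hsum : couplingCoeff (BGW N A B) d = ∑ α : d.Partition, (1 / (N : ℂ) ^ len α)
      * (-1) ^ (len α + d) * MvPolynomial.eval a (MvPolynomial.psumPart (Fin N) ℂ α) *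
      ((-(N : ℂ)) ^ (len α + len (ones d)) * ∑ σ with typ σ = α, ∑ τ with typ τ = ones d,
        monoGen (transp d) (-(N : ℂ)⁻¹) d (σ⁻¹ * τ)) := by
    rw [couplingCoeff_BGW, integral_trace_pow_mul_trace_pow hdN
      (sum_monoGen_mul_normTrace hd hdN)]
    simp only [trace_tens_mul_permMat_of_isSpectrum h]
    have h1 : (N : ℂ) ^ (2 * d) / d.factorial * (((N : ℂ) ^ d)⁻¹ * (d.factorial *
        ∑ σ, monoGen (transp d) (-(N : ℂ)⁻¹) d σ⁻¹ *
          MvPolynomial.eval a (MvPolynomial.psumPart (Fin N) ℂ (typ σ))))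
        = ∑ σ : Equiv.Perm (Fin d), (N : ℂ) ^ d * (monoGen (transp d) (-(N : ℂ)⁻¹) d σ⁻¹ *
          MvPolynomial.eval a (MvPolynomial.psumPart (Fin N) ℂ (typ σ))) := by
      rw [← Finset.mul_sum, two_mul, pow_add]
      have h2 := Nat.cast_ne_zero (R := ℂ).2 d.factorial_ne_zero
      field_simp
    rw [h1, ← sum_sum_typ (fun α σ => (N : ℂ) ^ d * (monoGen (transp d) (-(N : ℂ)⁻¹) d σ⁻¹ *
          MvPolynomial.eval a (MvPolynomial.psumPart (Fin N) ℂ α)))]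
    refine Finset.sum_congr rfl fun α _ => ?_
    rw [Finset.mul_sum, Finset.mul_sum]
    refine Finset.sum_congr rfl fun σ _ => ?_
    have h3 : (Finset.univ.filter fun τ : Equiv.Perm (Fin d) => typ τ = ones d) = {1} := by
      ext τ; simp [typ_eq_ones_iff]
    rw [h3, Finset.sum_singleton, mul_one, hones, neg_pow]
    -- The sign in the genus coefficient cancels the sign of (−N)^(ℓ(α)+d), and the division by
    -- N^ℓ(α) leaves N^d, as in the integral.
    have h4 : (-1 : ℂ) ^ (len α + d) * (-1) ^ (len α + d) = 1 := by
      rw [← mul_pow]; simp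
    have h5 : 1 / (N : ℂ) ^ len α * (N : ℂ) ^ (len α + d) = (N : ℂ) ^ d := by
      rw [pow_add]; field_simp
    rw [← h5]
    linear_combination (-(1 / (N : ℂ) ^ len α * (N : ℂ) ^ (len α + d) *
      (monoGen (transp d) (-(N : ℂ)⁻¹) d σ⁻¹ *
        MvPolynomial.eval a (MvPolynomial.psumPart (Fin N) ℂ α)))) * h4
  rw [hsum]
  refine hs.congr_fun fun g => ?_
  rw [eval_topCoeff1, Finset.mul_sum]
  refine Finset.sum_congr rfl fun α _ => ?_
  rw [singleHurwitz]
  ring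

lemma hasSum_topCoeff2 (hd : 1 ≤ d) (hdN : d ≤ N) (A B : Matrix (Fin N) (Fin N) ℂ)
    (a b : Fin N → ℂ) (ha : IsSpectrum A a) (hb : IsSpectrum B b) :
    HasSum (fun g : Genus d => (N : ℂ) ^ (2 - 2 * g.1) *
        MvPolynomial.eval (Sum.elim a b) (topCoeff2 N d g.1))
      (couplingCoeff (HCIZ N A B) d) := by
  have hN0 : (N : ℂ) ≠ 0 := Nat.cast_ne_zero.2 (by omega)
  have : NeZero N := ⟨by omega⟩
  have hs := hasSum_sum fun α (_ : α ∈ (Finset.univ : Finset d.Partition)) =>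
    hasSum_sum fun β (_ : β ∈ (Finset.univ : Finset d.Partition)) =>
    (hasSum_doubleHurwitz hd hdN α β).mul_left ((1 / (N : ℂ) ^ len α) * (1 / (N : ℂ) ^ len β)
      * (-1) ^ (len α + len β) * MvPolynomial.eval a (MvPolynomial.psumPart (Fin N) ℂ α)
      * MvPolynomial.eval b (MvPolynomial.psumPart (Fin N) ℂ β))
  have hsum : couplingCoeff (HCIZ N A B) d = ∑ α : d.Partition, ∑ β : d.Partition,
      (1 / (N : ℂ) ^ len α) * (1 / (N : ℂ) ^ len β)
      * (-1) ^ (len α + len β) * MvPolynomial.eval a (MvPolynomial.psumPart (Fin N) ℂ α)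
      * MvPolynomial.eval b (MvPolynomial.psumPart (Fin N) ℂ β) *
      ((-(N : ℂ)) ^ (len α + len β) * ∑ σ with typ σ = α, ∑ τ with typ τ = β,
        monoGen (transp d) (-(N : ℂ)⁻¹) d (σ⁻¹ * τ)) := by
    rw [couplingCoeff_HCIZ, integral_trace_conj_pow hdN (sum_monoGen_mul_normTrace hd hdN)]
    simp only [trace_tens_mul_permMat_of_isSpectrum ha, trace_tens_mul_permMat_of_isSpectrum hb]
    rw [mul_inv_cancel_left₀ (pow_ne_zero d hN0),
      ← sum_sum_typ (fun α σ => ∑ τ, monoGen (transp d) (-(N : ℂ)⁻¹) d (σ⁻¹ * τ) *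
          MvPolynomial.eval a (MvPolynomial.psumPart (Fin N) ℂ α) *
          MvPolynomial.eval b (MvPolynomial.psumPart (Fin N) ℂ (typ τ)))]
    refine Finset.sum_congr rfl fun α _ => ?_
    have h1 : ∀ σ : Equiv.Perm (Fin d), ∑ τ, monoGen (transp d) (-(N : ℂ)⁻¹) d (σ⁻¹ * τ) *
          MvPolynomial.eval a (MvPolynomial.psumPart (Fin N) ℂ α) *
          MvPolynomial.eval b (MvPolynomial.psumPart (Fin N) ℂ (typ τ))
        = ∑ β, ∑ τ with typ τ = β, monoGen (transp d) (-(N : ℂ)⁻¹) d (σ⁻¹ * τ) *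
          MvPolynomial.eval a (MvPolynomial.psumPart (Fin N) ℂ α) *
          MvPolynomial.eval b (MvPolynomial.psumPart (Fin N) ℂ β) := fun σ =>
      (sum_sum_typ (fun β τ => monoGen (transp d) (-(N : ℂ)⁻¹) d (σ⁻¹ * τ) *
          MvPolynomial.eval a (MvPolynomial.psumPart (Fin N) ℂ α) *
          MvPolynomial.eval b (MvPolynomial.psumPart (Fin N) ℂ β))).symm
    simp only [h1]
    rw [Finset.sum_comm]
    refine Finset.sum_congr rfl fun β _ => ?_
    simp only [Finset.mul_sum]
    refine Finset.sum_congr rfl fun σ _ => Finset.sum_congr rfl fun τ _ => ?_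
    rw [neg_pow]
    have h4 : (-1 : ℂ) ^ (len α + len β) * (-1) ^ (len α + len β) = 1 := by
      rw [← mul_pow]; simp
    have h5 : 1 / (N : ℂ) ^ len α * (1 / (N : ℂ) ^ len β) * (N : ℂ) ^ (len α + len β) = 1 := by
      rw [pow_add]; field_simp
    generalize monoGen (transp d) (-(N : ℂ)⁻¹) d (σ⁻¹ * τ) = m
    generalize MvPolynomial.eval a (MvPolynomial.psumPart (Fin N) ℂ α) = p
    generalize MvPolynomial.eval b (MvPolynomial.psumPart (Fin N) ℂ β) = q
    linear_combination (-(m * p * q)) * h5 - (1 / (N : ℂ) ^ len α * (1 / (N : ℂ) ^ len β) *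
      (N : ℂ) ^ (len α + len β) * m * p * q) * h4
  rw [hsum]
  refine hs.congr_fun fun g => ?_
  rw [eval_topCoeff2, Finset.mul_sum]
  refine Finset.sum_congr rfl fun α _ => ?_
  rw [Finset.mul_sum]
  refine Finset.sum_congr rfl fun β _ => ?_
  ring

/-! ### Jucys-Murphy elements and conditional expectations in the group algebra -/

/-- The group algebra of the permutations of `ℕ`. -/
abbrev PermAlg : Type := MonoidAlgebra ℂ (Equiv.Perm ℕ)

/-- The permutations fixing all `k ≥ n`, a copy of the symmetric group `S(n)`. -/
def fixGE (n : ℕ) : Subgroup (Equiv.Perm ℕ) where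
  carrier := {π | ∀ k, n ≤ k → π k = k}
  mul_mem' {a b} ha hb k hk := by rw [Equiv.Perm.mul_apply, hb k hk, ha k hk]
  one_mem' _ _ := rfl
  inv_mem' {a} ha k hk := by rw [Equiv.Perm.inv_eq_iff_eq]; exact (ha k hk).symm

lemma fixGE_mono {m n : ℕ} (h : m ≤ n) : fixGE m ≤ fixGE n := fun _ hπ k hk => hπ k (h.trans hk)

lemma apply_lt_of_mem_fixGE {n : ℕ} {π : Equiv.Perm ℕ} (h : π ∈ fixGE n) {k : ℕ} (hk : k < n) :
    π k < n := by
  by_contra hlt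
  have h1 := h (π k) (not_lt.1 hlt)
  rw [π.injective h1] at hlt
  exact hlt hk

open Classical in
/-- The projection of the group algebra onto the group algebra of `S(n)`. -/
def condExp (n : ℕ) : PermAlg →+ PermAlg where
  toFun x := MonoidAlgebra.ofCoeff (x.coeff.filter (· ∈ fixGE n))
  map_zero' := by rw [MonoidAlgebra.coeff_zero, Finsupp.filter_zero]; rfl
  map_add' x y := by rw [MonoidAlgebra.coeff_add, Finsupp.filter_add, MonoidAlgebra.ofCoeff_add]

open Classical in
lemma condExp_single (n : ℕ) (g : Equiv.Perm ℕ) (c : ℂ) :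
    condExp n (.single g c) = if g ∈ fixGE n then .single g c else 0 := by
  split_ifs with h
  · change MonoidAlgebra.ofCoeff _ = _
    rw [MonoidAlgebra.coeff_single, Finsupp.filter_single_of_pos _ h]
    rfl
  · change MonoidAlgebra.ofCoeff _ = _
    rw [MonoidAlgebra.coeff_single, Finsupp.filter_single_of_neg _ h]
    rfl

lemma condExp_single_of_mem {n : ℕ} {g : Equiv.Perm ℕ} (h : g ∈ fixGE n) (c : ℂ) :
    condExp n (.single g c) = .single g c := by rw [condExp_single, if_pos h]

lemma condExp_single_of_notMem {n : ℕ} {g : Equiv.Perm ℕ} (h : g ∉ fixGE n) (c : ℂ) :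
    condExp n (.single g c) = 0 := by rw [condExp_single, if_neg h]

lemma condExp_one (n : ℕ) : condExp n 1 = 1 := condExp_single_of_mem (one_mem _) 1

lemma condExp_algebraMap (n : ℕ) (c : ℂ) :
    condExp n (algebraMap ℂ PermAlg c) = algebraMap ℂ PermAlg c :=
  condExp_single_of_mem (one_mem _) c

lemma condExp_condExp {m n : ℕ} (h : m ≤ n) (x : PermAlg) :
    condExp n (condExp m x) = condExp m x := by
  induction x using MonoidAlgebra.induction_linear with
  | zero => simp
  | add x y hx hy => simp only [map_add, hx, hy]
  | single g c =>
    by_cases hg : g ∈ fixGE m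
    · rw [condExp_single_of_mem hg, condExp_single_of_mem (fixGE_mono h hg)]
    · rw [condExp_single_of_notMem hg, map_zero]

lemma condExp_mul_left (n : ℕ) (x y : PermAlg) :
    condExp n (condExp n x * y) = condExp n x * condExp n y := by
  induction x using MonoidAlgebra.induction_linear with
  | zero => simp
  | add x x' hx hx' => simp only [map_add, add_mul, hx, hx']
  | single g c =>
    by_cases hg : g ∈ fixGE n
    · rw [condExp_single_of_mem hg]
      induction y using MonoidAlgebra.induction_linear with
      | zero => simp
      | add y y' hy hy' => simp only [map_add, mul_add, hy, hy']
      | single h e =>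
        rw [MonoidAlgebra.single_mul_single]
        by_cases hh : h ∈ fixGE n
        · rw [condExp_single_of_mem hh, condExp_single_of_mem (mul_mem hg hh),
            MonoidAlgebra.single_mul_single]
        · rw [condExp_single_of_notMem hh, condExp_single_of_notMem, mul_zero]
          rwa [Subgroup.mul_mem_cancel_left _ hg]
    · simp [condExp_single_of_notMem hg]

lemma condExp_mul_right (n : ℕ) (x y : PermAlg) :
    condExp n (x * condExp n y) = condExp n x * condExp n y := by
  induction y using MonoidAlgebra.induction_linear with
  | zero => simp
  | add x x' hx hx' => simp only [map_add, mul_add, hx, hx']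
  | single g c =>
    by_cases hg : g ∈ fixGE n
    · rw [condExp_single_of_mem hg]
      induction x using MonoidAlgebra.induction_linear with
      | zero => simp
      | add y y' hy hy' => simp only [map_add, add_mul, hy, hy']
      | single h e =>
        rw [MonoidAlgebra.single_mul_single]
        by_cases hh : h ∈ fixGE n
        · rw [condExp_single_of_mem hh, condExp_single_of_mem (mul_mem hh hg),
            MonoidAlgebra.single_mul_single]
        · rw [condExp_single_of_notMem hh, condExp_single_of_notMem, zero_mul]
          rwa [Subgroup.mul_mem_cancel_right _ hg]
    · simp [condExp_single_of_notMem hg]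

lemma condExp_mul_of_left {n : ℕ} {y : PermAlg} (hy : condExp n y = y) (x : PermAlg) :
    condExp n (y * x) = y * condExp n x := by rw [← hy, condExp_mul_left]

lemma condExp_mul_of_right {n : ℕ} {y : PermAlg} (hy : condExp n y = y) (x : PermAlg) :
    condExp n (x * y) = condExp n x * y := by rw [← hy, condExp_mul_right]

open Classical in
lemma coeff_one_condExp (n : ℕ) (x : PermAlg) : (condExp n x).coeff 1 = x.coeff 1 :=
  Finsupp.filter_apply_pos _ _ (one_mem (fixGE n))

lemma condExp_mul_eq {n : ℕ} {x y : PermAlg} (hx : condExp n x = x) (hy : condExp n y = y) :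
    condExp n (x * y) = x * y := by
  rw [← hx, condExp_mul_left, hx, hy]

lemma condExp_pow_eq {n : ℕ} {x : PermAlg} (hx : condExp n x = x) (k : ℕ) :
    condExp n (x ^ k) = x ^ k := by
  induction k with
  | zero => simpa using condExp_one n
  | succ k ih => rw [pow_succ]; exact condExp_mul_eq ih hx

lemma condExp_eq_of_le {m n : ℕ} (h : m ≤ n) {x : PermAlg} (hx : condExp m x = x) :
    condExp n x = x := by
  rw [← hx, condExp_condExp h]

/-- The Jucys-Murphy element `∑_{s < n} (s n)`. -/
def jucys (n : ℕ) : PermAlg := ∑ s ∈ Finset.range n, .single (Equiv.swap s n) 1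

lemma jucys_zero : jucys 0 = 0 := rfl

lemma swap_mem_fixGE {a b n : ℕ} (ha : a < n) (hb : b < n) : Equiv.swap a b ∈ fixGE n :=
  fun k hk => Equiv.swap_apply_of_ne_of_ne (by omega) (by omega)

lemma swap_notMem_fixGE {a b n : ℕ} (hab : a ≠ b) (hb : n ≤ b) : Equiv.swap a b ∉ fixGE n :=
  fun h => hab (by simpa using h b hb)

lemma condExp_jucys (n : ℕ) : condExp (n + 1) (jucys n) = jucys n := by
  rw [jucys, map_sum]
  refine Finset.sum_congr rfl fun s hs => condExp_single_of_mem (swap_mem_fixGE ?_ (by omega)) 1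
  exact (Finset.mem_range.1 hs).trans (Nat.lt_succ_self n)

lemma condExp_self_jucys (n : ℕ) : condExp n (jucys n) = 0 := by
  rw [jucys, map_sum]
  exact Finset.sum_eq_zero fun s hs =>
    condExp_single_of_notMem (swap_notMem_fixGE (Finset.mem_range.1 hs).ne le_rfl) 1

/-- Conjugation by a permutation of the letters below n merely permutes the transpositions (s n). -/
lemma commute_jucys {n : ℕ} {x : PermAlg} (hx : condExp n x = x) : Commute x (jucys n) := by
  rw [← hx]
  clear hx
  induction x using MonoidAlgebra.induction_linear with
  | zero => simp
  | add x y hx hy => rw [map_add]; exact hx.add_left hy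
  | single g c =>
    by_cases hg : g ∈ fixGE n
    · rw [condExp_single_of_mem hg]
      rw [Commute, SemiconjBy, jucys, Finset.mul_sum, Finset.sum_mul]
      refine Finset.sum_bij (fun s _ => g s) (fun s hs => ?_) (fun s _ s' _ h => g.injective h)
        (fun s hs => ?_) (fun s hs => ?_)
      · exact Finset.mem_range.2 (apply_lt_of_mem_fixGE hg (Finset.mem_range.1 hs))
      · refine ⟨g⁻¹ s, Finset.mem_range.2
          (apply_lt_of_mem_fixGE (inv_mem hg) (Finset.mem_range.1 hs)), by simp⟩
      · rw [MonoidAlgebra.single_mul_single, MonoidAlgebra.single_mul_single, mul_comm c 1]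
        congr 1
        have := Equiv.mul_swap_eq_swap_mul g s n
        rw [this, hg n le_rfl]
    · simp [condExp_single_of_notMem hg]

/-! ### The moment recursion for consecutive Jucys-Murphy elements -/

/-- The adjacent transposition `(n n+1)`. -/
def adj (n : ℕ) : PermAlg := .single (Equiv.swap n (n + 1)) 1

lemma adj_mul_self (n : ℕ) : adj n * adj n = 1 := by
  rw [adj, MonoidAlgebra.single_mul_single, Equiv.swap_mul_self, one_mul]; rfl

lemma condExp_adj (n : ℕ) : condExp (n + 1) (adj n) = 0 :=
  condExp_single_of_notMem (swap_notMem_fixGE (by omega) le_rfl) 1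

lemma jucys_succ (n : ℕ) : jucys (n + 1) = adj n * jucys n * adj n + adj n := by
  rw [jucys, Finset.sum_range_succ, jucys, Finset.mul_sum, Finset.sum_mul]
  congr 1
  refine Finset.sum_congr rfl fun s hs => ?_
  rw [adj, MonoidAlgebra.single_mul_single, MonoidAlgebra.single_mul_single, one_mul, one_mul]
  congr 1
  have hs := Finset.mem_range.1 hs
  rw [Equiv.mul_swap_eq_swap_mul (Equiv.swap n (n + 1)) s n, mul_assoc, Equiv.swap_mul_self,
    mul_one, Equiv.swap_apply_of_ne_of_ne (by omega) (by omega), Equiv.swap_apply_left]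

/-- Let s = (n n+1) and let g fix every letter above n. If g also fixes n it commutes with s;
otherwise s g s moves n + 1 and the expectation kills it. -/
lemma condExp_adj_mul_mul_adj (n : ℕ) (x : PermAlg) (hx : condExp (n + 1) x = x) :
    condExp (n + 1) (adj n * x * adj n) = condExp n x := by
  rw [← hx]
  clear hx
  induction x using MonoidAlgebra.induction_linear with
  | zero => simp
  | add x y hx hy => simp only [map_add, mul_add, add_mul, hx, hy]
  | single g c =>
    by_cases hg : g ∈ fixGE (n + 1)
    · rw [condExp_single_of_mem hg, adj, MonoidAlgebra.single_mul_single,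
        MonoidAlgebra.single_mul_single, one_mul, mul_one]
      set s := Equiv.swap n (n + 1) with hs
      by_cases hn : g ∈ fixGE n
      · have h1 : s * g * s = g := by
          have h2 : g * s = s * g := by
            rw [hs, Equiv.mul_swap_eq_swap_mul, hn n le_rfl, hn (n + 1) (by omega)]
          rw [mul_assoc, h2, ← mul_assoc, Equiv.swap_mul_self, one_mul]
        rw [h1, condExp_single_of_mem hg, condExp_single_of_mem hn]
      · rw [condExp_single_of_notMem hn, condExp_single_of_notMem]
        intro h
        refine hn fun k hk => ?_
        rcases eq_or_lt_of_le hk with rfl | hk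
        · have h1 := h (n + 1) le_rfl
          simp only [Equiv.Perm.mul_apply, hs, Equiv.swap_apply_right] at h1
          rwa [Equiv.swap_apply_eq_iff, Equiv.swap_apply_right] at h1
        · exact hg k hk
    · simp [condExp_single_of_notMem hg]

lemma adj_mul_jucys_succ (n : ℕ) : adj n * jucys (n + 1) = jucys n * adj n + 1 := by
  rw [jucys_succ, mul_add, ← mul_assoc, ← mul_assoc, adj_mul_self, one_mul]

lemma jucys_succ_mul_adj (n : ℕ) : jucys (n + 1) * adj n = adj n * jucys n + 1 := by
  rw [jucys_succ, add_mul, mul_assoc, adj_mul_self, mul_one]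

lemma jucys_comm (n : ℕ) : jucys n * jucys (n + 1) = jucys (n + 1) * jucys n :=
  commute_jucys (condExp_jucys n)

/-- With a = J_n, b = J_{n+1} and s = (n n+1), the relation s b = a s + 1 rewrites ((b − a)² − 1)
b^k in terms of powers of a. The form is chosen for the conditional expectation: terms with a
conjugated power of a become moments, and terms with a single s vanish. -/
lemma jucys_succ_sub_sq_mul_pow (n k : ℕ) :
    (jucys (n + 1) ^ 2 - 2 * jucys n * jucys (n + 1) + jucys n ^ 2 - 1) * jucys (n + 1) ^ k
      = adj n * jucys n ^ (k + 2) * adj n - 2 * jucys n * (adj n * jucys n ^ (k + 1) * adj n)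
        + jucys n ^ 2 * (adj n * jucys n ^ k * adj n)
        + adj n * jucys n ^ (k + 1) - jucys n * adj n * jucys n ^ k := by
  have hss := adj_mul_self n
  have hab := jucys_comm n
  have hsb := adj_mul_jucys_succ n
  have hbs := jucys_succ_mul_adj n
  have hb := jucys_succ n
  generalize jucys (n + 1) = b at *
  generalize jucys n = a at *
  generalize adj n = s at *
  induction k with
  | zero =>
    simp only [pow_zero, mul_one, zero_add, pow_one]
    have h1 : b ^ 2 = s * a ^ 2 * s + s * a + a * s + 1 := by
      rw [pow_two]
      nth_rewrite 1 [hb]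
      rw [add_mul, hsb, mul_assoc (s * a), hsb]
      noncomm_ring
    have h2 : 2 * a * b = a * s * a * s + a * s + s * a * s * a + s * a := by
      have h3 : a * b = a * s * a * s + a * s := by rw [hb]; noncomm_ring
      have h4 : a * b = s * a * s * a + s * a := by rw [hab, hb]; noncomm_ring
      rw [mul_assoc, two_mul]
      nth_rewrite 1 [h3]
      rw [h4]
      noncomm_ring
    -- The two ways of expanding ab = ba.
    have h5 : a * s * a * s + a * s = s * a * s * a + s * a := by
      have h3 : a * b = a * s * a * s + a * s := by rw [hb]; noncomm_ring
      have h4 : a * b = s * a * s * a + s * a := by rw [hab, hb]; noncomm_ring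
      rw [← h3, h4]
    have h6 : s * a * s * a = a * s * a * s + a * s - s * a := by rw [h5]; noncomm_ring
    rw [h1, h2, h6, hss]
    noncomm_ring
  | succ k ih =>
    have hcomm : a ^ k * b = b * a ^ k := (Commute.pow_left hab k)
    have hcomm1 : a ^ (k + 1) * b = b * a ^ (k + 1) := (Commute.pow_left hab (k + 1))
    rw [pow_succ b k, ← mul_assoc, ih]
    have e1 : ∀ j, s * a ^ j * s * b = s * a ^ (j + 1) * s + s * a ^ j := by
      intro j
      rw [mul_assoc _ s, hsb, pow_succ]
      noncomm_ring
    have e2 : s * a ^ (k + 1) * b = a * s * a ^ (k + 1) + a ^ (k + 1) := by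
      rw [mul_assoc, hcomm1, ← mul_assoc, hsb]; noncomm_ring
    have e3 : a * s * a ^ k * b = a ^ 2 * s * a ^ k + a * a ^ k := by
      rw [mul_assoc, hcomm, ← mul_assoc, mul_assoc a, hsb]; noncomm_ring
    have e4 : (s * a ^ (k + 2) * s - 2 * a * (s * a ^ (k + 1) * s) + a ^ 2 * (s * a ^ k * s)
        + s * a ^ (k + 1) - a * s * a ^ k) * b
        = s * a ^ (k + 2) * s * b - 2 * a * (s * a ^ (k + 1) * s * b)
          + a ^ 2 * (s * a ^ k * s * b) + s * a ^ (k + 1) * b - a * s * a ^ k * b := by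
      noncomm_ring
    rw [e4, e1, e1, e1, e2, e3, ← pow_succ' a k]
    noncomm_ring

/-- The conditional expectations of the powers of the Jucys-Murphy elements. -/
def moment (n k : ℕ) : PermAlg := condExp n (jucys n ^ k)

lemma moment_zero (k : ℕ) : moment 0 k = if k = 0 then 1 else 0 := by
  rw [moment, jucys_zero]
  split_ifs with h
  · rw [h, pow_zero, condExp_one]
  · rw [zero_pow h, map_zero]

lemma moment_pow_zero (n : ℕ) : moment n 0 = 1 := by rw [moment, pow_zero, condExp_one]

lemma moment_pow_one (n : ℕ) : moment n 1 = 0 := by rw [moment, pow_one, condExp_self_jucys]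

/-- The conditional expectation of `jucys_succ_sub_sq_mul_pow`, solved for the highest moment. -/
lemma moment_succ (n k : ℕ) :
    moment (n + 1) (k + 2) = 2 * jucys n * moment (n + 1) (k + 1)
      - (jucys n ^ 2 - 1) * moment (n + 1) k
      + moment n (k + 2) - 2 * jucys n * moment n (k + 1) + jucys n ^ 2 * moment n k := by
  have h := congrArg (condExp (n + 1)) (jucys_succ_sub_sq_mul_pow n k)
  have hJ := condExp_jucys n
  have hJk := fun k => condExp_pow_eq hJ k
  have h2 : condExp (n + 1) (2 * jucys n) = 2 * jucys n := by
    rw [two_mul, map_add, hJ]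
  have hL : (jucys (n + 1) ^ 2 - 2 * jucys n * jucys (n + 1) + jucys n ^ 2 - 1)
      * jucys (n + 1) ^ k = jucys (n + 1) ^ (k + 2) - 2 * jucys n * jucys (n + 1) ^ (k + 1)
        + (jucys n ^ 2 - 1) * jucys (n + 1) ^ k := by
    rw [add_comm k 2, pow_add _ 2 k, pow_succ' _ k]
    noncomm_ring
  have h3 : condExp (n + 1) (jucys n ^ 2 - 1) = jucys n ^ 2 - 1 := by
    rw [map_sub, hJk, condExp_one]
  rw [hL] at h
  simp only [map_add, map_sub, condExp_mul_of_left h2, condExp_mul_of_left h3,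
    condExp_mul_of_left (hJk 2), condExp_mul_of_right (hJk _),
    condExp_adj_mul_mul_adj n _ (hJk _), condExp_mul_of_left hJ, condExp_adj, mul_zero, zero_mul, add_zero,
    sub_zero] at h
  simp only [moment]
  rw [← sub_eq_zero] at h ⊢
  rw [← h]
  noncomm_ring

/-! ### Vandermonde products and unit shifts of their arguments -/

/-- Both sides are ∑ C i j * adj(M) j i. Unit shifts of single arguments alter rows of a Vandermonde
matrix; read by columns, the alterations become simple. -/
lemma sum_det_updateRow {n : Type*} [Fintype n] [DecidableEq n] {R : Type*} [CommRing R]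
    (M C : Matrix n n R) :
    ∑ i, (M.updateRow i (C i)).det = ∑ j, (M.updateCol j fun i => C i j).det := by
  have h1 : ∀ i, (M.updateRow i (C i)).det = ∑ j, C i j * M.adjugate j i := fun i => by
    rw [Matrix.det_eq_sum_mul_adjugate_row _ i]
    simp [Matrix.adjugate_apply]
  have h2 : ∀ j, (M.updateCol j fun i => C i j).det = ∑ i, C i j * M.adjugate j i := fun j => by
    rw [← Matrix.det_transpose, ← Matrix.updateRow_transpose, Matrix.det_eq_sum_mul_adjugate_row _ j]
    simp only [Matrix.updateRow_self, Matrix.adjugate_apply, Matrix.updateRow_idem]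
    refine Finset.sum_congr rfl fun i _ => ?_
    rw [← Matrix.adjugate_apply, ← Matrix.adjugate_apply, ← Matrix.adjugate_transpose,
      Matrix.transpose_apply]
  rw [Finset.sum_congr rfl fun i _ => h1 i, Finset.sum_congr rfl fun j _ => h2 j,
    Finset.sum_comm]

/-- The Vandermonde product. -/
def vdm {N : ℕ} (x : Fin N → ℂ) : ℂ := ∏ i, ∏ j ∈ Finset.Ioi i, (x j - x i)

/-- The falling factorial. -/
def fall (j : ℕ) (x : ℂ) : ℂ := (descPochhammer ℂ j).eval x

lemma fall_zero (x : ℂ) : fall 0 x = 1 := by simp [fall]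

lemma fall_succ (j : ℕ) (x : ℂ) : fall (j + 1) x = fall j x * (x - j) :=
  descPochhammer_succ_eval j x

lemma fall_succ_left (j : ℕ) (x : ℂ) : fall (j + 1) x = x * fall j (x - 1) := by
  simp [fall, descPochhammer_succ_left]

lemma mul_fall_sub_one (j : ℕ) (x : ℂ) : x * fall j (x - 1) = x * fall j x - j * fall j x := by
  rw [← fall_succ_left, fall_succ]; ring

lemma fall_succ_add_one (j : ℕ) (x : ℂ) : fall (j + 1) (x + 1) = (x + 1) * fall j x := by
  rw [fall_succ_left, add_sub_cancel_right]

lemma fall_succ_zero (j : ℕ) : fall (j + 1) 0 = 0 := by rw [fall_succ_left, zero_mul]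

/-- The matrix of falling factorials. -/
def fallMatrix {N : ℕ} (x : Fin N → ℂ) : Matrix (Fin N) (Fin N) ℂ :=
  Matrix.of fun i j => fall j (x i)

/-- Falling factorials replace powers because a unit shift acts on them by x·fall j (x − 1) = (x −
j)·fall j x and fall (j+1) (x + 1) = (x + 1)·fall j x. -/
lemma vdm_eq_det {N : ℕ} (x : Fin N → ℂ) : vdm x = (fallMatrix x).det := by
  rw [vdm, ← Matrix.det_vandermonde]
  exact Matrix.det_eval_matrixOfPolynomials_eq_det_vandermonde x (fun j => descPochhammer ℂ j)
    (fun j => descPochhammer_natDegree ℂ j) (fun j => monic_descPochhammer ℂ j)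

lemma vdm_add_single {N : ℕ} (x : Fin N → ℂ) (i : Fin N) (c : ℂ) :
    vdm (x + Pi.single i c)
      = ((fallMatrix x).updateRow i fun j : Fin N => fall j (x i + c)).det := by
  rw [vdm_eq_det]
  congr 1
  ext k j
  by_cases h : k = i
  · subst h; simp [fallMatrix]
  · simp [fallMatrix, h]

/-- Shifting row i down subtracts j·fall j from its j-th entry. Summed over rows, this correction
becomes multiplication of column j by j, once for each column. -/
lemma sum_mul_vdm_sub_single {N : ℕ} (x : Fin N → ℂ) :
    ∑ i, x i * vdm (x + Pi.single i (-1)) = (∑ i, x i - ∑ i : Fin N, (i : ℂ)) * vdm x := by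
  have h1 : ∀ i, x i * vdm (x + Pi.single i (-1)) = x i * (fallMatrix x).det
      - ((fallMatrix x).updateRow i
        ((Matrix.of fun i j : Fin N => (j : ℂ) * fall j (x i)) i)).det := fun i => by
    rw [vdm_add_single, ← Matrix.det_updateRow_smul]
    have h2 : x i • (fun j : Fin N => fall j (x i + -1)) = x i • (fallMatrix x i)
        + (-1 : ℂ) • (Matrix.of fun i j : Fin N => (j : ℂ) * fall j (x i)) i := by
      ext j
      simp only [Pi.smul_apply, smul_eq_mul, ← sub_eq_add_neg, mul_fall_sub_one, Pi.add_apply,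
        fallMatrix, Matrix.of_apply]
      ring
    rw [h2, Matrix.det_updateRow_add, Matrix.det_updateRow_smul, Matrix.det_updateRow_smul,
      Matrix.updateRow_eq_self]
    ring
  rw [Finset.sum_congr rfl fun i _ => h1 i, Finset.sum_sub_distrib, sum_det_updateRow, sub_mul,
    ← Finset.sum_mul, ← vdm_eq_det, Finset.sum_mul]
  congr 1
  rw [Finset.sum_mul]
  refine Finset.sum_congr rfl fun j _ => ?_
  have h3 : (fun i => (Matrix.of fun i j : Fin N => (j : ℂ) * fall j (x i)) i j)
      = (j : ℂ) • fun i => fallMatrix x i j := rfl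
  rw [h3, Matrix.det_updateCol_smul, Matrix.updateCol_eq_self, vdm_eq_det]

/-- Where x p = 0 the row p of falling factorials is (1, 0, …, 0), so only `w p` matters. -/
lemma det_updateCol_zero_fallMatrix {m : ℕ} (x : Fin (m + 1) → ℂ) {p : Fin (m + 1)}
    (hp : x p = 0) (w : Fin (m + 1) → ℂ) :
    ((fallMatrix x).updateCol 0 w).det = w p * vdm x := by
  have h1 : w = w p • (fun i => fallMatrix x i 0) + fun i => w i - w p := by
    ext i
    simp [fallMatrix, fall_zero]
  have h2 : ((fallMatrix x).updateCol 0 fun i => w i - w p).det = 0 := by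
    refine Matrix.det_eq_zero_of_row_eq_zero p fun j => ?_
    refine Fin.cases ?_ (fun j => ?_) j
    · simp
    · simp [fallMatrix, hp, fall_succ_zero]
  rw [vdm_eq_det]
  nth_rewrite 1 [h1]
  rw [Matrix.det_updateCol_add, h2, Matrix.det_updateCol_smul, Matrix.updateCol_eq_self, add_zero]

/-- Division by x i + 1 lowers the degree: in each column but the first it turns the shifted fall
(j+1) into fall j. -/
lemma sum_mul_vdm_add_single {m : ℕ} (x w : Fin (m + 1) → ℂ) (hx : ∀ i, x i + 1 ≠ 0) :
    ∑ i, w i * (vdm (x + Pi.single i 1) / (x i + 1))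
      = ((fallMatrix x).updateCol 0 fun i => w i / (x i + 1)).det
        + ∑ j : Fin m, ((fallMatrix x).updateCol j.succ fun i => w i * fall j (x i)).det := by
  have h1 : ∀ i, w i * (vdm (x + Pi.single i 1) / (x i + 1))
      = ((fallMatrix x).updateRow i ((Matrix.of fun i j : Fin (m + 1) =>
        w i / (x i + 1) * fall j (x i + 1)) i)).det := fun i => by
    rw [vdm_add_single]
    have h2 : (Matrix.of fun i j : Fin (m + 1) => w i / (x i + 1) * fall j (x i + 1)) i
        = (w i / (x i + 1)) • fun j : Fin (m + 1) => fall j (x i + 1) := rfl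
    rw [h2, Matrix.det_updateRow_smul]
    ring
  rw [Finset.sum_congr rfl fun i _ => h1 i, sum_det_updateRow, Fin.sum_univ_succ]
  congr 1
  · simp [fall_zero]
  · refine Finset.sum_congr rfl fun j _ => ?_
    congr 2
    ext i
    rw [Matrix.of_apply, Fin.val_succ, fall_succ_add_one, ← mul_assoc, div_mul_cancel₀ _ (hx i)]

lemma det_updateCol_succ_fallMatrix {m : ℕ} (x : Fin (m + 1) → ℂ) (j : Fin m) :
    ((fallMatrix x).updateCol j.succ fun i => fall j (x i)).det = 0 :=
  Matrix.det_updateCol_eq_zero (M := fallMatrix x) (i := j.castSucc) (j := j.succ)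
    (Fin.castSucc_lt_succ).ne

lemma sum_vdm_add_single {N : ℕ} (x : Fin N → ℂ) (hx : ∀ i, x i + 1 ≠ 0) {p : Fin N}
    (hp : x p = 0) : ∑ i, vdm (x + Pi.single i 1) / (x i + 1) = vdm x := by
  obtain ⟨m, rfl⟩ : ∃ m, N = m + 1 := ⟨N - 1, by have := p.2; omega⟩
  have h := sum_mul_vdm_add_single x 1 hx
  simp only [Pi.one_apply, one_mul] at h
  rw [h, det_updateCol_zero_fallMatrix x hp,
    Finset.sum_eq_zero fun j _ => det_updateCol_succ_fallMatrix x j, hp]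
  simp

/-- The first column contributes −(N − 1) times the Vandermonde product. Each of the other N − 1
columns contributes it once, up to a multiple of the preceding column. -/
lemma sum_sub_mul_vdm_add_single {N : ℕ} (x : Fin N → ℂ) (hx : ∀ i, x i + 1 ≠ 0) {p : Fin N}
    (hp : x p = 0) :
    ∑ i, (x i - ((N : ℂ) - 1)) * (vdm (x + Pi.single i 1) / (x i + 1)) = 0 := by
  obtain ⟨m, rfl⟩ : ∃ m, N = m + 1 := ⟨N - 1, by have := p.2; omega⟩
  rw [sum_mul_vdm_add_single x _ hx, det_updateCol_zero_fallMatrix x hp]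
  have h1 : ∀ j : Fin m, ((fallMatrix x).updateCol j.succ
      fun i => (x i - (((m + 1 : ℕ) : ℂ) - 1)) * fall j (x i)).det = vdm x := fun j => by
    have h2 : (fun i => (x i - (((m + 1 : ℕ) : ℂ) - 1)) * fall j (x i))
        = (fun i => fallMatrix x i j.succ) + ((j : ℂ) - m) • fun i => fall j (x i) := by
      ext i
      simp only [fallMatrix, Matrix.of_apply, Pi.add_apply, Pi.smul_apply, smul_eq_mul,
        Fin.val_succ, fall_succ]
      push_cast
      ring
    rw [h2, Matrix.det_updateCol_add, Matrix.updateCol_eq_self, Matrix.det_updateCol_smul,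
      det_updateCol_succ_fallMatrix, mul_zero, add_zero, vdm_eq_det]
  rw [Finset.sum_congr rfl fun j _ => h1 j, hp]
  simp

lemma vdm_ne_zero {N : ℕ} {x : Fin N → ℂ} (hx : Function.Injective x) : vdm x ≠ 0 :=
  Finset.prod_ne_zero_iff.2 fun _ _ => Finset.prod_ne_zero_iff.2 fun _ hj =>
    sub_ne_zero.2 (hx.ne (Finset.mem_Ioi.1 hj).ne')

lemma vdm_eq_zero {N : ℕ} {x : Fin N → ℂ} {i j : Fin N} (hij : i < j) (h : x i = x j) :
    vdm x = 0 :=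
  Finset.prod_eq_zero (Finset.mem_univ i)
    (Finset.prod_eq_zero (Finset.mem_Ioi.2 hij) (sub_eq_zero.2 h.symm))

lemma vdm_eq_prod {N : ℕ} (x : Fin N → ℂ) :
    vdm x = ∏ p : Fin N × Fin N with p.1 < p.2, (x p.2 - x p.1) := by
  rw [vdm, Finset.prod_sigma']
  refine Finset.prod_bij' (fun p _ => (p.1, p.2)) (fun p _ => ⟨p.1, p.2⟩) ?_ ?_ ?_ ?_ ?_ <;> simp

/-- A pair of indices other than (i, j) meets at most one of the two shifts, so its factors balance.
For the pair (i, j) with difference δ, the double shift leaves δ and the single shifts give δ ± 1,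
whence δ² − 1. -/
lemma vdm_add_single_add_single {N : ℕ} (x : Fin N → ℂ) {i j : Fin N} (hij : i ≠ j) :
    vdm (x + Pi.single i 1 + Pi.single j 1) * vdm x * ((x i - x j) ^ 2 - 1)
      = vdm (x + Pi.single i 1) * vdm (x + Pi.single j 1) * (x i - x j) ^ 2 := by
  wlog h : i < j generalizing i j
  · have := this hij.symm (lt_of_le_of_ne (not_lt.1 h) hij.symm)
    rw [add_right_comm x, mul_comm (vdm (x + Pi.single i 1)), ← neg_sub (x j), neg_sq, this]
  have hmem : (i, j) ∈ ({p | p.1 < p.2} : Finset (Fin N × Fin N)) := by simpa using h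
  have hne : ∀ y : Fin N → ℂ, vdm y = (y j - y i)
      * ∏ p ∈ ({p | p.1 < p.2} : Finset (Fin N × Fin N)).erase (i, j), (y p.2 - y p.1) :=
    fun y => by rw [vdm_eq_prod, ← Finset.mul_prod_erase _ _ hmem]
  have hrest : ∀ e f : Fin N → ℂ, e = Pi.single i 1 → f = Pi.single j 1 →
      (∏ p ∈ ({p | p.1 < p.2} : Finset (Fin N × Fin N)).erase (i, j),
        ((x + e + f) p.2 - (x + e + f) p.1))
      * (∏ p ∈ ({p | p.1 < p.2} : Finset (Fin N × Fin N)).erase (i, j), (x p.2 - x p.1))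
      = (∏ p ∈ ({p | p.1 < p.2} : Finset (Fin N × Fin N)).erase (i, j),
        ((x + e) p.2 - (x + e) p.1))
      * (∏ p ∈ ({p | p.1 < p.2} : Finset (Fin N × Fin N)).erase (i, j),
        ((x + f) p.2 - (x + f) p.1)) := by
    rintro e f rfl rfl
    rw [← Finset.prod_mul_distrib, ← Finset.prod_mul_distrib]
    refine Finset.prod_congr rfl fun p hp => ?_
    obtain ⟨a, b⟩ := p
    simp only [Finset.mem_erase, ne_eq, Prod.mk.injEq, not_and, Finset.mem_filter,
      Finset.mem_univ, true_and] at hp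
    obtain ⟨hp1, hp2⟩ := hp
    simp only [Pi.add_apply, Pi.single_apply]
    by_cases ha : a = i
    · subst ha
      simp [hp1 rfl, hij, hp2.ne']
    · by_cases hb : b = i
      · subst hb
        have : a ≠ j := (hp2.trans h).ne
        simp [hij, ha, this]
      · simp [ha, hb]
        ring
  have hr := hrest _ _ rfl rfl
  rw [hne x, hne (x + Pi.single i 1), hne (x + Pi.single j 1),
    hne (x + Pi.single i 1 + Pi.single j 1)]
  generalize (∏ p ∈ ({p | p.1 < p.2} : Finset (Fin N × Fin N)).erase (i, j),
    (x p.2 - x p.1)) = q1 at *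
  generalize (∏ p ∈ ({p | p.1 < p.2} : Finset (Fin N × Fin N)).erase (i, j),
    ((x + Pi.single i 1 : Fin N → ℂ) p.2 - (x + Pi.single i 1 : Fin N → ℂ) p.1)) = q2 at *
  generalize (∏ p ∈ ({p | p.1 < p.2} : Finset (Fin N × Fin N)).erase (i, j),
    ((x + Pi.single j 1 : Fin N → ℂ) p.2 - (x + Pi.single j 1 : Fin N → ℂ) p.1)) = q3 at *
  generalize (∏ p ∈ ({p | p.1 < p.2} : Finset (Fin N × Fin N)).erase (i, j),
    ((x + Pi.single i 1 + Pi.single j 1 : Fin N → ℂ) p.2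
      - (x + Pi.single i 1 + Pi.single j 1 : Fin N → ℂ) p.1)) = q4 at *
  simp only [Pi.add_apply, Pi.single_eq_same, Pi.single_eq_of_ne hij, Pi.single_eq_of_ne hij.symm]
  linear_combination ((x j - x i) * (x j - x i) * ((x i - x j) ^ 2 - 1)) * hr

/-! ### Dimensions of partitions -/

open Classical in
/-- The partitions of `n` with at most `N` rows. -/
def parts (N n : ℕ) : Finset (Fin N → ℕ) :=
  {l ∈ Fintype.piFinset fun _ : Fin N => Finset.range (n + 1) | Antitone l ∧ ∑ i, l i = n}

lemma mem_parts {N n : ℕ} {l : Fin N → ℕ} : l ∈ parts N n ↔ Antitone l ∧ ∑ i, l i = n := by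
  rw [parts, Finset.mem_filter, and_iff_right_iff_imp, Fintype.mem_piFinset]
  rintro ⟨-, h⟩ i
  rw [Finset.mem_range, Nat.lt_succ_iff, ← h]
  exact Finset.single_le_sum (fun _ _ => Nat.zero_le _) (Finset.mem_univ i)

/-- The diagram obtained by adding a cell to row `i`. -/
def addCell {N : ℕ} (l : Fin N → ℕ) (i : Fin N) : Fin N → ℕ := l + Pi.single i 1

/-- The content of the cell added to row `i`. -/
def newContent {N : ℕ} (l : Fin N → ℕ) (i : Fin N) : ℂ := (l i : ℂ) - (i : ℕ)

/-- The strictly decreasing sequence of shifted parts. -/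
def shifted {N : ℕ} (l : Fin N → ℕ) (i : Fin N) : ℕ := l i + (N - 1 - i)

/-- The normalised dimension of the representation of the symmetric group. -/
def dimv {N : ℕ} (l : Fin N → ℕ) : ℂ :=
  vdm (fun i => (shifted l i : ℂ)) / ∏ i, ((shifted l i).factorial : ℂ)

lemma addCell_self {N : ℕ} (l : Fin N → ℕ) (i : Fin N) : addCell l i i = l i + 1 := by
  simp [addCell]

lemma addCell_of_ne {N : ℕ} (l : Fin N → ℕ) {i j : Fin N} (h : j ≠ i) : addCell l i j = l j := by
  simp [addCell, h]

lemma addCell_comm {N : ℕ} (l : Fin N → ℕ) (i j : Fin N) :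
    addCell (addCell l i) j = addCell (addCell l j) i := add_right_comm _ _ _

lemma sum_addCell {N : ℕ} (l : Fin N → ℕ) (i : Fin N) : ∑ j, addCell l i j = ∑ j, l j + 1 := by
  simp [addCell, Finset.sum_add_distrib]

lemma shifted_addCell_self {N : ℕ} (l : Fin N → ℕ) (i : Fin N) :
    shifted (addCell l i) i = shifted l i + 1 := by
  rw [shifted, addCell_self, shifted]; omega

lemma shifted_addCell_of_ne {N : ℕ} (l : Fin N → ℕ) {i j : Fin N} (h : j ≠ i) :
    shifted (addCell l i) j = shifted l j := by
  rw [shifted, addCell_of_ne l h, shifted]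

lemma newContent_addCell_self {N : ℕ} (l : Fin N → ℕ) (i : Fin N) :
    newContent (addCell l i) i = newContent l i + 1 := by
  rw [newContent, addCell_self, newContent]; push_cast; ring

lemma newContent_addCell_of_ne {N : ℕ} (l : Fin N → ℕ) {i j : Fin N} (h : j ≠ i) :
    newContent (addCell l i) j = newContent l j := by
  rw [newContent, addCell_of_ne l h, newContent]

lemma shifted_eq {N : ℕ} (l : Fin N → ℕ) (i : Fin N) :
    (shifted l i : ℂ) - ((N : ℂ) - 1) = newContent l i := by
  have h : shifted l i + i + 1 = l i + N := by have := i.2; rw [shifted]; omega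
  have h' : (shifted l i : ℂ) + (i : ℕ) + 1 = l i + N := by exact_mod_cast h
  rw [newContent]
  linear_combination h'

lemma shifted_sub {N : ℕ} (l : Fin N → ℕ) (i j : Fin N) :
    (shifted l i : ℂ) - shifted l j = newContent l i - newContent l j := by
  rw [← shifted_eq, ← shifted_eq]; ring

lemma shifted_strictAnti {N : ℕ} {l : Fin N → ℕ} (hl : Antitone l) : StrictAnti (shifted l) := by
  intro i j hij
  have h1 := hl hij.le
  have h2 : (i : ℕ) < j := hij
  have := j.2
  rw [shifted, shifted]
  omega

lemma prod_factorial_ne_zero {N : ℕ} (l : Fin N → ℕ) :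
    ∏ i, ((shifted l i).factorial : ℂ) ≠ 0 :=
  Finset.prod_ne_zero_iff.2 fun _ _ => Nat.cast_ne_zero.2 (Nat.factorial_ne_zero _)

lemma dimv_ne_zero {N : ℕ} {l : Fin N → ℕ} (hl : Antitone l) : dimv l ≠ 0 :=
  div_ne_zero (vdm_ne_zero (Nat.cast_injective.comp (shifted_strictAnti hl).injective))
    (prod_factorial_ne_zero l)

lemma shifted_addCell {N : ℕ} (l : Fin N → ℕ) (i : Fin N) :
    (fun j => (shifted (addCell l i) j : ℂ)) = (fun j => (shifted l j : ℂ)) + Pi.single i 1 := by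
  ext j
  by_cases h : j = i
  · subst h; simp [shifted_addCell_self]
  · simp [shifted_addCell_of_ne l h, h]

lemma prod_factorial_addCell {N : ℕ} (l : Fin N → ℕ) (i : Fin N) :
    ∏ j, ((shifted (addCell l i) j).factorial : ℂ)
      = (shifted l i + 1) * ∏ j, ((shifted l j).factorial : ℂ) := by
  rw [← Finset.mul_prod_erase _ _ (Finset.mem_univ i), ← Finset.mul_prod_erase _
    (fun j => ((shifted l j).factorial : ℂ)) (Finset.mem_univ i), shifted_addCell_self,
    Nat.factorial_succ, ← mul_assoc]
  push_cast
  congr 1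
  exact Finset.prod_congr rfl fun j hj => by rw [shifted_addCell_of_ne l (Finset.ne_of_mem_erase hj)]

lemma dimv_addCell {N : ℕ} (l : Fin N → ℕ) (i : Fin N) :
    dimv (addCell l i) = vdm ((fun j => (shifted l j : ℂ)) + Pi.single i 1) / (shifted l i + 1)
      / ∏ j, ((shifted l j).factorial : ℂ) := by
  rw [dimv, shifted_addCell, prod_factorial_addCell, div_div]

/-- Adding a cell to a row which is as long as the preceding one yields no partition. -/
lemma exists_of_not_antitone_addCell {N : ℕ} {l : Fin N → ℕ} (hl : Antitone l) {i : Fin N}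
    (h : ¬ Antitone (addCell l i)) : ∃ j, j < i ∧ shifted l j = shifted l i + 1 := by
  have hN := i.2
  rcases Nat.eq_zero_or_pos (i : ℕ) with h0 | h0
  · refine absurd (fun a b hab => ?_) h
    rcases eq_or_ne b i with rfl | hb
    · have : a = b := le_antisymm hab (by rw [Fin.le_def, h0]; omega)
      rw [this]
    · rw [addCell_of_ne l hb]
      exact (hl hab).trans (by simp [addCell])
  · refine ⟨⟨i - 1, by omega⟩, by rw [Fin.lt_def]; simp only; omega, ?_⟩
    have h1 : l i ≤ l ⟨i - 1, by omega⟩ := hl (by rw [Fin.le_def]; simp only; omega)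
    have h2 : l ⟨i - 1, by omega⟩ ≤ l i := by
      by_contra hlt
      refine h fun a b hab => ?_
      rcases eq_or_ne b i with rfl | hb
      · rcases eq_or_ne a b with rfl | ha
        · exact le_rfl
        · have hlt' : a < b := lt_of_le_of_ne hab ha
          have h3 : l ⟨b - 1, by omega⟩ ≤ l a :=
            hl (by rw [Fin.lt_def] at hlt'; rw [Fin.le_def]; simp only; omega)
          rw [addCell_self, addCell_of_ne l ha]
          omega
      · rw [addCell_of_ne l hb]
        exact (hl hab).trans (by simp [addCell])
    simp only [shifted]
    omega

/-- An inadmissible cell makes two shifted parts equal, so sums over admissible cells may run over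
all rows. -/
lemma dimv_addCell_eq_zero {N : ℕ} {l : Fin N → ℕ} (hl : Antitone l) {i : Fin N}
    (h : ¬ Antitone (addCell l i)) : dimv (addCell l i) = 0 := by
  obtain ⟨j, hj, h1⟩ := exists_of_not_antitone_addCell hl h
  rw [dimv, vdm_eq_zero hj, zero_div]
  rw [shifted_addCell_self, shifted_addCell_of_ne l hj.ne, h1]

/-- With fewer than N cells the last row is empty. This zero is what the Vandermonde identities for
added cells require. -/
lemma exists_shifted_eq_zero {N n : ℕ} {l : Fin N → ℕ} (hl : l ∈ parts N n) (hn : n < N) :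
    ∃ p, shifted l p = 0 := by
  obtain ⟨h1, h2⟩ := mem_parts.1 hl
  refine ⟨⟨N - 1, by omega⟩, ?_⟩
  rw [shifted]
  by_contra h
  have h3 : ∀ i, 1 ≤ l i := fun i => by
    have h4 : l ⟨N - 1, by omega⟩ ≤ l i := h1 (by rw [Fin.le_def]; simp only; omega)
    simp only at h
    omega
  have h5 : ∑ _i : Fin N, 1 ≤ ∑ i, l i := Finset.sum_le_sum fun i _ => h3 i
  simp at h5
  omega

lemma sum_dimv_addCell {N n : ℕ} {l : Fin N → ℕ} (hl : l ∈ parts N n) (hn : n < N) :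
    ∑ i, dimv (addCell l i) = dimv l := by
  obtain ⟨p, hp⟩ := exists_shifted_eq_zero hl hn
  simp only [dimv_addCell]
  rw [← Finset.sum_div, sum_vdm_add_single (fun j => (shifted l j : ℂ))
    (fun i => Nat.cast_add_one_ne_zero _) (p := p) (by simp [hp]), dimv]

lemma sum_newContent_mul_dimv_addCell {N n : ℕ} {l : Fin N → ℕ} (hl : l ∈ parts N n) (hn : n < N) :
    ∑ i, newContent l i * dimv (addCell l i) = 0 := by
  obtain ⟨p, hp⟩ := exists_shifted_eq_zero hl hn
  simp only [dimv_addCell, ← shifted_eq, ← mul_div_assoc]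
  rw [← Finset.sum_div]
  have := sum_sub_mul_vdm_add_single (fun j => (shifted l j : ℂ))
    (fun i => Nat.cast_add_one_ne_zero _) (p := p) (by simp [hp])
  simp only [← mul_div_assoc] at this
  rw [this, zero_div]

lemma dimv_addCell_addCell {N : ℕ} (l : Fin N → ℕ) {i j : Fin N} (hij : i ≠ j) :
    dimv (addCell (addCell l i) j) * dimv l * ((newContent l i - newContent l j) ^ 2 - 1)
      = dimv (addCell l i) * dimv (addCell l j) * (newContent l i - newContent l j) ^ 2 := by
  have h := vdm_add_single_add_single (fun j => (shifted l j : ℂ)) hij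
  simp only [dimv, shifted_addCell, prod_factorial_addCell, shifted_addCell_of_ne l hij.symm,
    ← shifted_sub]
  have h1 := prod_factorial_ne_zero l
  have h2 : (shifted l i : ℂ) + 1 ≠ 0 := Nat.cast_add_one_ne_zero _
  have h3 : (shifted l j : ℂ) + 1 ≠ 0 := Nat.cast_add_one_ne_zero _
  field_simp
  linear_combination h

/-! ### Removing a cell, and the branching rule -/

/-- The diagram obtained by removing a cell from row `i`. -/
def removeCell {N : ℕ} (l : Fin N → ℕ) (i : Fin N) : Fin N → ℕ := l - Pi.single i 1

lemma addCell_removeCell {N : ℕ} {l : Fin N → ℕ} {i : Fin N} (h : 1 ≤ l i) :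
    addCell (removeCell l i) i = l := by
  ext j
  rcases eq_or_ne j i with rfl | hj
  · simp [addCell, removeCell]; omega
  · simp [addCell, removeCell, hj]

lemma removeCell_addCell {N : ℕ} (l : Fin N → ℕ) (i : Fin N) : removeCell (addCell l i) i = l :=
  add_tsub_cancel_right _ _

/-- An irremovable cell either lies in an empty last row, where the shifted part is 0, or in a row
as long as the next one, where lowering creates equal arguments. -/
lemma vdm_shifted_sub_single_eq_zero {N : ℕ} {l : Fin N → ℕ} (hl : Antitone l) {i : Fin N}
    (h : ¬ (1 ≤ l i ∧ Antitone (removeCell l i))) :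
    (shifted l i : ℂ) * vdm ((fun j => (shifted l j : ℂ)) + Pi.single i (-1)) = 0 := by
  have hN := i.2
  rcases eq_or_ne (i + 1 : ℕ) N with hi | hi
  · have h0 : l i = 0 := by
      by_contra h0
      refine h ⟨by omega, fun a b hab => ?_⟩
      rcases eq_or_ne a i with rfl | ha
      · have : b = a := le_antisymm (by have := b.2; rw [Fin.le_def]; omega) hab
        rw [this]
      · simp only [removeCell, Pi.sub_apply, Pi.single_eq_of_ne ha, tsub_zero]
        exact (Nat.sub_le _ _).trans (hl hab)
    have : shifted l i = 0 := by rw [shifted]; omega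
    rw [this, Nat.cast_zero, zero_mul]
  · have hlt : (i : ℕ) + 1 < N := by omega
    have h1 : l ⟨i + 1, hlt⟩ ≤ l i := hl (by rw [Fin.le_def]; simp)
    have h2 : l i ≤ l ⟨i + 1, hlt⟩ := by
      by_contra hc
      refine h ⟨by omega, fun a b hab => ?_⟩
      rcases eq_or_ne a i with rfl | ha
      · rcases eq_or_ne b a with rfl | hb
        · exact le_rfl
        · have hab' : a < b := lt_of_le_of_ne hab hb.symm
          have h3 : l b ≤ l ⟨a + 1, hlt⟩ :=
            hl (by rw [Fin.lt_def] at hab'; rw [Fin.le_def]; simp only; omega)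
          simp only [removeCell, Pi.sub_apply, Pi.single_eq_of_ne hb, tsub_zero,
            Pi.single_eq_same]
          omega
      · simp only [removeCell, Pi.sub_apply, Pi.single_eq_of_ne ha, tsub_zero]
        exact (Nat.sub_le _ _).trans (hl hab)
    have h4 : i < ⟨i + 1, hlt⟩ := by rw [Fin.lt_def]; simp
    rw [vdm_eq_zero h4, mul_zero]
    have h5 : shifted l i = shifted l ⟨i + 1, hlt⟩ + 1 := by simp only [shifted]; omega
    simp only [Pi.add_apply, Pi.single_eq_same, Pi.single_eq_of_ne h4.ne', h5]
    push_cast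
    ring

lemma dimv_removeCell {N : ℕ} {l : Fin N → ℕ} {i : Fin N} (h : 1 ≤ l i) :
    dimv (removeCell l i) = (shifted l i : ℂ)
      * vdm ((fun j => (shifted l j : ℂ)) + Pi.single i (-1))
      / ∏ j, ((shifted l j).factorial : ℂ) := by
  set m := removeCell l i with hm
  have hl : l = addCell m i := (addCell_removeCell h).symm
  have h2 : (shifted m i : ℂ) + 1 ≠ 0 := Nat.cast_add_one_ne_zero _
  have h1 := prod_factorial_ne_zero m
  rw [hl, shifted_addCell, prod_factorial_addCell, shifted_addCell_self, add_assoc,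
    ← Pi.single_add, add_neg_cancel, Pi.single_zero, add_zero, dimv]
  push_cast
  field_simp

-- The branching rule dim λ = ∑ dim(λ − □), divided by (n − 1)! when n ≥ 1.
open Classical in
lemma sum_dimv_removeCell {N n : ℕ} {l : Fin N → ℕ} (hl : l ∈ parts N n) :
    ∑ i with 1 ≤ l i ∧ Antitone (removeCell l i), dimv (removeCell l i) = n * dimv l := by
  obtain ⟨h1, h2⟩ := mem_parts.1 hl
  have h3 : ∀ i, (if 1 ≤ l i ∧ Antitone (removeCell l i) then dimv (removeCell l i) else 0)
      = (shifted l i : ℂ) * vdm ((fun j => (shifted l j : ℂ)) + Pi.single i (-1))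
      / ∏ j, ((shifted l j).factorial : ℂ) := fun i => by
    split_ifs with h
    · exact dimv_removeCell h.1
    · rw [vdm_shifted_sub_single_eq_zero h1 h, zero_div]
  rw [Finset.sum_filter, Finset.sum_congr rfl fun i _ => h3 i, ← Finset.sum_div,
    sum_mul_vdm_sub_single (fun j => (shifted l j : ℂ)), dimv, mul_div_assoc]
  congr 1
  have h4 : ∑ i : Fin N, (N - 1 - i : ℕ) = ∑ i : Fin N, (i : ℕ) := by
    rw [← Equiv.sum_comp Fin.revPerm]
    refine Finset.sum_congr rfl fun i _ => ?_
    rw [Fin.revPerm_apply, Fin.val_rev]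
    omega
  have h5 : ∑ i, shifted l i = n + ∑ i : Fin N, (i : ℕ) := by
    simp only [shifted, Finset.sum_add_distrib, h2, h4]
  have h6 : ∑ i, (shifted l i : ℂ) = n + ∑ i : Fin N, ((i : ℕ) : ℂ) := by exact_mod_cast h5
  rw [h6, add_sub_cancel_right]

/-! ### Elements of the group algebra with eigenvalues indexed by partitions -/

/-- The elements `∑ Y J_n^e`, with `Y` in a class `Q` of elements with eigenvalues, together with
their eigenvalues `F l i` on the path which ends by adding a cell to row `i` of `l`. -/
inductive PathEigen {N : ℕ} (Q : PermAlg → ((Fin N → ℕ) → ℂ) → Prop) (n : ℕ) :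
    PermAlg → ((Fin N → ℕ) → Fin N → ℂ) → Prop
  | term (Y : PermAlg) (f : (Fin N → ℕ) → ℂ) (e : ℕ) (h : Q Y f) :
      PathEigen Q n (Y * jucys n ^ e) fun l i => f l * newContent l i ^ e
  | add (Y Y' : PermAlg) (F F' : (Fin N → ℕ) → Fin N → ℂ) (h : PathEigen Q n Y F)
      (h' : PathEigen Q n Y' F') : PathEigen Q n (Y + Y') fun l i => F l i + F' l i
  | congr (Y : PermAlg) (F G : (Fin N → ℕ) → Fin N → ℂ) (h : PathEigen Q n Y F)
      (hFG : ∀ l ∈ parts N n, ∀ i, Antitone (addCell l i) → F l i = G l i) : PathEigen Q n Y G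

/-- The element `Y` is a polynomial in Jucys-Murphy elements which lies in the group algebra of
`S(n)` and has the eigenvalue `f l` in the representation labelled by `l`. -/
def Eigen (N : ℕ) : ℕ → PermAlg → ((Fin N → ℕ) → ℂ) → Prop
  | 0 => fun Y f => Y = algebraMap ℂ PermAlg (f 0)
  | n + 1 => fun Y f => PathEigen (Eigen N n) n Y fun l i => f (addCell l i)

lemma PathEigen.condExp_eq {N n : ℕ} {Q : PermAlg → ((Fin N → ℕ) → ℂ) → Prop}
    (hQ : ∀ Y f, Q Y f → condExp n Y = Y) {Y : PermAlg} {F : (Fin N → ℕ) → Fin N → ℂ}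
    (h : PathEigen Q n Y F) : condExp (n + 1) Y = Y := by
  induction h with
  | term Y f e h =>
    exact condExp_mul_eq (condExp_eq_of_le n.le_succ (hQ Y f h)) (condExp_pow_eq (condExp_jucys n) e)
  | add Y Y' F F' _ _ h h' => rw [map_add, h, h']
  | congr _ _ _ _ _ h => exact h

lemma Eigen.condExp_eq {N : ℕ} : ∀ {n : ℕ} {Y : PermAlg} {f : (Fin N → ℕ) → ℂ},
    Eigen N n Y f → condExp n Y = Y
  | 0, _, f, h => by
    have h' : _ = algebraMap ℂ PermAlg (f 0) := h
    rw [h', condExp_algebraMap]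
  | n + 1, _, _, h => PathEigen.condExp_eq (fun _ _ h => Eigen.condExp_eq h) h

/-- Since J_n commutes with the algebra of S(n), the powers of J_n can be collected on the right. -/
lemma PathEigen.mul {N n : ℕ} {Q : PermAlg → ((Fin N → ℕ) → ℂ) → Prop}
    (hQ : ∀ Y f, Q Y f → condExp n Y = Y)
    (hmul : ∀ Y f Y' f', Q Y f → Q Y' f' → Q (Y * Y') fun l => f l * f' l)
    {Y Y' : PermAlg} {F F' : (Fin N → ℕ) → Fin N → ℂ}
    (h : PathEigen Q n Y F) (h' : PathEigen Q n Y' F') :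
    PathEigen Q n (Y * Y') fun l i => F l i * F' l i := by
  induction h with
  | term Y f e h =>
    induction h' with
    | term Y' f' e' h' =>
      have h1 : Y * jucys n ^ e * (Y' * jucys n ^ e') = Y * Y' * jucys n ^ (e + e') := by
        have h2 : Y' * jucys n ^ e = jucys n ^ e * Y' := (commute_jucys (hQ Y' f' h')).pow_right e
        rw [pow_add, mul_assoc, ← mul_assoc (jucys n ^ e), ← h2]
        simp only [mul_assoc]
      rw [h1]
      refine .congr _ _ _ (.term _ _ (e + e') (hmul _ _ _ _ h h')) fun l _ i _ => ?_
      simp only [pow_add]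
      ring
    | add Y1 Y2 F1 F2 _ _ h1 h2 =>
      rw [mul_add]
      exact .congr _ _ _ (.add _ _ _ _ h1 h2) fun l _ i _ => (mul_add _ _ _).symm
    | congr Y1 F1 F2 _ hF h1 =>
      exact .congr _ _ _ h1 fun l hl i hi => by rw [hF l hl i hi]
  | add Y1 Y2 F1 F2 _ _ h1 h2 =>
    rw [add_mul]
    exact .congr _ _ _ (.add _ _ _ _ h1 h2) fun l _ i _ => (add_mul _ _ _).symm
  | congr Y1 F1 F2 _ hF h1 =>
    exact .congr _ _ _ h1 fun l hl i hi => by rw [hF l hl i hi]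

lemma Eigen.mul {N : ℕ} : ∀ {n : ℕ} {Y Y' : PermAlg} {f f' : (Fin N → ℕ) → ℂ},
    Eigen N n Y f → Eigen N n Y' f' → Eigen N n (Y * Y') fun l => f l * f' l
  | 0, Y, Y', f, f', h, h' => by
    have h1 : Y = algebraMap ℂ PermAlg (f 0) := h
    have h2 : Y' = algebraMap ℂ PermAlg (f' 0) := h'
    change Y * Y' = algebraMap ℂ PermAlg (f 0 * f' 0)
    rw [h1, h2, map_mul]
  | _ + 1, _, _, _, _, h, h' =>
    PathEigen.mul (fun _ _ h => Eigen.condExp_eq h) (fun _ _ _ _ h h' => Eigen.mul h h') h h'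

lemma PathEigen.of_eigen {N n : ℕ} {Q : PermAlg → ((Fin N → ℕ) → ℂ) → Prop} {Y : PermAlg}
    {f : (Fin N → ℕ) → ℂ} (h : Q Y f) : PathEigen Q n Y fun l _ => f l := by
  have := PathEigen.term (n := n) Y f 0 h
  simpa using this

lemma Eigen.const {N : ℕ} (c : ℂ) : ∀ n : ℕ, Eigen N n (algebraMap ℂ PermAlg c) fun _ => c
  | 0 => rfl
  | n + 1 => PathEigen.of_eigen (Eigen.const c n)

lemma PathEigen.jucys (N n : ℕ) :
    PathEigen (Eigen N n) n (jucys n) fun l i => newContent l i := by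
  have := PathEigen.term (n := n) _ _ 1 (Eigen.const (N := N) 1 n)
  simpa only [map_one, one_mul, pow_one] using this

/-! ### The transition moments -/

/-- The moments of the contents of the added cell under the Plancherel growth process. -/
def transMoment {N : ℕ} (k : ℕ) (l : Fin N → ℕ) : ℂ :=
  ∑ i, dimv (addCell l i) / dimv l * newContent l i ^ k

lemma transMoment_zero {N n : ℕ} {l : Fin N → ℕ} (hl : l ∈ parts N n) (hn : n < N) :
    transMoment 0 l = 1 := by
  simp only [transMoment, pow_zero, mul_one]
  rw [← Finset.sum_div, sum_dimv_addCell hl hn, div_self (dimv_ne_zero (mem_parts.1 hl).1)]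

lemma transMoment_one {N n : ℕ} {l : Fin N → ℕ} (hl : l ∈ parts N n) (hn : n < N) :
    transMoment 1 l = 0 := by
  simp only [transMoment, pow_one, div_mul_eq_mul_div, mul_comm (dimv _)]
  rw [← Finset.sum_div, sum_newContent_mul_dimv_addCell hl hn, zero_div]

/-- The counterpart of `moment_succ` for Plancherel growth. It holds separately for each row
receiving the new cell, by `dimv_addCell_addCell`. -/
lemma transMoment_addCell {N : ℕ} {l : Fin N → ℕ} (hl : Antitone l) (j : Fin N)
    (hj : Antitone (addCell l j)) (k : ℕ) :
    transMoment (k + 2) (addCell l j)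
      = 2 * newContent l j * transMoment (k + 1) (addCell l j)
        - (newContent l j ^ 2 - 1) * transMoment k (addCell l j)
        + transMoment (k + 2) l - 2 * newContent l j * transMoment (k + 1) l
        + newContent l j ^ 2 * transMoment k l := by
  have h0 := dimv_ne_zero hl
  have h1 := dimv_ne_zero hj
  rw [← sub_eq_zero]
  simp only [transMoment, Finset.mul_sum]
  rw [← Finset.sum_sub_distrib, ← Finset.sum_add_distrib, ← Finset.sum_sub_distrib,
    ← Finset.sum_add_distrib, ← Finset.sum_sub_distrib]
  refine Finset.sum_eq_zero fun i _ => ?_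
  -- In the row just extended the new content exceeds the old one by 1, so (difference)² − 1
  -- vanishes, and the terms from l vanish as well.
  rcases eq_or_ne i j with rfl | hij
  · rw [newContent_addCell_self]
    ring
  · rw [newContent_addCell_of_ne l hij]
    have h2 : dimv (addCell (addCell l j) i) / dimv (addCell l j)
        * ((newContent l i - newContent l j) ^ 2 - 1)
        = dimv (addCell l i) / dimv l * (newContent l i - newContent l j) ^ 2 := by
      have h3 := dimv_addCell_addCell l hij
      rw [addCell_comm] at h3
      field_simp
      linear_combination h3
    linear_combination (newContent l i ^ k) * h2

lemma zero_mem_parts (N : ℕ) : (0 : Fin N → ℕ) ∈ parts N 0 :=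
  mem_parts.2 ⟨fun _ _ _ => le_rfl, by simp⟩

lemma addCell_mem_parts {N n : ℕ} {l : Fin N → ℕ} (hl : l ∈ parts N n) {i : Fin N}
    (hi : Antitone (addCell l i)) : addCell l i ∈ parts N (n + 1) :=
  mem_parts.2 ⟨hi, by rw [sum_addCell, (mem_parts.1 hl).2]⟩

lemma Eigen.congr {N : ℕ} : ∀ {n : ℕ} {Y : PermAlg} {f g : (Fin N → ℕ) → ℂ},
    Eigen N n Y f → (∀ l ∈ parts N n, f l = g l) → Eigen N n Y g
  | 0, Y, f, g, h, hfg => by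
    have h1 : Y = algebraMap ℂ PermAlg (f 0) := h
    change Y = algebraMap ℂ PermAlg (g 0)
    rw [h1, hfg 0 (zero_mem_parts N)]
  | _ + 1, _, _, _, h, hfg =>
    PathEigen.congr _ _ _ h fun _ hl _ hi => hfg _ (addCell_mem_parts hl hi)

lemma transMoment_succ_zero {N : ℕ} (k : ℕ) : transMoment (k + 1) (0 : Fin N → ℕ) = 0 := by
  refine Finset.sum_eq_zero fun i _ => ?_
  rcases Nat.eq_zero_or_pos (i : ℕ) with h | h
  · simp [newContent, h]
  · rw [dimv_addCell_eq_zero (fun _ _ _ => le_rfl), zero_div, zero_mul]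
    intro ha
    have h1 : (⟨0, h.trans i.2⟩ : Fin N) < i := h
    have h2 := ha h1.le
    rw [addCell_self, addCell_of_ne _ h1.ne] at h2
    simp at h2

/-- Both families obey the same two-step recursion in k and agree at k = 0, 1 and at n = 0. The
recursion uses only sums, products, J_n and earlier moments, all of which stay in the class `Eigen`.
-/
lemma eigen_moment {N : ℕ} : ∀ {n : ℕ}, n < N → ∀ k, Eigen N n (moment n k) (transMoment k)
  | 0, hn, 0 => by
    change moment 0 0 = algebraMap ℂ PermAlg (transMoment 0 0)
    rw [moment_pow_zero, transMoment_zero (zero_mem_parts N) hn, map_one]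
  | 0, hn, k + 1 => by
    change moment 0 (k + 1) = algebraMap ℂ PermAlg (transMoment (k + 1) 0)
    rw [moment_zero, if_neg k.succ_ne_zero, transMoment_succ_zero, map_zero]
  | n + 1, hn, 0 => by
    rw [moment_pow_zero, ← map_one (algebraMap ℂ PermAlg)]
    exact (Eigen.const 1 (n + 1)).congr fun l hl => (transMoment_zero hl hn).symm
  | n + 1, hn, 1 => by
    rw [moment_pow_one, ← map_zero (algebraMap ℂ PermAlg)]
    exact (Eigen.const 0 (n + 1)).congr fun l hl => (transMoment_one hl hn).symm
  | n + 1, hn, k + 2 => by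
    have h1 : PathEigen (Eigen N n) n _ _ := eigen_moment hn (k + 1)
    have h0 : PathEigen (Eigen N n) n _ _ := eigen_moment hn k
    have h' := fun k => PathEigen.of_eigen (n := n) (eigen_moment (n.lt_succ_self.trans hn) k)
    have hJ := PathEigen.jucys N n
    have hc := fun c => PathEigen.of_eigen (n := n) (Eigen.const (N := N) c n)
    have hmul : ∀ {Y Y' : PermAlg} {F F' : (Fin N → ℕ) → Fin N → ℂ},
        PathEigen (Eigen N n) n Y F → PathEigen (Eigen N n) n Y' F' →
        PathEigen (Eigen N n) n (Y * Y') fun l i => F l i * F' l i :=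
      PathEigen.mul (fun _ _ h => Eigen.condExp_eq h) fun _ _ _ _ h h' => Eigen.mul h h'
    have h := ((((hmul (hmul (hc 2) hJ) h1).add _ _ _ _ (hmul (hc (-1))
      (hmul ((hmul hJ hJ).add _ _ _ _ (hc (-1))) h0))).add _ _ _ _ (h' (k + 2))).add _ _ _ _
      (hmul (hmul (hc (-2)) hJ) (h' (k + 1)))).add _ _ _ _ (hmul (hmul hJ hJ) (h' k))
    have hY : algebraMap ℂ PermAlg 2 = 2 := map_ofNat _ 2
    have hY' : algebraMap ℂ PermAlg (-1) = -1 := by rw [map_neg, map_one]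
    have hY2 : algebraMap ℂ PermAlg (-2) = -2 := by rw [map_neg, hY]
    rw [hY, hY', hY2] at h
    change PathEigen (Eigen N n) n _ _
    rw [moment_succ]
    convert PathEigen.congr _ _ (fun l i => transMoment (k + 2) (addCell l i)) h ?_ using 1
    · noncomm_ring
    · intro l hl i hi
      rw [transMoment_addCell (mem_parts.1 hl).1 i hi]
      ring

/-! ### Young diagrams, hook lengths and dimensions -/

/-- The rows of a Young diagram with at most `N` rows. -/
def rows (N : ℕ) (μ : YoungDiagram) (i : Fin N) : ℕ := μ.rowLen i

lemma rows_antitone (N : ℕ) (μ : YoungDiagram) : Antitone (rows N μ) :=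
  fun _ _ h => μ.rowLen_anti _ _ h

lemma lt_rowLen_iff_lt_colLen {μ : YoungDiagram} {i j : ℕ} : j < μ.rowLen i ↔ i < μ.colLen j := by
  rw [← YoungDiagram.mem_iff_lt_rowLen, ← YoungDiagram.mem_iff_lt_colLen]

lemma lt_of_mem_of_colLen_le {μ : YoungDiagram} {N : ℕ} (h : μ.colLen 0 ≤ N) {c : ℕ × ℕ}
    (hc : c ∈ μ) : c.1 < N :=
  (lt_of_lt_of_le (YoungDiagram.mem_iff_lt_colLen.1 (show (c.1, c.2) ∈ μ from hc))
    (μ.colLen_anti 0 c.2 (Nat.zero_le _))).trans_le h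

lemma cells_eq_map {μ : YoungDiagram} {N : ℕ} (h : μ.colLen 0 ≤ N) :
    μ.cells = (Finset.univ.sigma fun i : Fin N => Finset.range (rows N μ i)).map
      ⟨fun p => ((p.1 : ℕ), p.2), fun p q hpq => by
        obtain ⟨a, b⟩ := p
        obtain ⟨a', b'⟩ := q
        simp only [Prod.mk.injEq] at hpq
        obtain ⟨h1, rfl⟩ := hpq
        rw [Fin.ext h1]⟩ := by
  ext ⟨i, j⟩
  simp only [YoungDiagram.mem_cells, Finset.mem_map, Finset.mem_sigma, Finset.mem_univ, true_and,
    Finset.mem_range, Sigma.exists, rows]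
  constructor
  · intro hc
    exact ⟨⟨i, lt_of_mem_of_colLen_le h hc⟩, j, YoungDiagram.mem_iff_lt_rowLen.1 hc, rfl⟩
  · rintro ⟨a, b, hab, heq⟩
    obtain ⟨rfl, rfl⟩ : (a : ℕ) = i ∧ b = j := Prod.mk.inj heq
    exact YoungDiagram.mem_iff_lt_rowLen.2 hab

lemma prod_cells {μ : YoungDiagram} {N : ℕ} (h : μ.colLen 0 ≤ N) (F : ℕ × ℕ → ℂ) :
    ∏ c ∈ μ.cells, F c = ∏ i : Fin N, ∏ j ∈ Finset.range (rows N μ i), F (i, j) := by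
  rw [cells_eq_map h, Finset.prod_map, Finset.prod_sigma]
  rfl

lemma card_eq_sum_rows {μ : YoungDiagram} {N : ℕ} (h : μ.colLen 0 ≤ N) :
    μ.card = ∑ i, rows N μ i := by
  rw [YoungDiagram.card, cells_eq_map h, Finset.card_map, Finset.card_sigma]
  simp

lemma mem_diagrams {d N : ℕ} {μ : YoungDiagram} :
    μ ∈ diagrams d N ↔ μ.card = d ∧ μ.colLen 0 ≤ N := by simp [diagrams]

lemma rows_injOn {N : ℕ} {μ ν : YoungDiagram} (hμ : μ.colLen 0 ≤ N) (hν : ν.colLen 0 ≤ N)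
    (h : rows N μ = rows N ν) : μ = ν := by
  apply YoungDiagram.ext
  ext ⟨i, j⟩
  rw [YoungDiagram.mem_cells, YoungDiagram.mem_cells]
  constructor
  · intro hc
    have := congrFun h ⟨i, lt_of_mem_of_colLen_le hμ hc⟩
    rw [YoungDiagram.mem_iff_lt_rowLen] at hc ⊢
    exact hc.trans_eq this
  · intro hc
    have := congrFun h ⟨i, lt_of_mem_of_colLen_le hν hc⟩
    rw [YoungDiagram.mem_iff_lt_rowLen] at hc ⊢
    exact hc.trans_eq this.symm

lemma exists_rows_eq {N : ℕ} {l : Fin N → ℕ} (hl : Antitone l) :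
    ∃ μ : YoungDiagram, μ.colLen 0 ≤ N ∧ rows N μ = l := by
  let s : Finset (ℕ × ℕ) := (Finset.univ.sigma fun i : Fin N => Finset.range (l i)).image
    fun p => ((p.1 : ℕ), p.2)
  have hs : ∀ i j, (i, j) ∈ s ↔ ∃ h : i < N, j < l ⟨i, h⟩ := by
    intro i j
    simp only [s, Finset.mem_image, Finset.mem_sigma, Finset.mem_univ, true_and,
      Finset.mem_range, Prod.mk.injEq, Sigma.exists]
    constructor
    · rintro ⟨a, b, hab, rfl, rfl⟩
      exact ⟨a.2, hab⟩
    · rintro ⟨h, hj⟩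
      exact ⟨⟨i, h⟩, j, hj, rfl, rfl⟩
  let μ : YoungDiagram := ⟨s, by
    rintro ⟨i, j⟩ ⟨i', j'⟩ hle hc
    obtain ⟨h1, h2⟩ := Prod.mk_le_mk.1 hle
    rw [Finset.mem_coe, hs] at hc ⊢
    obtain ⟨h, hj⟩ := hc
    exact ⟨lt_of_le_of_lt h1 h, lt_of_le_of_lt h2 (hj.trans_le (hl h1))⟩⟩
  have hμ : ∀ i j, (i, j) ∈ μ ↔ ∃ h : i < N, j < l ⟨i, h⟩ := hs
  refine ⟨μ, ?_, ?_⟩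
  · by_contra hlt
    have h1 : (N, 0) ∈ μ := YoungDiagram.mem_iff_lt_colLen.2 (not_le.1 hlt)
    rw [hμ] at h1
    exact lt_irrefl _ h1.1
  · ext i
    refine eq_of_forall_lt_iff fun j => ?_
    rw [rows, ← YoungDiagram.mem_iff_lt_rowLen, hμ]
    exact ⟨fun ⟨_, h⟩ => h, fun h => ⟨i.2, h⟩⟩

lemma sum_diagrams (d N : ℕ) (F : (Fin N → ℕ) → ℂ) :
    ∑ μ ∈ diagrams d N, F (rows N μ) = ∑ l ∈ parts N d, F l := by
  refine Finset.sum_bij (fun μ _ => rows N μ) (fun μ hμ => ?_) (fun μ hμ ν hν h => ?_)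
    (fun l hl => ?_) fun _ _ => rfl
  · obtain ⟨h1, h2⟩ := mem_diagrams.1 hμ
    exact mem_parts.2 ⟨rows_antitone N μ, by rw [← card_eq_sum_rows h2, h1]⟩
  · exact rows_injOn (mem_diagrams.1 hμ).2 (mem_diagrams.1 hν).2 h
  · obtain ⟨h1, h2⟩ := mem_parts.1 hl
    obtain ⟨μ, h3, h4⟩ := exists_rows_eq h1
    exact ⟨μ, mem_diagrams.2 ⟨by rw [card_eq_sum_rows h3, h4, h2], h3⟩, h4⟩

/-- The hook lengths in a row and the differences to the lower shifted parts fill an interval. -/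
lemma prod_hook_mul_prod_shifted_sub {μ : YoungDiagram} {N : ℕ} (h : μ.colLen 0 ≤ N)
    (i : Fin N) :
    (∏ j ∈ Finset.range (rows N μ i), hook μ (i, j))
      * ∏ k ∈ Finset.Ioi i, (shifted (rows N μ) i - shifted (rows N μ) k)
      = (shifted (rows N μ) i).factorial := by
  have hanti := shifted_strictAnti (rows_antitone N μ)
  have hN := i.2
  have hcol : ∀ j, j < μ.rowLen i → i < μ.colLen j ∧ μ.colLen j ≤ N := fun j hj =>
    ⟨lt_rowLen_iff_lt_colLen.1 hj, (μ.colLen_anti 0 j (Nat.zero_le _)).trans h⟩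
  have hinj1 : Set.InjOn (fun j => hook μ (i, j)) (Finset.range (rows N μ i)) := by
    have : StrictAntiOn (fun j => hook μ (i, j)) (Finset.range (rows N μ i)) := by
      intro j hj j' hj' hlt
      rw [Finset.mem_coe, Finset.mem_range, rows] at hj hj'
      have h1 := μ.colLen_anti j j' hlt.le
      have h2 := (hcol j' hj').1
      simp only [hook]
      omega
    exact this.injOn
  have hinj2 : Set.InjOn (fun k => shifted (rows N μ) i - shifted (rows N μ) k)
      (Finset.Ioi i : Finset (Fin N)) := by
    intro k hk k' hk' heq
    have h1 := hanti (Finset.mem_Ioi.1 (Finset.mem_coe.1 hk))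
    have h2 := hanti (Finset.mem_Ioi.1 (Finset.mem_coe.1 hk'))
    simp only at heq
    exact hanti.injective (by omega)
  have hdisj : Disjoint ((Finset.range (rows N μ i)).image fun j => hook μ (i, j))
      ((Finset.Ioi i).image fun k => shifted (rows N μ) i - shifted (rows N μ) k) := by
    rw [Finset.disjoint_left]
    rintro _ h1 h2
    obtain ⟨j, hj, rfl⟩ := Finset.mem_image.1 h1
    obtain ⟨k, hk, heq⟩ := Finset.mem_image.1 h2
    rw [Finset.mem_Ioi] at hk
    rw [Finset.mem_range, rows] at hj
    have h3 := hanti hk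
    obtain ⟨h4, h5⟩ := hcol j hj
    have hk2 := k.2
    have hk3 : (i : ℕ) < k := hk
    simp only [hook, shifted, rows] at heq h3
    rcases lt_or_ge (k : ℕ) (μ.colLen j) with h6 | h6
    · have h7 := lt_rowLen_iff_lt_colLen.2 h6
      omega
    · have h7 : ¬ j < μ.rowLen k := fun h7 => absurd (lt_rowLen_iff_lt_colLen.1 h7) (not_lt.2 h6)
      omega
  have hunion : ((Finset.range (rows N μ i)).image fun j => hook μ (i, j))
      ∪ ((Finset.Ioi i).image fun k => shifted (rows N μ) i - shifted (rows N μ) k)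
      = Finset.Icc 1 (shifted (rows N μ) i) := by
    refine Finset.eq_of_subset_of_card_le ?_ ?_
    · refine Finset.union_subset ?_ ?_
      · intro x hx
        obtain ⟨j, hj, rfl⟩ := Finset.mem_image.1 hx
        rw [Finset.mem_range, rows] at hj
        obtain ⟨h4, h5⟩ := hcol j hj
        rw [Finset.mem_Icc]
        simp only [hook, shifted, rows]
        omega
      · intro x hx
        obtain ⟨k, hk, rfl⟩ := Finset.mem_image.1 hx
        have h3 := hanti (Finset.mem_Ioi.1 hk)
        rw [Finset.mem_Icc]
        omega
    · rw [Finset.card_union_of_disjoint hdisj, Finset.card_image_of_injOn hinj1,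
        Finset.card_image_of_injOn hinj2, Finset.card_range, Fin.card_Ioi, Nat.card_Icc,
        shifted]
      omega
  rw [← Finset.prod_Ico_id_eq_factorial, Finset.Ico_add_one_right_eq_Icc, ← hunion, Finset.prod_union hdisj,
    Finset.prod_image hinj1, Finset.prod_image hinj2]

/-- The hook length formula, obtained from Frobenius' Vandermonde form row by row. Squaring removes
the sign due to the shifted parts being decreasing. -/
lemma dimv_rows_sq {μ : YoungDiagram} {N : ℕ} (h : μ.colLen 0 ≤ N) :
    dimv (rows N μ) ^ 2 = ∏ c ∈ μ.cells, 1 / (hook μ c : ℂ) ^ 2 := by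
  rw [prod_cells h, dimv, vdm, ← Finset.prod_div_distrib, ← Finset.prod_pow]
  refine Finset.prod_congr rfl fun i _ => ?_
  have h1 := congrArg (Nat.cast (R := ℂ)) (prod_hook_mul_prod_shifted_sub h i)
  have h2 : ((∏ k ∈ Finset.Ioi i, (shifted (rows N μ) i - shifted (rows N μ) k) : ℕ) : ℂ) ^ 2
      = (∏ k ∈ Finset.Ioi i, ((shifted (rows N μ) k : ℂ) - shifted (rows N μ) i)) ^ 2 := by
    rw [Nat.cast_prod, ← Finset.prod_pow, ← Finset.prod_pow]
    refine Finset.prod_congr rfl fun k hk => ?_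
    rw [Nat.cast_sub (shifted_strictAnti (rows_antitone N μ) (Finset.mem_Ioi.1 hk)).le]
    ring
  have h3 : ((shifted (rows N μ) i).factorial : ℂ) ≠ 0 :=
    Nat.cast_ne_zero.2 (Nat.factorial_ne_zero _)
  rw [Finset.prod_div_distrib, Finset.prod_const_one, Finset.prod_pow, div_pow, ← h2]
  rw [Nat.cast_mul] at h1
  have h4 : ((∏ j ∈ Finset.range (rows N μ i), hook μ (i, j) : ℕ) : ℂ) ≠ 0 :=
    left_ne_zero_of_mul (h1.trans_ne h3)
  rw [Nat.cast_prod] at h1 h4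
  rw [← h1] at h3 ⊢
  have h5 := right_ne_zero_of_mul h3
  field_simp

lemma dimv_zero_sq (N : ℕ) : dimv (0 : Fin N → ℕ) ^ 2 = 1 := by
  obtain ⟨μ, h1, h2⟩ := exists_rows_eq (N := N) (l := 0) fun _ _ _ => le_rfl
  rw [← h2, dimv_rows_sq h1, prod_cells h1, h2]
  simp

/-! ### The coefficient of the identity in terms of eigenvalues -/

/-- The conditional expectation keeps the coefficient of the identity and lets Y be pulled out. -/
lemma coeff_one_mul_jucys_pow {n : ℕ} {Y : PermAlg} (hY : condExp n Y = Y) (e : ℕ) :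
    (Y * jucys n ^ e).coeff 1 = (Y * moment n e).coeff 1 := by
  rw [← coeff_one_condExp n, condExp_mul_of_left hY, moment]

/-- The weight n!·dimv l·dimv (l + □) is the joint law of two consecutive steps of Plancherel
growth: replacing J_n^e by its moment multiplies the eigenvalue by a transition moment, whose
weights are dimv (l + □)/dimv l. -/
lemma PathEigen.coeff_one {N n : ℕ} (hn : n < N)
    (ih : ∀ {Y : PermAlg} {f : (Fin N → ℕ) → ℂ}, Eigen N n Y f →
      Y.coeff 1 = ∑ l ∈ parts N n, (n.factorial : ℂ) * dimv l ^ 2 * f l)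
    {Y : PermAlg} {F : (Fin N → ℕ) → Fin N → ℂ} (h : PathEigen (Eigen N n) n Y F) :
    Y.coeff 1 = ∑ l ∈ parts N n, ∑ i, (n.factorial : ℂ) * dimv l * dimv (addCell l i) * F l i := by
  induction h with
  | term Y f e h =>
    rw [coeff_one_mul_jucys_pow h.condExp_eq, ih (h.mul (eigen_moment hn e))]
    refine Finset.sum_congr rfl fun l hl => ?_
    have h0 := dimv_ne_zero (mem_parts.1 hl).1
    rw [transMoment, Finset.mul_sum, Finset.mul_sum]
    refine Finset.sum_congr rfl fun i _ => ?_
    field_simp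
  | add Y Y' F F' _ _ h h' =>
    rw [MonoidAlgebra.coeff_add, Finsupp.add_apply, h, h']
    simp only [← Finset.sum_add_distrib, mul_add]
  | congr Y F G _ hFG h =>
    rw [h]
    refine Finset.sum_congr rfl fun l hl => Finset.sum_congr rfl fun i _ => ?_
    by_cases hi : Antitone (addCell l i)
    · rw [hFG l hl i hi]
    · rw [dimv_addCell_eq_zero (mem_parts.1 hl).1 hi]
      ring

open Classical in
lemma sum_parts_sum_addCell {N n : ℕ} (G : (Fin N → ℕ) → (Fin N → ℕ) → ℂ) :
    ∑ l ∈ parts N n, ∑ i with Antitone (addCell l i), G l (addCell l i)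
      = ∑ m ∈ parts N (n + 1), ∑ i with 1 ≤ m i ∧ Antitone (removeCell m i),
        G (removeCell m i) m := by
  rw [Finset.sum_sigma', Finset.sum_sigma']
  refine Finset.sum_bij' (fun p _ => ⟨addCell p.1 p.2, p.2⟩)
    (fun p _ => ⟨removeCell p.1 p.2, p.2⟩) ?_ ?_ ?_ ?_ ?_
  · rintro ⟨l, i⟩ h
    simp only [Finset.mem_sigma, Finset.mem_filter, Finset.mem_univ, true_and] at h ⊢
    refine ⟨addCell_mem_parts h.1 h.2, by rw [addCell_self]; omega, ?_⟩
    rw [removeCell_addCell]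
    exact (mem_parts.1 h.1).1
  · rintro ⟨m, i⟩ h
    simp only [Finset.mem_sigma, Finset.mem_filter, Finset.mem_univ, true_and] at h ⊢
    obtain ⟨h1, h2, h3⟩ := h
    refine ⟨mem_parts.2 ⟨h3, ?_⟩, ?_⟩
    · have h4 := sum_addCell (removeCell m i) i
      rw [addCell_removeCell h2, (mem_parts.1 h1).2] at h4
      omega
    · rw [addCell_removeCell h2]
      exact (mem_parts.1 h1).1
  · rintro ⟨l, i⟩ _
    simp only [removeCell_addCell]
  · rintro ⟨m, i⟩ h
    simp only [Finset.mem_sigma, Finset.mem_filter, Finset.mem_univ, true_and] at h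
    simp only [addCell_removeCell h.2.1]
  · rintro ⟨l, i⟩ _
    simp only [removeCell_addCell]

lemma parts_zero (N : ℕ) : parts N 0 = {0} := by
  ext l
  rw [mem_parts, Finset.mem_singleton]
  constructor
  · rintro ⟨-, h⟩
    ext i
    exact (Finset.sum_eq_zero_iff.1 h) i (Finset.mem_univ i)
  · rintro rfl
    exact mem_parts.1 (zero_mem_parts N)

/-- The coefficient of the identity is a Plancherel average. In the inductive step the sum over
edges of Young's graph is regrouped by upper endpoint, and `sum_dimv_removeCell` supplies the factor
n + 1. -/
theorem Eigen.coeff_one {N : ℕ} : ∀ {n : ℕ}, n ≤ N → ∀ {Y : PermAlg} {f : (Fin N → ℕ) → ℂ},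
    Eigen N n Y f → Y.coeff 1 = ∑ l ∈ parts N n, (n.factorial : ℂ) * dimv l ^ 2 * f l
  | 0, _, Y, f, h => by
    have h' : Y = algebraMap ℂ PermAlg (f 0) := h
    rw [h', parts_zero, Finset.sum_singleton, dimv_zero_sq]
    simp
  | n + 1, hn, Y, f, h => by
    classical
    rw [PathEigen.coeff_one hn (fun h => Eigen.coeff_one (Nat.le_of_succ_le hn) h) h]
    have h1 : ∀ l ∈ parts N n, ∑ i, (n.factorial : ℂ) * dimv l * dimv (addCell l i)
        * f (addCell l i) = ∑ i with Antitone (addCell l i),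
          (n.factorial : ℂ) * dimv l * dimv (addCell l i) * f (addCell l i) := fun l hl => by
      rw [Finset.sum_filter]
      refine Finset.sum_congr rfl fun i _ => ?_
      split_ifs with hi
      · rfl
      · rw [dimv_addCell_eq_zero (mem_parts.1 hl).1 hi]
        ring
    rw [Finset.sum_congr rfl h1, sum_parts_sum_addCell fun l m =>
      (n.factorial : ℂ) * dimv l * dimv m * f m]
    refine Finset.sum_congr rfl fun m hm => ?_
    have h2 := sum_dimv_removeCell hm
    simp only [mul_assoc]
    rw [← Finset.mul_sum, ← Finset.sum_mul, h2, Nat.factorial_succ]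
    push_cast
    ring

/-! ### Complete symmetric polynomials in Jucys-Murphy elements -/

/-- The complete homogeneous symmetric polynomial of degree `r` in the Jucys-Murphy elements
`J_0, …, J_{n-1}`. -/
def completeSym : ℕ → ℕ → PermAlg
  | 0, r => if r = 0 then 1 else 0
  | n + 1, r => ∑ p ∈ Finset.HasAntidiagonal.antidiagonal r, completeSym n p.1 * jucys n ^ p.2

lemma completeSym_zero_right (n : ℕ) : completeSym n 0 = 1 := by
  induction n with
  | zero => simp [completeSym]
  | succ n ih => simp [completeSym, ih]

lemma completeSym_succ_succ (n r : ℕ) :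
    completeSym (n + 1) (r + 1) = completeSym n (r + 1) + completeSym (n + 1) r * jucys n := by
  rw [completeSym, Finset.Nat.sum_antidiagonal_succ', completeSym, Finset.sum_mul, pow_zero,
    mul_one]
  congr 1
  refine Finset.sum_congr rfl fun p _ => ?_
  rw [pow_succ, mul_assoc]

open Classical in
/-- The transpositions `(s n)` with `s < n`. -/
def natTransp (n : ℕ) : Finset (Equiv.Perm ℕ) :=
  (Finset.range n).image fun s => Equiv.swap s n

open Classical in
lemma coeff_completeSym (n : ℕ) :
    ∀ r g, (completeSym n r).coeff g = (monoCount natTransp n r g : ℂ) := by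
  have hone : ∀ g : Equiv.Perm ℕ, (1 : PermAlg).coeff g = ((if g = 1 then 1 else 0 : ℕ) : ℂ) := by
    intro g
    rw [MonoidAlgebra.one_def, MonoidAlgebra.coeff_single, Finsupp.single_apply]
    simp [eq_comm]
  induction n with
  | zero =>
    intro r g
    cases r with
    | zero => rw [completeSym_zero_right, monoCount_zero_right, hone]
    | succ r => rw [completeSym, if_neg r.succ_ne_zero, monoCount_zero_succ]; simp
  | succ n ihn =>
    intro r
    induction r with
    | zero => intro g; rw [completeSym_zero_right, monoCount_zero_right, hone]
    | succ r ihr =>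
      intro g
      rw [completeSym_succ_succ, monoCount_succ_succ, MonoidAlgebra.coeff_add, Finsupp.add_apply,
        ihn, jucys, Finset.mul_sum, MonoidAlgebra.coeff_sum, Finsupp.finsetSum_apply,
        natTransp, Finset.sum_image fun a _ b _ h => swap_left_injective n h]
      push_cast
      congr 1
      refine Finset.sum_congr rfl fun s _ => ?_
      rw [MonoidAlgebra.coeff_mul_single_apply, ihr, mul_one]

lemma swap_viaEmbedding {α β : Type*} [DecidableEq α] [DecidableEq β] (ι : α ↪ β) (a b : α) :
    (Equiv.swap a b).viaEmbedding ι = Equiv.swap (ι a) (ι b) := by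
  ext x
  by_cases hx : x ∈ Set.range ι
  · obtain ⟨y, rfl⟩ := hx
    rw [Equiv.Perm.viaEmbedding_apply, ι.injective.swap_apply]
  · rw [Equiv.Perm.viaEmbedding_apply_of_notMem _ _ _ hx, Equiv.swap_apply_of_ne_of_ne]
    · rintro rfl; exact hx ⟨a, rfl⟩
    · rintro rfl; exact hx ⟨b, rfl⟩

-- The embedding of S(d) into the permutations of ℕ carries each set of transpositions with a given
-- label below d to the corresponding one.
open Classical in
lemma monoCount_natTransp_one (d r : ℕ) :
    monoCount natTransp d r 1 = monoCount (transp d) d r 1 := by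
  have h := monoCount_map (Equiv.Perm.viaEmbeddingHom (Fin.valEmbedding (n := d)))
    (Equiv.Perm.viaEmbeddingHom_injective _) (S := transp d) (S' := natTransp) (m := d)
    (fun n hn => ?_) d le_rfl r 1
  · rwa [map_one] at h
  · ext σ
    rw [natTransp, transp, dif_pos hn, Finset.mem_image, Finset.mem_map]
    constructor
    · rintro ⟨s, hs, rfl⟩
      refine ⟨_, Finset.mem_image.2 ⟨⟨s, Finset.mem_range.1 hs⟩, Finset.mem_univ _, rfl⟩, ?_⟩
      exact swap_viaEmbedding _ _ _
    · rintro ⟨_, h, rfl⟩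
      obtain ⟨s, -, rfl⟩ := Finset.mem_image.1 h
      exact ⟨s, Finset.mem_range.2 s.2,
        (swap_viaEmbedding Fin.valEmbedding ⟨s, s.2.trans hn⟩ ⟨n, hn⟩).symm⟩

/-- The generating function of the complete symmetric polynomials in the contents. -/
def contentSeries {N : ℕ} (l : Fin N → ℕ) : PowerSeries ℂ :=
  ∏ i, ∏ j ∈ Finset.range (l i), PowerSeries.mk fun r => ((j : ℂ) - (i : ℕ)) ^ r

lemma contentSeries_addCell {N : ℕ} (l : Fin N → ℕ) (i : Fin N) :
    contentSeries (addCell l i)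
      = contentSeries l * PowerSeries.mk fun r => newContent l i ^ r := by
  rw [contentSeries, ← Finset.prod_erase_mul _ _ (Finset.mem_univ i), contentSeries,
    ← Finset.prod_erase_mul (a := i) _ _ (Finset.mem_univ i), addCell_self, Finset.prod_range_succ,
    ← mul_assoc]
  congr 2
  exact Finset.prod_congr rfl fun j hj => by rw [addCell_of_ne l (Finset.ne_of_mem_erase hj)]

lemma PathEigen.sum {N n : ℕ} {ι : Type*} (s : Finset ι) {Y : ι → PermAlg}
    {F : ι → (Fin N → ℕ) → Fin N → ℂ} (h : ∀ i ∈ s, PathEigen (Eigen N n) n (Y i) (F i)) :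
    PathEigen (Eigen N n) n (∑ i ∈ s, Y i) fun l j => ∑ i ∈ s, F i l j := by
  classical
  induction s using Finset.induction_on with
  | empty => simpa using PathEigen.of_eigen (n := n) (Eigen.const (N := N) 0 n)
  | insert a s ha ih =>
    simp only [Finset.sum_insert ha]
    exact (h a (Finset.mem_insert_self a s)).add _ _ _ _
      (ih fun i hi => h i (Finset.mem_insert_of_mem hi))

lemma eigen_completeSym {N : ℕ} : ∀ n r : ℕ,
    Eigen N n (completeSym n r) fun l => PowerSeries.coeff r (contentSeries l)
  | 0, r => by
    change completeSym 0 r = algebraMap ℂ PermAlg (PowerSeries.coeff r (contentSeries 0))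
    have h : contentSeries (0 : Fin N → ℕ) = 1 := by simp [contentSeries]
    rw [h, PowerSeries.coeff_one, completeSym]
    split_ifs
    · rw [map_one]
    · rw [map_zero]
  | n + 1, r => by
    change PathEigen (Eigen N n) n _ _
    rw [completeSym]
    refine .congr _ _ _ (PathEigen.sum _ fun p _ => .term _ _ p.2 (eigen_completeSym n p.1))
      fun l _ i _ => ?_
    simp only [contentSeries_addCell, PowerSeries.coeff_mul, PowerSeries.coeff_mk]

lemma monoCount_transp_one {d N : ℕ} (h : d ≤ N) (r : ℕ) :
    (monoCount (transp d) d r 1 : ℂ) = ∑ l ∈ parts N d,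
      (d.factorial : ℂ) * dimv l ^ 2 * PowerSeries.coeff r (contentSeries l) := by
  classical
  rw [← monoCount_natTransp_one, ← coeff_completeSym, (eigen_completeSym d r).coeff_one h]

/-! ### The character form of the coupling coefficients -/

/-- The power series `S` converges absolutely at `t` with value `c`. -/
def SumsTo (t : ℂ) (S : PowerSeries ℂ) (c : ℂ) : Prop :=
  Summable (fun r => ‖t ^ r * PowerSeries.coeff r S‖) ∧
    ∑' r, t ^ r * PowerSeries.coeff r S = c

lemma SumsTo.one (t : ℂ) : SumsTo t 1 1 := by
  have h : ∀ r, r ∉ ({0} : Finset ℕ) → t ^ r * PowerSeries.coeff r (1 : PowerSeries ℂ) = 0 := by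
    intro r hr
    rw [PowerSeries.coeff_one, if_neg (by simpa using hr), mul_zero]
  refine ⟨summable_of_ne_finset_zero (s := {0}) fun r hr => by rw [h r hr, norm_zero], ?_⟩
  rw [tsum_eq_sum h]
  simp

lemma SumsTo.mul {t : ℂ} {S T : PowerSeries ℂ} {c e : ℂ} (hS : SumsTo t S c)
    (hT : SumsTo t T e) : SumsTo t (S * T) (c * e) := by
  have h : ∀ r, t ^ r * PowerSeries.coeff r (S * T)
      = ∑ p ∈ Finset.HasAntidiagonal.antidiagonal r,
        (t ^ p.1 * PowerSeries.coeff p.1 S) * (t ^ p.2 * PowerSeries.coeff p.2 T) := fun r => by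
    rw [PowerSeries.coeff_mul, Finset.mul_sum]
    refine Finset.sum_congr rfl fun p hp => ?_
    rw [← Finset.HasAntidiagonal.mem_antidiagonal.1 hp, pow_add]
    ring
  constructor
  · exact (summable_norm_sum_mul_antidiagonal_of_summable_norm hS.1 hT.1).congr
      fun r => congrArg _ (h r).symm
  · rw [tsum_congr h, ← tsum_mul_tsum_eq_tsum_sum_antidiagonal_of_summable_norm hS.1 hT.1, hS.2,
      hT.2]

lemma SumsTo.prod {ι : Type*} {t : ℂ} (s : Finset ι) {S : ι → PowerSeries ℂ} {c : ι → ℂ}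
    (h : ∀ i ∈ s, SumsTo t (S i) (c i)) : SumsTo t (∏ i ∈ s, S i) (∏ i ∈ s, c i) := by
  classical
  induction s using Finset.induction_on with
  | empty => simpa using SumsTo.one t
  | insert a s ha ih =>
    rw [Finset.prod_insert ha, Finset.prod_insert ha]
    exact (h a (Finset.mem_insert_self a s)).mul
      (ih fun i hi => h i (Finset.mem_insert_of_mem hi))

lemma sumsTo_geometric {t a : ℂ} (h : ‖t * a‖ < 1) :
    SumsTo t (PowerSeries.mk fun r => a ^ r) (1 - t * a)⁻¹ := by
  simp only [SumsTo, PowerSeries.coeff_mk, ← mul_pow]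
  exact ⟨summable_norm_geometric_of_norm_lt_one h, tsum_geometric_of_norm_lt_one h⟩

/-- Each cell gives a geometric series of ratio −c/N, and |c| < N since d ≤ N. -/
lemma sumsTo_contentSeries {N d : ℕ} (hd : d ≤ N) {l : Fin N → ℕ} (hl : l ∈ parts N d) :
    SumsTo (-(N : ℂ)⁻¹) (contentSeries l)
      (∏ i, ∏ j ∈ Finset.range (l i), (1 + ((j : ℂ) - (i : ℕ)) / N)⁻¹) := by
  refine SumsTo.prod _ fun i _ => SumsTo.prod _ fun j hj => ?_
  have hi := i.2
  have h1 : l i ≤ d :=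
    (mem_parts.1 hl).2 ▸ Finset.single_le_sum (fun _ _ => Nat.zero_le _) (Finset.mem_univ i)
  have h2 := Finset.mem_range.1 hj
  have h3 : 1 + ((j : ℂ) - (i : ℕ)) / N = 1 - -(N : ℂ)⁻¹ * ((j : ℂ) - (i : ℕ)) := by
    rw [div_eq_mul_inv]; ring
  rw [h3]
  refine sumsTo_geometric ?_
  have hN : (0 : ℝ) < N := by exact_mod_cast (by omega : 0 < N)
  have h4 : |(j : ℤ) - (i : ℕ)| < N := by rw [abs_lt]; constructor <;> omega
  have h5 : ‖(j : ℂ) - (i : ℕ)‖ < N := by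
    have h6 : ((j : ℂ) - (i : ℕ)) = (((j : ℤ) - (i : ℕ) : ℤ) : ℂ) := by push_cast; ring
    rw [h6, Complex.norm_intCast]
    exact_mod_cast h4
  rwa [norm_mul, norm_neg, norm_inv, Complex.norm_natCast, ← div_eq_inv_mul, div_lt_one hN]

/-- The sum over Young diagrams in the coefficients of `I0`. -/
def diagramSum (N d : ℕ) : ℂ :=
  ∑ μ ∈ diagrams d N, ∏ c ∈ μ.cells,
    1 / ((hook μ c : ℂ) ^ 2 * (1 + (content c : ℂ) / (N : ℂ)))

lemma diagramSum_eq (N d : ℕ) : diagramSum N d = ∑ l ∈ parts N d,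
    dimv l ^ 2 * ∏ i, ∏ j ∈ Finset.range (l i), (1 + ((j : ℂ) - (i : ℕ)) / N)⁻¹ := by
  rw [← sum_diagrams, diagramSum]
  refine Finset.sum_congr rfl fun μ hμ => ?_
  have h := (mem_diagrams.1 hμ).2
  have h1 := prod_cells h fun c => (1 + ((c.2 : ℂ) - (c.1 : ℕ)) / N)⁻¹
  simp only at h1
  rw [dimv_rows_sq h, ← h1, ← Finset.prod_mul_distrib]
  refine Finset.prod_congr rfl fun c _ => ?_
  rw [content, one_div, mul_inv, one_div]
  push_cast
  rfl

/-- Summing h_r of the contents against (−1/N)^r gives ∏ 1/(1 + c/N) for each diagram; the squared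
dimension supplies the hooks. -/
lemma monoGen_transp_one {N d : ℕ} (hdN : d ≤ N) :
    monoGen (transp d) (-(N : ℂ)⁻¹) d 1 = d.factorial * diagramSum N d := by
  have h : ∀ r, (-(N : ℂ)⁻¹) ^ r * (monoCount (transp d) d r 1 : ℂ)
      = ∑ l ∈ parts N d, (d.factorial : ℂ) * dimv l ^ 2
        * ((-(N : ℂ)⁻¹) ^ r * PowerSeries.coeff r (contentSeries l)) := fun r => by
    rw [monoCount_transp_one hdN, Finset.mul_sum]
    exact Finset.sum_congr rfl fun l _ => by ring
  rw [monoGen, diagramSum_eq, Finset.mul_sum]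
  simp only [h]
  rw [Summable.tsum_finsetSum fun l hl => (sumsTo_contentSeries hdN hl).1.of_norm.mul_left _]
  refine Finset.sum_congr rfl fun l hl => ?_
  rw [tsum_mul_left, (sumsTo_contentSeries hdN hl).2, mul_assoc]

/-! ### Exponential growth bounds and the coupling coefficients for m = 0 -/

lemma card_diagrams_le (d N : ℕ) : (diagrams d N).card ≤ (2 ^ N) ^ d := by
  have h := sum_diagrams d N fun _ => 1
  simp only [Finset.sum_const, nsmul_eq_mul, mul_one, Nat.cast_inj] at h
  rw [h]
  calc (parts N d).card ≤ (Fintype.piFinset fun _ : Fin N => Finset.range (d + 1)).card :=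
        Finset.card_le_card (Finset.filter_subset _ _)
    _ = (d + 1) ^ N := by simp
    _ ≤ (2 ^ d) ^ N := Nat.pow_le_pow_left (Nat.lt_two_pow_self) N
    _ = (2 ^ N) ^ d := by rw [← pow_mul, ← pow_mul, mul_comm]

/-- At most N rows means c ≥ 1 − N, so 1 + c/N ≥ 1/N; hooks are at least 1. The crude bound is
enough for a positive radius of convergence. -/
lemma norm_diagramSum_le (N d : ℕ) : ‖diagramSum N d‖ ≤ ((2 ^ N : ℝ) * N) ^ d := by
  have h : ∀ μ ∈ diagrams d N, ‖∏ c ∈ μ.cells,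
      1 / ((hook μ c : ℂ) ^ 2 * (1 + (content c : ℂ) / (N : ℂ)))‖ ≤ (N : ℝ) ^ d := by
    intro μ hμ
    obtain ⟨h1, h2⟩ := mem_diagrams.1 hμ
    have h3 : μ.cells.card = d := h1
    rw [norm_prod, ← h3, ← Finset.prod_const]
    refine Finset.prod_le_prod (fun _ _ => norm_nonneg _) fun c hc => ?_
    have hcN := lt_of_mem_of_colLen_le h2 ((YoungDiagram.mem_cells _).1 hc)
    have hN : (0 : ℝ) < N := by exact_mod_cast (by omega : 0 < N)
    have h4 : (1 : ℝ) ≤ ‖(hook μ c : ℂ) ^ 2‖ := by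
      rw [norm_pow, Complex.norm_natCast]
      have : (1 : ℝ) ≤ hook μ c := by exact_mod_cast (by rw [hook]; omega : 1 ≤ hook μ c)
      exact one_le_pow₀ this
    have h5 : (1 : ℝ) / N ≤ ‖1 + (content c : ℂ) / (N : ℂ)‖ := by
      have h6 : (1 : ℝ) ≤ N + content c := by
        exact_mod_cast (by rw [content]; omega : (1 : ℤ) ≤ N + content c)
      have h7 : 1 + (content c : ℂ) / (N : ℂ) = (((N + content c) / N : ℝ) : ℂ) := by
        have hN' : (N : ℂ) ≠ 0 := by exact_mod_cast hN.ne'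
        push_cast
        rw [add_div, div_self hN']
      rw [h7, Complex.norm_real]
      exact (div_le_div_of_nonneg_right h6 hN.le).trans (le_abs_self _)
    rw [norm_div, norm_one, norm_mul]
    have h8 : (1 : ℝ) / N ≤ ‖(hook μ c : ℂ) ^ 2‖ * ‖1 + (content c : ℂ) / (N : ℂ)‖ :=
      h5.trans (le_mul_of_one_le_left (norm_nonneg _) h4)
    calc (1 : ℝ) / _ ≤ 1 / (1 / N) := one_div_le_one_div_of_le (by positivity) h8
      _ = N := one_div_one_div _
  calc ‖diagramSum N d‖ ≤ ∑ μ ∈ diagrams d N, (N : ℝ) ^ d := norm_sum_le_of_le _ h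
    _ = ((diagrams d N).card : ℝ) * (N : ℝ) ^ d := by rw [Finset.sum_const, nsmul_eq_mul]
    _ ≤ ((2 ^ N) ^ d : ℝ) * (N : ℝ) ^ d :=
        mul_le_mul_of_nonneg_right (by exact_mod_cast card_diagrams_le d N) (by positivity)
    _ = _ := (mul_pow _ _ _).symm

lemma couplingCoeff_I0 {N : ℕ} (hN : 1 ≤ N) (d : ℕ) :
    couplingCoeff (I0 N) d = d.factorial * ((N : ℂ) ^ (2 * d) * diagramSum N d) := by
  have hN' : (0 : ℝ) < N := by exact_mod_cast hN
  set K : ℝ := (N : ℝ) ^ 2 * (2 ^ N * N) with hK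
  have hK0 : 0 < K := by positivity
  refine couplingCoeff_eq (c := fun n => (N : ℂ) ^ (2 * n) * diagramSum N n)
    (inv_pos.2 hK0) (fun z hz => ?_) d
  have hz' : ‖z‖ * K < 1 := by rwa [← lt_div_iff₀ hK0, one_div]
  have hs : Summable fun n => z ^ n * ((N : ℂ) ^ (2 * n) * diagramSum N n) := by
    refine Summable.of_norm_bounded
      (summable_geometric_of_lt_one (by positivity) hz') fun n => ?_
    rw [norm_mul, norm_mul, norm_pow, norm_pow, Complex.norm_natCast, mul_pow, hK, mul_pow,
      ← pow_mul]
    exact mul_le_mul_of_nonneg_left (mul_le_mul_of_nonneg_left (norm_diagramSum_le N n)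
      (by positivity)) (by positivity)
  have h : I0 N z = ∑' n, z ^ n * ((N : ℂ) ^ (2 * n) * diagramSum N n) := by
    simp only [I0, mul_assoc]
    rfl
  rw [h]
  exact hs.hasSum

lemma len_ones (d : ℕ) : len (ones d) = d := Multiset.card_replicate d 1

/-- For α = β = 1^d both fibres reduce to the identity, so only the value of the inverse at 1
remains; the sign of (−N)^(2d) is trivial. -/
lemma hasSum_topCoeff0 {N d : ℕ} (hd : 1 ≤ d) (hdN : d ≤ N) :
    HasSum (fun g : Genus d => (N : ℂ) ^ (2 - 2 * g.1) * topCoeff0 d g.1)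
      (couplingCoeff (I0 N) d) := by
  have h := hasSum_doubleHurwitz hd hdN (ones d) (ones d)
  simp only [typ_eq_ones_iff, Finset.sum_filter, Finset.sum_ite_eq', Finset.mem_univ, if_true,
    inv_one, mul_one, len_ones, monoGen_transp_one hdN] at h
  rw [couplingCoeff_I0 (hd.trans hdN)]
  have h1 : (d.factorial : ℂ) * ((N : ℂ) ^ (2 * d) * diagramSum N d)
      = (-(N : ℂ)) ^ (d + d) * (d.factorial * diagramSum N d) := by
    rw [← two_mul, pow_mul, pow_mul, neg_sq]
    ring
  rw [h1]
  exact h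

end TopExpansion

end

theorem mainTheorem5 (N d : ℕ) (hd : 1 ≤ d) (hdN : d ≤ N) :
    -- m = 0
    (Summable (fun g : TopExpansion.Genus d =>
        ‖(N : ℂ) ^ (2 - 2 * g.1) * TopExpansion.topCoeff0 d g.1‖) ∧
      HasSum (fun g : TopExpansion.Genus d =>
          (N : ℂ) ^ (2 - 2 * g.1) * TopExpansion.topCoeff0 d g.1)
        (TopExpansion.couplingCoeff (TopExpansion.I0 N) d)) ∧
    -- m = 1 (BGW)
    ((∀ g : TopExpansion.Genus d, (TopExpansion.topCoeff1 N d g.1).IsHomogeneous d) ∧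
      Summable (fun g : TopExpansion.Genus d =>
        (N : ℝ) ^ (2 - 2 * g.1) * TopExpansion.polydiscNorm (TopExpansion.topCoeff1 N d g.1)) ∧
      ∀ (A B : Matrix (Fin N) (Fin N) ℂ) (a : Fin N → ℂ), TopExpansion.IsSpectrum (A * B) a →
        HasSum (fun g : TopExpansion.Genus d =>
            (N : ℂ) ^ (2 - 2 * g.1) * MvPolynomial.eval a (TopExpansion.topCoeff1 N d g.1))
          (TopExpansion.couplingCoeff (TopExpansion.BGW N A B) d)) ∧
    -- m = 2 (HCIZ)
    ((∀ g : TopExpansion.Genus d,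
        (TopExpansion.topCoeff2 N d g.1).IsWeightedHomogeneous
            (Sum.elim (fun _ => 1) (fun _ => 0) : Fin N ⊕ Fin N → ℕ) d ∧
        (TopExpansion.topCoeff2 N d g.1).IsWeightedHomogeneous
            (Sum.elim (fun _ => 0) (fun _ => 1) : Fin N ⊕ Fin N → ℕ) d) ∧
      Summable (fun g : TopExpansion.Genus d =>
        (N : ℝ) ^ (2 - 2 * g.1) * TopExpansion.polydiscNorm (TopExpansion.topCoeff2 N d g.1)) ∧
      ∀ (A B : Matrix (Fin N) (Fin N) ℂ) (a b : Fin N → ℂ),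
        TopExpansion.IsSpectrum A a → TopExpansion.IsSpectrum B b →
        HasSum (fun g : TopExpansion.Genus d =>
            (N : ℂ) ^ (2 - 2 * g.1) *
              MvPolynomial.eval (Sum.elim a b) (TopExpansion.topCoeff2 N d g.1))
          (TopExpansion.couplingCoeff (TopExpansion.HCIZ N A B) d)) := by
  open TopExpansion in
  -- Unconditional summability of complex numbers is absolute.
  refine ⟨⟨(hasSum_topCoeff0 hd hdN).summable.norm, hasSum_topCoeff0 hd hdN⟩,
    ⟨fun g => topCoeff1_isHomogeneous g.1, summable_polydiscNorm_topCoeff1 hd hdN,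
      hasSum_topCoeff1 hd hdN⟩,
    ⟨fun g => ⟨?_, ?_⟩, summable_polydiscNorm_topCoeff2 hd hdN, hasSum_topCoeff2 hd hdN⟩⟩
  -- The weights (1, 0) and (0, 1) measure the degree in the a-variables and in the b-variables
  -- respectively.
  · simpa using TopExpansion.topCoeff2_isWeightedHomogeneous (N := N) (d := d) g.1 (k := 1) (l := 0)
  · simpa using TopExpansion.topCoeff2_isWeightedHomogeneous (N := N) (d := d) g.1 (k := 0) (l := 1)
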